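/- **Setting.** Let $(\mathcal S,\mathcal T)$ be a measurable space with countably generated $\sigma$-algebra, and let $(x_n)_{n\in\mathbb Z}$ be a stationary Markov chain on $\mathcal S$ with transition kernel $H$ and stationary law $\pi$. Let $\omega:\mathcal S\to(0,1)$ be measurable and $\rho(x)=(1-\omega(x))/\omega(x)$. The random environment is $\omega_{-n}=\omega(x_n)$, $n\in\mathbb Z$; let $P$ denote its law on $(0,1)^{\mathbb Z}$ (and, with the same letter, the law of the chain), and put $\rho_n=(1-\omega_n)/\omega_n$. Given the environment, $X=(X_n)_{n\ge 0}$ is the Markov chain on $\mathbb Z$ with $X_0=0$ that jumps from $i$ to $i+1$ with probability $\omega_i$ and to $i-1$ with probability $1-\omega_i$; $P_\omega$ is its law and $\mathbb P=P\otimes P_\omega$ is the annealed law. **Assumptions.** (A1) Either $\mathcal S$ is finite (with the discrete $\sigma$-algebra) and the chain is irreducible, or there are $c\ge 1$, $m\in\mathbb N$ and a probability measure $\psi$ on $\mathcal S$ with $c^{-1}\psi(A)\le H^m(x,A)\le c\,\psi(A)$ for all $x\in\mathcal S$, $A\in\mathcal T$. (A2) $P(\varepsilon<\omega_0<1-\varepsilon)=1$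 for some $\varepsilon\in(0,1/2)$. (A3) $\limsup_{n}\frac1n\log E_P\big(\prod_{i=0}^{n-1}\rho_i^{\beta}\big)<0$ and $\limsup_{n}\frac1n\log E_P\big(\prod_{i=0}^{n-1}\rho_i^{\beta'}\big)\ge 0$ for some $\beta,\beta'>0$. (A4) There is no largest number among the $\alpha>0$ for which there is a measurable $\gamma:\mathcal S\to[0,\alpha)$ with $P\big(\log\rho_0\in\gamma(x_{-1})-\gamma(x_0)+\alpha\mathbb Z\big)=1$ (in particular this holds if no such $\alpha$ exists). **Statement.** There is exactly one $\kappa>0$ such that $\lim_{n}\frac1n\log E_P\big(\prod_{i=0}^{n-1}\rho_i^{\kappa}\big)$ exists and equals $0$. There is a constant $v_P\in\mathbb R$ such that $X_n/n\to v_P$, $\mathbb P$-almost surely, and: * if $\kappa\le 1$, then $v_P=0$; * if $\kappa>1$, then $v_P>0$, and the equation $$\xi(x)=\int_{\mathcal S}H(x,dy)\,\rho(y)\,\xi(y)+1+\frac1{\rho(x)}\qquad(\ast)$$ has a bounded measurable solution $\xi:\mathcal S\to(0,\infty)$, where $(\ast)$ is required for $\pi$-almost every $x$; it is unique up to $\pi$-null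 sets, and $$v_P^{-1}=E_P\big(\rho(x_0)\,\xi(x_0)\big)<\infty .$$ If moreover the ellipticity bounds hold at every state, i.e. $\varepsilon<\omega(x)<1-\varepsilon$ for all $x\in\mathcal S$ and some $\varepsilon>0$, then there is exactly one bounded measurable $\xi:\mathcal S\to(0,\infty)$ that satisfies $(\ast)$ for every $x\in\mathcal S$ (so the formula for $v_P^{-1}$ holds with it). -/

import Mathlib

open MeasureTheory ProbabilityTheory Filter Topology

namespace RWRE

/-- The space of environments `(0,1)^ℤ`, with its product (= Borel) σ-algebra. -/
abbrev Env : Type := ℤ → Set.Ioo (0 : ℝ) 1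

/-- `r(a) = (1 - a) / a`, so that `ρ_n = ratio (ω_n)`. -/
noncomputable def ratio (a : Set.Ioo (0 : ℝ) 1) : ℝ := (1 - (a : ℝ)) / (a : ℝ)

/-! ### The random walk in a random environment -/

/-- One step of the walk from the site `i`: to `i + 1` with probability `ω_i` and to `i - 1` with
probability `1 - ω_i`. -/
noncomputable def stepLaw (ω : Env) (i : ℤ) : Measure ℤ :=
  ENNReal.ofReal (ω i : ℝ) • Measure.dirac (i + 1) +
    ENNReal.ofReal (1 - (ω i : ℝ)) • Measure.dirac (i - 1)

instance isProbabilityMeasure_stepLaw (ω : Env) (i : ℤ) : IsProbabilityMeasure (stepLaw ω i) := by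
  have h := (ω i).2
  refine ⟨?_⟩
  simp only [stepLaw, Measure.add_apply, Measure.smul_apply, measure_univ, smul_eq_mul, mul_one]
  rw [← ENNReal.ofReal_add h.1.le (by linarith [h.2])]
  simp

lemma measurable_stepLaw_apply (i : ℤ) (s : Set ℤ) :
    Measurable fun ω : Env => stepLaw ω i s := by
  simp only [stepLaw, Measure.add_apply, Measure.smul_apply, smul_eq_mul]
  fun_prop

/-- The transition kernel of the walk in the environment `ω`, as a kernel from paths up to time
`n`; only the current position `h_n` matters. -/
noncomputable def stepKernel (ω : Env) (n : ℕ) : Kernel (Finset.Iic n → ℤ) ℤ :=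
  Kernel.ofFunOfCountable fun h => stepLaw ω (h ⟨n, Finset.mem_Iic.2 le_rfl⟩)

instance isMarkovKernel_stepKernel (ω : Env) (n : ℕ) : IsMarkovKernel (stepKernel ω n) :=
  ⟨fun h => isProbabilityMeasure_stepLaw ω (h ⟨n, Finset.mem_Iic.2 le_rfl⟩)⟩

/-- The quenched law `P_ω` on paths: the law of the Markov chain on `ℤ` started at `0` that moves
according to `stepLaw ω`. -/
noncomputable def quenchedLaw (ω : Env) : Measure (ℕ → ℤ) :=
  Kernel.traj (X := fun _ => ℤ) (stepKernel ω) 0 (fun _ => 0)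

instance isProbabilityMeasure_quenchedLaw (ω : Env) : IsProbabilityMeasure (quenchedLaw ω) := by
  unfold quenchedLaw
  infer_instance

lemma measurable_partialTraj_succ (n : ℕ) (y : Finset.Iic n → ℤ)
    (s : Set (Finset.Iic (n + 1) → ℤ)) :
    Measurable fun ω : Env =>
      Kernel.partialTraj (X := fun _ => ℤ) (stepKernel ω) n (n + 1) y s := by
  have hs : MeasurableSet s := (Set.to_countable s).measurableSet
  have key : ∀ ω : Env, Kernel.partialTraj (X := fun _ => ℤ) (stepKernel ω) n (n + 1) y s
      = stepLaw ω (y ⟨n, Finset.mem_Iic.2 le_rfl⟩)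
        ((fun j => IicProdIoc (X := fun _ => ℤ) n (n + 1)
          (y, MeasurableEquiv.piSingleton (X := fun _ => ℤ) n j)) ⁻¹' s) := by
    intro ω
    rw [Kernel.partialTraj_succ_self, Kernel.map_apply' _ (by fun_prop) _ hs,
      Kernel.prod_apply, Kernel.id_apply, Measure.dirac_prod,
      Measure.map_apply (by fun_prop) (measurableSet_preimage (by fun_prop) hs),
      Kernel.map_apply' _ (by fun_prop) _ (Set.to_countable _).measurableSet]
    rfl
  simp_rw [key]
  exact measurable_stepLaw_apply _ _

lemma measurable_partialTraj (n : ℕ) (s : Set (Finset.Iic n → ℤ)) :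
    Measurable fun ω : Env =>
      Kernel.partialTraj (X := fun _ => ℤ) (stepKernel ω) 0 n (fun _ => 0) s := by
  induction n with
  | zero => simp only [Kernel.partialTraj_self, Kernel.id_apply]; exact measurable_const
  | succ n ih =>
    have hs : MeasurableSet s := (Set.to_countable s).measurableSet
    simp_rw [Kernel.partialTraj_succ_eq_comp (X := fun _ => ℤ) (Nat.zero_le n),
      Kernel.comp_apply' _ _ _ hs, lintegral_countable']
    exact Measurable.tsum fun y => (measurable_partialTraj_succ n y s).mul (ih {y})

lemma measurable_quenchedLaw : Measurable quenchedLaw := by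
  refine Measurable.measure_of_isPiSystem_of_isProbabilityMeasure
    (S := measurableCylinders fun _ : ℕ => ℤ) generateFrom_measurableCylinders.symm
    isPiSystem_measurableCylinders ?_
  intro s hs
  rw [measurableCylinders_nat] at hs
  simp only [Set.mem_iUnion, Set.mem_singleton_iff] at hs
  obtain ⟨n, B, hB, rfl⟩ := hs
  have key : ∀ ω : Env, quenchedLaw ω (cylinder (Finset.Iic n) B)
      = Kernel.partialTraj (X := fun _ => ℤ) (stepKernel ω) 0 n (fun _ => 0) B := by
    intro ω
    rw [← Kernel.traj_map_frestrictLe_apply, Measure.map_apply (by fun_prop) hB]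
    rfl
  simp_rw [key]
  exact measurable_partialTraj n B

/-- The quenched laws as a kernel from environments to paths. -/
noncomputable def quenchedKernel : Kernel Env (ℕ → ℤ) := ⟨quenchedLaw, measurable_quenchedLaw⟩

instance isMarkovKernel_quenchedKernel : IsMarkovKernel quenchedKernel :=
  ⟨isProbabilityMeasure_quenchedLaw⟩

/-- The annealed law `ℙ = P ⊗ P_ω` of `(ω, X)`: `ℙ(F × G) = ∫_F P_ω(G) P(dω)`. -/
noncomputable def annealed (P : Measure Env) : Measure (Env × (ℕ → ℤ)) := P ⊗ₘ quenchedKernel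

/-- `v` is the speed `v_P` of the walk: `X_n / n → v`, `ℙ`-almost surely. -/
def IsSpeed (P : Measure Env) (v : ℝ) : Prop :=
  ∀ᵐ z ∂(annealed P), Tendsto (fun n : ℕ => (z.2 n : ℝ) / n) atTop (𝓝 v)

/-! ### The exponent `κ` -/

/-- `(1/n) log E_P (∏_{i=0}^{n-1} ρ_i^β)`. -/
noncomputable def logMoment (P : Measure Env) (β : ℝ) (n : ℕ) : ℝ :=
  1 / (n : ℝ) * Real.log (∫ ω, ∏ i ∈ Finset.range n, ratio (ω (i : ℤ)) ^ β ∂P)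

/-- `κ > 0` and `Λ(κ) = lim_n (1/n) log E_P (∏_{i=0}^{n-1} ρ_i^κ)` exists and is `0`. -/
def IsIndex (P : Measure Env) (κ : ℝ) : Prop :=
  0 < κ ∧ Tendsto (logMoment P κ) atTop (𝓝 0)

/-! ### Markov environments -/

section Markov

variable {S Ω : Type*} [MeasurableSpace S] [MeasurableSpace Ω]

/-- `(x_n)_{n ∈ ℤ}` is, under `μ`, a stationary Markov chain with transition kernel `H` whose
one-dimensional marginals are all `π`. -/
structure IsStationaryMarkovChain (H : Kernel S S) (π : Measure S) (μ : Measure Ω)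
    (x : ℤ → Ω → S) : Prop where
  measurable : ∀ n, Measurable (x n)
  map_eq : ∀ n, μ.map (x n) = π
  markov : ∀ (n : ℤ) (A : Set S), MeasurableSet A →
    μ⟦x (n + 1) ⁻¹' A | ⨆ k : Set.Iic n, MeasurableSpace.comap (x k) inferInstance⟧
      =ᵐ[μ] fun w => (H (x n w)).real A

/-- The environment `ω_n = θ(x_{-n})`. -/
def markovEnv (θ : S → Set.Ioo (0 : ℝ) 1) (x : ℤ → Ω → S) (w : Ω) : Env :=
  fun n => θ (x (-n) w)

/-- The law `P` of the environment `ω_n = θ(x_{-n})`. -/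
noncomputable def envLaw (θ : S → Set.Ioo (0 : ℝ) 1) (μ : Measure Ω) (x : ℤ → Ω → S) :
    Measure Env :=
  μ.map (markovEnv θ x)

/-- The numbers `α > 0` such that, for some measurable `γ : S → [0, α)`, almost surely
`log ρ_0 ∈ γ(x_{-1}) - γ(x_0) + αℤ`. -/
def arithmeticSpans (θ : S → Set.Ioo (0 : ℝ) 1) (μ : Measure Ω) (x : ℤ → Ω → S) : Set ℝ :=
  {α | 0 < α ∧ ∃ γ : S → ℝ, Measurable γ ∧ (∀ s, γ s ∈ Set.Ico 0 α) ∧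
    ∀ᵐ w ∂μ, ∃ k : ℤ, Real.log (ratio (θ (x 0 w))) = γ (x (-1) w) - γ (x 0 w) + α * k}

/-- The process `log ρ_{-n}` is `α`-arithmetic: `α` is the largest such number. -/
def IsArithmetic (θ : S → Set.Ioo (0 : ℝ) 1) (μ : Measure Ω) (x : ℤ → Ω → S) (α : ℝ) : Prop :=
  IsGreatest (arithmeticSpans θ μ x) α

/-- Finite (discrete) state space and irreducible chain. -/
def FiniteIrreducible (H : Kernel S S) : Prop :=
  Finite S ∧ MeasurableSingletonClass S ∧ ∀ s t : S, ∃ n : ℕ, 0 < (H ^ n) s {t}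

/-- Some power of `H` is bounded above and below by multiples of one probability measure. -/
def UniformlyDominated (H : Kernel S S) : Prop :=
  ∃ (c : ℝ) (ψ : Measure S) (m : ℕ), 1 ≤ c ∧ IsProbabilityMeasure ψ ∧
    ∀ (s : S) (A : Set S), MeasurableSet A →
      ENNReal.ofReal c⁻¹ * ψ A ≤ (H ^ m) s A ∧ (H ^ m) s A ≤ ENNReal.ofReal c * ψ A

/-- The standing assumptions (A1)-(A4) on the Markov environment. -/
structure StandingAssumption (H : Kernel S S) (θ : S → Set.Ioo (0 : ℝ) 1) (μ : Measure Ω)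
    (x : ℤ → Ω → S) : Prop where
  a1 : FiniteIrreducible H ∨ UniformlyDominated H
  a2 : ∃ ε ∈ Set.Ioo (0 : ℝ) (1 / 2),
    ∀ᵐ ω ∂(envLaw θ μ x), ε < (ω 0 : ℝ) ∧ (ω 0 : ℝ) < 1 - ε
  a3_neg : ∃ β > 0, limsup (logMoment (envLaw θ μ x) β) atTop < 0
  a3_nonneg : ∃ β > 0, 0 ≤ limsup (logMoment (envLaw θ μ x) β) atTop
  a4 : ¬ ∃ α, IsArithmetic θ μ x α

/-! ### The speed equation -/

/-- `ξ : S → (0, ∞)` is measurable and bounded. -/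
def IsPosBounded (ξ : S → ℝ) : Prop :=
  Measurable ξ ∧ (∀ s, 0 < ξ s) ∧ ∃ C, ∀ s, ξ s ≤ C

/-- The equation `ξ(s) = ∫ H(s,dy) ρ(y) ξ(y) + 1 + 1/ρ(s)` at the state `s`. -/
def SolvesAt (H : Kernel S S) (θ : S → Set.Ioo (0 : ℝ) 1) (ξ : S → ℝ) (s : S) : Prop :=
  ξ s = (∫ y, ratio (θ y) * ξ y ∂(H s)) + 1 + 1 / ratio (θ s)

end Markov

end RWRE

/-! Assumption (A1) enters through two facts: a power of `H` is dominated by a multiple of `π`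
(`exists_pow_le_mul`), and a finite sum of powers is minorized by one (`exists_mul_le_sum_pow`).
Minorization makes the shift ergodic for the law of the environment (`ergodic_shift`). Domination
makes the moments `E ∏ ρ_i^β` submultiplicative up to a constant, so Fekete's lemma gives the rate
`Λ(β)` for `β ≥ 0`. By Hölder `Λ` is convex, `Λ(0) = 0`, and (A3) leaves exactly one positive zero
`κ`. On `(0, κ)` the moments decay geometrically. From `κ` on their series diverges, even at `κ`
itself, because Fekete's limit is an infimum.

The speed comes from a coordinate in which the walk has drift one. Let `f(ω) = ∑_l ω_{-l}⁻¹ ρ_{-l+1}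
⋯ ρ_0`, the mean time to go from `0` to `1`, and let `h` have increment `f` seen from `i` between
`i` and `i + 1`. Then `Lh = 1`, so `h(X_n) - n` is a martingale.

If `κ > 1`, then `E f < ∞`. Birkhoff's theorem gives `h(n)/n → E f`, the martingale law of large
numbers gives `h(X_n)/n → 1`, and so `X_n/n → 1 / E f`. The martingale law needs `∑_i (f_i/(|i|+1))²
g_i < ∞`, where `g_i` bounds the Green function at `i`. Truncating the ratios at `1` reduces this to
`E (f g) < ∞`. The products in `f` end at site `0` and those in `g` start at site `1`, so they
concatenate to products over a single block, and only `Λ(1) < 0` is needed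
(`isSpeed_inv_lintegral_crossingTime`).

If `κ ≤ 1`, the truncated series `f_K` are bounded and give drift at most one, whence `limsup X_n/n
≤ 1 / E f_K`, and `E f_K → ∞`. Moments of an order below `κ` and Borel–Cantelli bound the walk from
below, so the speed is `0` (`isSpeed_zero`).

Site `-n` carries `ρ(x_n)`, so `f` reads the chain forward from `x_0`. With `K g = ∫ H(·, dy) ρ(y)
g(y)`, the Markov property gives `E f = ∫ ρ ξ dπ` for the Neumann series `ξ = ∑ Kⁿ(1 + 1/ρ)`, which
solves the equation. The geometric decay of `∫ Kⁿ1 dπ` and domination make it bounded. The absolute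
difference `e` of two bounded solutions satisfies `e ≤ Kⁿ e`, hence vanishes. Almost sure
ellipticity is first made to hold everywhere by changing `θ` on a `π`-null set. -/

namespace RWRE

set_option linter.unusedSectionVars false

/-! ### Birkhoff's pointwise ergodic theorem for ergodic maps -/

section Birkhoff

variable {α : Type*}

/-- The maximum of `0` and of the first `N` Birkhoff sums of `f`. -/
def maxBirkhoffSum (T : α → α) (f : α → ℝ) : ℕ → α → ℝ
  | 0, _ => 0
  | N + 1, x => max 0 (f x + maxBirkhoffSum T f N (T x))

lemma maxBirkhoffSum_nonneg (T : α → α) (f : α → ℝ) (N : ℕ) (x : α) :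
    0 ≤ maxBirkhoffSum T f N x := by
  cases N <;> simp [maxBirkhoffSum]

lemma maxBirkhoffSum_le_succ (T : α → α) (f : α → ℝ) (N : ℕ) (x : α) :
    maxBirkhoffSum T f N x ≤ maxBirkhoffSum T f (N + 1) x := by
  induction N generalizing x with
  | zero => exact maxBirkhoffSum_nonneg T f 1 x
  | succ N ih =>
    exact max_le_max le_rfl (add_le_add_right (ih (T x)) (f x))

lemma birkhoffSum_le_maxBirkhoffSum (T : α → α) (f : α → ℝ) (N : ℕ) (x : α) :
    birkhoffSum T f N x ≤ maxBirkhoffSum T f N x := by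
  induction N generalizing x with
  | zero => simp [maxBirkhoffSum]
  | succ N ih =>
    rw [birkhoffSum_succ']
    exact le_max_of_le_right (by linarith [ih (T x)])

/-- Garsia's pointwise inequality. Where the maximum is positive it is attained by a nonempty sum,
which is `f x` plus at most the maximum at `T x`. Elsewhere the left side is at most `0`. -/
lemma maxBirkhoffSum_sub_le (T : α → α) (f : α → ℝ) (N : ℕ) (x : α) :
    maxBirkhoffSum T f N x - maxBirkhoffSum T f N (T x)
      ≤ {y | 0 < maxBirkhoffSum T f N y}.indicator f x := by
  by_cases hx : 0 < maxBirkhoffSum T f N x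
  · rw [Set.indicator_of_mem (show x ∈ {y | 0 < maxBirkhoffSum T f N y} from hx)]
    cases N with
    | zero => simp [maxBirkhoffSum] at hx
    | succ N =>
      have h1 : maxBirkhoffSum T f (N + 1) x = f x + maxBirkhoffSum T f N (T x) := by
        simp only [maxBirkhoffSum] at hx ⊢
        rcases max_choice 0 (f x + maxBirkhoffSum T f N (T x)) with h | h
        · rw [h] at hx; exact absurd hx (lt_irrefl _)
        · exact h
      linarith [maxBirkhoffSum_le_succ T f N (T x)]
  · rw [Set.indicator_of_notMem (show x ∉ {y | 0 < maxBirkhoffSum T f N y} from hx)]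
    linarith [maxBirkhoffSum_nonneg T f N (T x)]

variable [MeasurableSpace α] {P : Measure α} {T : α → α} {f : α → ℝ}

lemma measurable_maxBirkhoffSum (hT : Measurable T) (hf : Measurable f) (N : ℕ) :
    Measurable (maxBirkhoffSum T f N) := by
  induction N with
  | zero => exact measurable_const
  | succ N ih => exact measurable_const.max (hf.add (ih.comp hT))

lemma integrable_maxBirkhoffSum (hT : MeasurePreserving T P P) (hf : Integrable f P) (N : ℕ) :
    Integrable (maxBirkhoffSum T f N) P := by
  induction N with
  | zero => exact integrable_zero _ _ _
  | succ N ih =>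
    exact (integrable_zero _ _ _).sup (hf.add (hT.integrable_comp_of_integrable ih))

/-- The left side of Garsia's inequality has integral zero because `T` preserves `P`. -/
lemma setIntegral_maxBirkhoffSum_nonneg (hT : MeasurePreserving T P P) (hfm : Measurable f)
    (hf : Integrable f P) (N : ℕ) : 0 ≤ ∫ x in {y | 0 < maxBirkhoffSum T f N y}, f x ∂P := by
  have hM := integrable_maxBirkhoffSum hT hf N
  have hMT := hT.integrable_comp_of_integrable hM
  have hms : MeasurableSet {y | 0 < maxBirkhoffSum T f N y} :=
    measurableSet_lt measurable_const (measurable_maxBirkhoffSum hT.measurable hfm N)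
  rw [← integral_indicator hms]
  have h0 : ∫ x, (maxBirkhoffSum T f N x - (maxBirkhoffSum T f N ∘ T) x) ∂P = 0 := by
    rw [integral_sub hM hMT, sub_eq_zero]
    conv_lhs => rw [← hT.map_eq]
    rw [integral_map hT.measurable.aemeasurable
      (measurable_maxBirkhoffSum hT.measurable hfm N).aestronglyMeasurable]
    rfl
  refine h0.symm.le.trans ?_
  exact integral_mono (hM.sub hMT) (hf.indicator hms) (maxBirkhoffSum_sub_le T f N)

/-- The maximal ergodic theorem, when almost every point has a positive Birkhoff sum. -/
lemma integral_nonneg_of_ae_exists_birkhoffSum_pos (hT : MeasurePreserving T P P)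
    (hfm : Measurable f) (hf : Integrable f P) (h : ∀ᵐ x ∂P, ∃ n, 0 < birkhoffSum T f n x) :
    0 ≤ ∫ x, f x ∂P := by
  have hms : ∀ N, MeasurableSet {y | 0 < maxBirkhoffSum T f N y} := fun N =>
    measurableSet_lt measurable_const (measurable_maxBirkhoffSum hT.measurable hfm N)
  have hmono : Monotone fun N => {y | 0 < maxBirkhoffSum T f N y} :=
    monotone_nat_of_le_succ fun N y hy => lt_of_lt_of_le hy (maxBirkhoffSum_le_succ T f N y)
  have hlim := tendsto_setIntegral_of_monotone hms hmono hf.integrableOn (μ := P)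
  have huniv : (⋃ N, {y | 0 < maxBirkhoffSum T f N y}) =ᵐ[P] Set.univ := by
    filter_upwards [h] with x ⟨n, hn⟩
    refine propext ⟨fun _ => trivial, fun _ => Set.mem_iUnion.2 ⟨n, ?_⟩⟩
    exact lt_of_lt_of_le hn (birkhoffSum_le_maxBirkhoffSum T f n x)
  rw [setIntegral_congr_set huniv, setIntegral_univ] at hlim
  exact ge_of_tendsto' hlim fun N => setIntegral_maxBirkhoffSum_nonneg hT hfm hf N

/-- Boundedness above of the Birkhoff sums is an invariant event, so it has full or zero measure. In
the second case almost every point would have a positive sum, and the maximal theorem would make the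
integral nonnegative. -/
lemma ae_birkhoffSum_bddAbove_of_integral_neg (hT : Ergodic T P)
    (hfm : Measurable f) (hf : Integrable f P) (hneg : ∫ x, f x ∂P < 0) :
    ∀ᵐ x ∂P, ∃ C : ℕ, ∀ n, birkhoffSum T f n x ≤ C := by
  have hSm : ∀ n, Measurable (birkhoffSum T f n) := fun n =>
    Finset.measurable_fun_sum _ fun k _ => hfm.comp (hT.measurable.iterate k)
  set B : Set α := {x | ∃ C : ℕ, ∀ n, birkhoffSum T f n x ≤ C}
  have hB : MeasurableSet B := by
    have : B = ⋃ C : ℕ, ⋂ n, {x | birkhoffSum T f n x ≤ C} := by ext x; simp [B]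
    rw [this]
    exact .iUnion fun C => .iInter fun n => measurableSet_le (hSm n) measurable_const
  have hinv : T ⁻¹' B = B := by
    ext x
    simp only [Set.mem_preimage, B, Set.mem_ofPred_eq]
    constructor
    · rintro ⟨C, hC⟩
      obtain ⟨D, hD⟩ := exists_nat_ge (|f x| + C)
      refine ⟨D, fun n => ?_⟩
      cases n with
      | zero => simp
      | succ n =>
        rw [birkhoffSum_succ']
        linarith [hC n, le_abs_self (f x)]
    · rintro ⟨C, hC⟩
      obtain ⟨D, hD⟩ := exists_nat_ge (C + |f x|)
      refine ⟨D, fun n => ?_⟩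
      have := hC (n + 1)
      rw [birkhoffSum_succ'] at this
      linarith [neg_abs_le (f x)]
  rcases hT.toPreErgodic.ae_mem_or_ae_notMem hB hinv with h | h
  · exact h
  · exfalso
    refine absurd (integral_nonneg_of_ae_exists_birkhoffSum_pos hT.toMeasurePreserving hfm hf ?_)
      (not_le.2 hneg)
    filter_upwards [h] with x hx
    by_contra! hx'
    exact hx ⟨0, fun n => by simpa using hx' n⟩

/-- Centring at some `b` strictly between the mean and `a` leaves a negative mean, so the sums of
`f` stay below `n b + C`, which is eventually less than `n a`. -/
lemma ae_eventually_birkhoffSum_le [IsProbabilityMeasure P] (hT : Ergodic T P)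
    (hfm : Measurable f) (hf : Integrable f P) {a : ℝ} (ha : ∫ x, f x ∂P < a) :
    ∀ᵐ x ∂P, ∀ᶠ n : ℕ in atTop, birkhoffSum T f n x / n < a := by
  obtain ⟨b, hb, hba⟩ := exists_between ha
  have hneg : ∫ x, (f x - b) ∂P < 0 := by
    rw [integral_sub hf (integrable_const _)]
    simpa using hb
  filter_upwards [ae_birkhoffSum_bddAbove_of_integral_neg hT (hfm.sub_const b)
    (hf.sub (integrable_const _)) hneg] with x ⟨C, hC⟩
  obtain ⟨N, hN⟩ := exists_nat_gt (C / (a - b))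
  have hab : 0 < a - b := sub_pos.2 hba
  filter_upwards [eventually_ge_atTop (N + 1)] with n hn
  have hn0 : (0 : ℝ) < n := by exact_mod_cast (Nat.succ_pos N).trans_le hn
  have h1 : birkhoffSum T (fun y => f y - b) n x = birkhoffSum T f n x - n * b := by
    simp [birkhoffSum, Finset.sum_sub_distrib]
  have h2 := hC n
  rw [h1] at h2
  rw [div_lt_iff₀ hn0]
  have h3 : (N : ℝ) < n := by exact_mod_cast hn
  rw [div_lt_iff₀ hab] at hN
  nlinarith

/-- **Birkhoff's ergodic theorem** for ergodic maps. -/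
theorem ae_tendsto_birkhoffSum_div [IsProbabilityMeasure P] (hT : Ergodic T P)
    (hfm : Measurable f) (hf : Integrable f P) :
    ∀ᵐ x ∂P, Tendsto (fun n : ℕ => birkhoffSum T f n x / n) atTop (𝓝 (∫ x, f x ∂P)) := by
  have hup : ∀ᵐ x ∂P, ∀ k : ℕ, ∀ᶠ n : ℕ in atTop,
      birkhoffSum T f n x / n < ∫ x, f x ∂P + 1 / ((k : ℝ) + 1) := ae_all_iff.2 fun k =>
    ae_eventually_birkhoffSum_le hT hfm hf (lt_add_of_pos_right _ Nat.one_div_pos_of_nat)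
  have hlo : ∀ᵐ x ∂P, ∀ k : ℕ, ∀ᶠ n : ℕ in atTop,
      birkhoffSum T (fun y => -f y) n x / n < -∫ x, f x ∂P + 1 / ((k : ℝ) + 1) :=
    ae_all_iff.2 fun k => ae_eventually_birkhoffSum_le hT hfm.neg hf.neg
      (by rw [integral_neg']; exact lt_add_of_pos_right _ Nat.one_div_pos_of_nat)
  filter_upwards [hup, hlo] with x h1 h2
  rw [Metric.tendsto_atTop']
  intro ε hε
  obtain ⟨k, hk⟩ := exists_nat_one_div_lt hε
  obtain ⟨N, hN⟩ := eventually_atTop.1 ((h1 k).and (h2 k))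
  refine ⟨N, fun n hn => ?_⟩
  obtain ⟨a, b⟩ := hN n hn.le
  have h3 : birkhoffSum T (fun y => -f y) n x = -birkhoffSum T f n x := by
    simp [birkhoffSum]
  rw [h3, neg_div] at b
  rw [Real.dist_eq, abs_lt]
  constructor <;> linarith

end Birkhoff

/-! ### Stationary Markov chains -/

section Chain

variable {S Ω : Type*} [MeasurableSpace S] [MeasurableSpace Ω]

/-- The σ-algebra generated by the chain up to time `k`. -/
abbrev past (x : ℤ → Ω → S) (k : ℤ) : MeasurableSpace Ω :=
  ⨆ j : Set.Iic k, MeasurableSpace.comap (x j) inferInstance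

lemma past_mono (x : ℤ → Ω → S) {k l : ℤ} (h : k ≤ l) : past x k ≤ past x l :=
  iSup_le fun j => le_iSup (fun i : Set.Iic l => MeasurableSpace.comap (x i) inferInstance)
    ⟨j, le_trans j.2 h⟩

lemma measurable_past (x : ℤ → Ω → S) {j k : ℤ} (h : j ≤ k) : Measurable[past x k] (x j) :=
  (comap_measurable (x j)).mono
    (le_iSup (fun i : Set.Iic k => MeasurableSpace.comap (x i) inferInstance) ⟨j, h⟩) le_rfl

/-- The transition kernels of the chain, as kernels from paths. -/
noncomputable def pathKernel (H : Kernel S S) (n : ℕ) : Kernel (Finset.Iic n → S) S :=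
  H.comap (fun h => h ⟨n, Finset.mem_Iic.2 le_rfl⟩) (measurable_pi_apply _)

instance (H : Kernel S S) [IsMarkovKernel H] (n : ℕ) : IsMarkovKernel (pathKernel H n) := by
  unfold pathKernel; infer_instance

/-- The law on paths of the Markov chain with kernel `H`, as a kernel from the initial state. -/
noncomputable def chainLaw (H : Kernel S S) [IsMarkovKernel H] : Kernel S (ℕ → S) :=
  (Kernel.traj (X := fun _ => S) (pathKernel H) 0).comap (fun s _ => s)
    (measurable_pi_lambda _ fun _ => measurable_id)

instance (H : Kernel S S) [IsMarkovKernel H] : IsMarkovKernel (chainLaw H) := by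
  unfold chainLaw; infer_instance

/-- A finite measure on paths is determined by its first marginal and its transition kernels. -/
lemma eq_of_map_frestrictLe_eq_compProd {X : ℕ → Type*} [∀ n, MeasurableSpace (X n)]
    (κ : (n : ℕ) → Kernel (Π i : Finset.Iic n, X i) (X (n + 1)))
    {ν ν' : Measure (Π n, X n)} [IsFiniteMeasure ν]
    (h0 : ν.map (Preorder.frestrictLe 0) = ν'.map (Preorder.frestrictLe 0))
    (h : ∀ n, ν.map (fun y => (Preorder.frestrictLe n y, y (n + 1)))
      = (ν.map (Preorder.frestrictLe n)) ⊗ₘ κ n)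
    (h' : ∀ n, ν'.map (fun y => (Preorder.frestrictLe n y, y (n + 1)))
      = (ν'.map (Preorder.frestrictLe n)) ⊗ₘ κ n) : ν = ν' := by
  have key : ∀ n, ν.map (Preorder.frestrictLe n) = ν'.map (Preorder.frestrictLe n) := by
    intro n
    induction n with
    | zero => exact h0
    | succ n ih =>
      let φ : (Π i : Finset.Iic n, X i) × X (n + 1) → Π i : Finset.Iic (n + 1), X i := fun p =>
        IicProdIoc (X := X) n (n + 1) (p.1, MeasurableEquiv.piSingleton (X := X) n p.2)
      have hφ : Measurable φ := by fun_prop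
      have hc : Preorder.frestrictLe (π := X) (n + 1)
          = φ ∘ fun y => (Preorder.frestrictLe n y, y (n + 1)) := by
        ext y i
        simp only [φ, Function.comp, IicProdIoc]
        split_ifs with hi
        · rfl
        · obtain ⟨i, hi'⟩ := i
          obtain rfl : i = n + 1 := by
            have := Finset.mem_Iic.1 hi'
            simp only at hi
            omega
          rfl
      rw [hc, ← Measure.map_map hφ (by fun_prop), ← Measure.map_map hφ (by fun_prop), h, h', ih]
  have huniv : ν Set.univ = ν' Set.univ := by
    have := congrArg (fun m => m Set.univ) (key 0)
    simpa [Measure.map_apply (Preorder.measurable_frestrictLe 0)] using this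
  refine ext_of_generate_finite (measurableCylinders X) generateFrom_measurableCylinders.symm
    isPiSystem_measurableCylinders ?_ huniv
  intro s hs
  rw [measurableCylinders_nat] at hs
  simp only [Set.mem_iUnion, Set.mem_singleton_iff] at hs
  obtain ⟨n, B, hB, rfl⟩ := hs
  have := congrArg (fun m => m B) (key n)
  simp only [Measure.map_apply (Preorder.measurable_frestrictLe n) hB] at this
  exact this

variable {H : Kernel S S} [IsMarkovKernel H]

/-- With `map_bind_chainLaw_zero`, this puts the constructed path law within reach of
`eq_of_map_frestrictLe_eq_compProd`, which then identifies the future of the given chain with it. -/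
lemma map_bind_chainLaw_pair (ν : Measure S) [SFinite ν] (n : ℕ) :
    (ν.bind (chainLaw H)).map (fun y => (Preorder.frestrictLe (π := fun _ => S) n y, y (n + 1)))
      = ((ν.bind (chainLaw H)).map (Preorder.frestrictLe n)) ⊗ₘ pathKernel H n := by
  ext s hs
  have hm : Measurable fun y : ℕ → S => (Preorder.frestrictLe (π := fun _ => S) n y, y (n + 1)) := by
    fun_prop
  have hg : Measurable fun a => pathKernel H n a (Prod.mk a ⁻¹' s) :=
    Kernel.measurable_kernel_prodMk_left hs
  rw [Measure.map_apply hm hs, Measure.bind_apply (hm hs) (chainLaw H).aemeasurable,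
    Measure.compProd_apply hs, lintegral_map hg (Preorder.measurable_frestrictLe n)]
  refine Eq.trans ?_ (Measure.lintegral_bind (chainLaw H).aemeasurable
      (hg.comp (Preorder.measurable_frestrictLe n)).aemeasurable).symm
  refine lintegral_congr fun y => ?_
  have h1 := Kernel.partialTraj_compProd_eq_map_traj (κ := pathKernel H) (X := fun _ => S)
    (Nat.zero_le n) (x₀ := fun _ => y)
  have h2 := congrArg (fun m => m s) h1
  simp only [Measure.map_apply hm hs, Measure.compProd_apply hs] at h2
  rw [← Kernel.traj_map_frestrictLe_apply,
    lintegral_map hg (Preorder.measurable_frestrictLe n)] at h2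
  exact h2.symm

lemma map_bind_chainLaw_zero (ν : Measure S) :
    (ν.bind (chainLaw H)).map (Preorder.frestrictLe (π := fun _ => S) 0)
      = ν.map (fun s _ => s) := by
  ext s hs
  have hm : Measurable (Preorder.frestrictLe (π := fun _ : ℕ => S) 0) :=
    Preorder.measurable_frestrictLe 0
  have hm' : Measurable fun (s : S) (_ : Finset.Iic 0) => s :=
    measurable_pi_lambda _ fun _ => measurable_id
  rw [Measure.map_apply hm hs, Measure.bind_apply (hm hs) (chainLaw H).aemeasurable,
    Measure.map_apply hm' hs, ← lintegral_indicator_one (hm' hs)]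
  refine lintegral_congr fun y => ?_
  have h1 := Kernel.traj_map_frestrictLe_apply (κ := pathKernel H) (X := fun _ => S) 0 0
    (fun _ => y)
  have h2 := congrArg (fun m => m s) h1
  simp only [Measure.map_apply hm hs, Kernel.partialTraj_self, Kernel.id_apply,
    Measure.dirac_apply' _ hs] at h2
  exact h2

/-! ### The Markov property of the two-sided stationary chain. -/

variable {π : Measure S} {μ : Measure Ω} {x : ℤ → Ω → S}

namespace IsStationaryMarkovChain

lemma past_le (hx : IsStationaryMarkovChain H π μ x) (k : ℤ) :
    past x k ≤ (inferInstance : MeasurableSpace Ω) :=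
  iSup_le fun j => (hx.measurable j).comap_le

/-- The conditional expectation is integrated over an event of the past once and for all; every
later use of the Markov property rests on this form. -/
lemma measure_inter_preimage [IsFiniteMeasure μ] (hx : IsStationaryMarkovChain H π μ x) (k : ℤ)
    {B : Set Ω} (hB : MeasurableSet[past x k] B) {A : Set S} (hA : MeasurableSet A) :
    μ (B ∩ x (k + 1) ⁻¹' A) = ∫⁻ w in B, H (x k w) A ∂μ := by
  have hB' : MeasurableSet B := hx.past_le k B hB
  have hA' : MeasurableSet (x (k + 1) ⁻¹' A) := hx.measurable _ hA
  have h1 := setIntegral_condExp (m := past x k) (hx.past_le k)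
    (f := (x (k + 1) ⁻¹' A).indicator fun _ => (1 : ℝ))
    ((integrable_const (1 : ℝ)).indicator hA' : Integrable _ μ) hB
  have h2 : ∫ w in B, (μ[(x (k + 1) ⁻¹' A).indicator fun _ => (1 : ℝ) | past x k]) w ∂μ
      = ∫ w in B, (H (x k w)).real A ∂μ :=
    integral_congr_ae (ae_restrict_of_ae (hx.markov k A hA))
  rw [h2, setIntegral_indicator hA', setIntegral_const, smul_eq_mul, mul_one] at h1
  have hm : Measurable fun w => H (x k w) A := (H.measurable_coe hA).comp (hx.measurable k)
  have h3 : ∫ w in B, (H (x k w)).real A ∂μ = (∫⁻ w in B, H (x k w) A ∂μ).toReal :=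
    integral_toReal hm.aemeasurable (ae_of_all _ fun w => measure_lt_top _ _)
  rw [h3, Measure.real] at h1
  refine ((ENNReal.toReal_eq_toReal_iff' ?_ (measure_ne_top _ _)).1 h1).symm
  refine ne_top_of_le_ne_top (measure_ne_top μ B) ?_
  calc ∫⁻ w in B, H (x k w) A ∂μ ≤ ∫⁻ _ in B, 1 ∂μ := lintegral_mono fun w => prob_le_one
    _ = μ B := by simp

/-- The Markov property at time `k`: given the past, the future path has law `chainLaw H (x k)`. -/
lemma map_restrict_future [IsFiniteMeasure μ] (hx : IsStationaryMarkovChain H π μ x) (k : ℤ)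
    {B : Set Ω} (hB : MeasurableSet[past x k] B) :
    (μ.restrict B).map (fun w (i : ℕ) => x (k + i) w)
      = ((μ.restrict B).map (x k)).bind (chainLaw H) := by
  have hZ : Measurable fun w (i : ℕ) => x (k + i) w :=
    measurable_pi_lambda _ fun i => hx.measurable _
  refine eq_of_map_frestrictLe_eq_compProd (X := fun _ => S) (pathKernel H) ?_ ?_
    (map_bind_chainLaw_pair _)
  · rw [map_bind_chainLaw_zero, Measure.map_map (by fun_prop) hZ, Measure.map_map
      (f := x k) (g := fun s _ => s) (by fun_prop) (hx.measurable k)]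
    congr 1
    ext w ⟨i, hi⟩
    obtain rfl : i = 0 := by simpa using hi
    simp [Preorder.frestrictLe_apply]
  · intro n
    rw [Measure.map_map (by fun_prop) hZ, Measure.map_map (by fun_prop) hZ]
    refine Measure.ext_prod fun {E A} hE hA => ?_
    have hr : Measurable[past x (k + n)]
        ((Preorder.frestrictLe (π := fun _ => S) n) ∘ fun w (i : ℕ) => x (k + i) w) := by
      refine @measurable_pi_lambda _ _ _ (past x (k + n)) _ _ fun i => ?_
      exact measurable_past x (by have := Finset.mem_Iic.1 i.2; omega)
    have hr' := hr.mono (hx.past_le _) le_rfl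
    have hp : Measurable ((fun y => (Preorder.frestrictLe (π := fun _ => S) n y, y (n + 1))) ∘
        fun w (i : ℕ) => x (k + i) w) := Measurable.comp (by fun_prop) hZ
    rw [Measure.map_apply hp (hE.prod hA), Measure.compProd_apply_prod hE hA,
      setLIntegral_map hE ((pathKernel H n).measurable_coe hA) hr',
      Measure.restrict_apply (hp (hE.prod hA)), Measure.restrict_restrict (hr' hE)]
    have h1 := hx.measure_inter_preimage (k + n)
      ((hr hE).inter (past_mono x (by omega : k ≤ k + n) B hB)) hA
    have h2 : (Preorder.frestrictLe (π := fun _ => S) n ∘ fun w (i : ℕ) => x (k + i) w) ⁻¹' E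
        ∩ B ∩ x (k + n + 1) ⁻¹' A
      = ((fun y => (Preorder.frestrictLe (π := fun _ => S) n y, y (n + 1))) ∘
        fun w (i : ℕ) => x (k + i) w) ⁻¹' E ×ˢ A ∩ B := by
      ext w
      simp only [Set.mem_inter_iff, Set.mem_preimage, Function.comp, Set.mem_prod]
      push_cast
      rw [← add_assoc]
      tauto
    rw [h2] at h1
    exact h1

lemma map_future [IsFiniteMeasure μ] (hx : IsStationaryMarkovChain H π μ x) (k : ℤ) :
    μ.map (fun w (i : ℕ) => x (k + i) w) = π.bind (chainLaw H) := by
  have := hx.map_restrict_future k (B := Set.univ) MeasurableSet.univ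
  rwa [Measure.restrict_univ, hx.map_eq k] at this

lemma map_restrict_succ [IsFiniteMeasure μ] (hx : IsStationaryMarkovChain H π μ x) (k : ℤ)
    {B : Set Ω} (hB : MeasurableSet[past x k] B) :
    (μ.restrict B).map (x (k + 1)) = ((μ.restrict B).map (x k)).bind H := by
  ext A hA
  rw [Measure.map_apply (hx.measurable _) hA, Measure.restrict_apply (hx.measurable _ hA),
    Measure.bind_apply hA H.aemeasurable, lintegral_map (H.measurable_coe hA) (hx.measurable k),
    Set.inter_comm, hx.measure_inter_preimage k hB hA]

lemma map_restrict_add [IsFiniteMeasure μ] (hx : IsStationaryMarkovChain H π μ x) (k : ℤ)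
    {B : Set Ω} (hB : MeasurableSet[past x k] B) (j : ℕ) :
    (μ.restrict B).map (x (k + j)) = ((μ.restrict B).map (x k)).bind (H ^ j : Kernel S S) := by
  induction j with
  | zero => simp only [Nat.cast_zero, add_zero, pow_zero]; exact (Measure.bind_dirac).symm
  | succ j ih =>
    have h := hx.map_restrict_succ (k + j) (past_mono x (by omega : k ≤ k + j) B hB)
    push_cast
    rw [← add_assoc, h, ih, Measure.comp_assoc, pow_succ']
    rfl

lemma bind_eq [IsFiniteMeasure μ] (hx : IsStationaryMarkovChain H π μ x) : π.bind H = π := by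
  have h := hx.map_restrict_succ 0 (B := Set.univ) MeasurableSet.univ
  rw [Measure.restrict_univ, hx.map_eq, hx.map_eq] at h
  exact h.symm

/-- For `Y` a multiple of an indicator this is `map_restrict_succ`; sums and monotone limits give
the rest. -/
lemma lintegral_mul_succ [IsFiniteMeasure μ] (hx : IsStationaryMarkovChain H π μ x) (k : ℤ)
    {Y : Ω → ENNReal} (hY : Measurable[past x k] Y) {g : S → ENNReal} (hg : Measurable g) :
    ∫⁻ w, Y w * g (x (k + 1) w) ∂μ = ∫⁻ w, Y w * ∫⁻ y, g y ∂(H (x k w)) ∂μ := by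
  have hg1 : Measurable fun w => g (x (k + 1) w) := hg.comp (hx.measurable _)
  have hHg : Measurable fun s => ∫⁻ y, g y ∂(H s) := hg.lintegral_kernel
  have hg2 : Measurable fun w => ∫⁻ y, g y ∂(H (x k w)) := hHg.comp (hx.measurable k)
  refine @Measurable.ennreal_induction Ω (past x k)
    (fun Y => ∫⁻ w, Y w * g (x (k + 1) w) ∂μ = ∫⁻ w, Y w * ∫⁻ y, g y ∂(H (x k w)) ∂μ)
    ?_ ?_ ?_ Y hY
  · intro c B hB
    have hB' := hx.past_le k B hB
    have h1 : ∀ G : Ω → ENNReal, Measurable G →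
        ∫⁻ w, B.indicator (fun _ => c) w * G w ∂μ = c * ∫⁻ w in B, G w ∂μ := by
      intro G hG
      rw [← lintegral_const_mul _ hG, ← lintegral_indicator hB']
      refine lintegral_congr fun w => ?_
      by_cases hw : w ∈ B <;> simp [hw]
    rw [h1 _ hg1, h1 _ hg2]
    congr 1
    have h2 := congrArg (fun m => ∫⁻ s, g s ∂m) (hx.map_restrict_succ k hB)
    simpa only [lintegral_map hg (hx.measurable _),
      Measure.lintegral_bind H.aemeasurable hg.aemeasurable,
      lintegral_map hHg (hx.measurable _)] using h2
  · intro f f' _ hf hf' h h'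
    have m1 := hf.mono (hx.past_le k) le_rfl
    have m2 := hf'.mono (hx.past_le k) le_rfl
    simp only [Pi.add_apply, add_mul]
    rw [lintegral_add_left (f := fun w => f w * _) (m1.mul hg1),
      lintegral_add_left (f := fun w => f w * _) (m1.mul hg2), h, h']
  · intro f hf hmono h
    have m1 := fun n => (hf n).mono (hx.past_le k) le_rfl
    simp only [ENNReal.iSup_mul]
    rw [lintegral_iSup (f := fun n w => f n w * _) (fun n => (m1 n).mul hg1)
        fun i j hij w => mul_le_mul_left (hmono hij w) _,
      lintegral_iSup (f := fun n w => f n w * _) (fun n => (m1 n).mul hg2)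
        fun i j hij w => mul_le_mul_left (hmono hij w) _]
    simp only [h]

end IsStationaryMarkovChain

end Chain

/-! ### The shift on environments -/

/-- The environment seen from the site `k`. -/
def shift (k : ℤ) (ω : Env) : Env := fun n => ω (n + k)

@[fun_prop]
lemma measurable_shift (k : ℤ) : Measurable (shift k) :=
  measurable_pi_lambda _ fun _ => measurable_pi_apply _

lemma shift_apply (k n : ℤ) (ω : Env) : shift k ω n = ω (n + k) := rfl

lemma shift_shift (k l : ℤ) (ω : Env) : shift k (shift l ω) = shift (k + l) ω := by
  ext n; simp only [shift, add_assoc]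

lemma shift_zero (ω : Env) : shift 0 ω = ω := by ext n; simp [shift]

lemma shift_iterate (n : ℕ) (ω : Env) : (shift 1)^[n] ω = shift n ω := by
  induction n with
  | zero => simp [shift_zero]
  | succ n ih => rw [Function.iterate_succ_apply', ih, shift_shift]; congr 1; push_cast; ring

lemma preimage_shift_neg {A : Set Env} (hA : shift 1 ⁻¹' A = A) (n : ℕ) :
    shift (-(n : ℤ)) ⁻¹' A = A := by
  have h1 : shift n ⁻¹' A = A := by
    have : shift n = (shift 1)^[n] := funext fun ω => (shift_iterate n ω).symm
    rw [this]
    exact Function.IsFixedPt.preimage_iterate hA n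
  conv_lhs => rw [← h1]
  ext ω
  simp only [Set.mem_preimage, shift_shift]
  simp [shift_zero]

section MarkovEnvironment

variable {S Ω : Type*} [MeasurableSpace S] [MeasurableSpace Ω]
  {H : Kernel S S} [IsMarkovKernel H] {π : Measure S} {μ : Measure Ω} {x : ℤ → Ω → S}
  {θ : S → Set.Ioo (0 : ℝ) 1}

lemma measurable_markovEnv (hx : IsStationaryMarkovChain H π μ x) (hθ : Measurable θ) :
    Measurable (markovEnv θ x) :=
  measurable_pi_lambda _ fun _ => hθ.comp (hx.measurable _)

/-- A cylinder of environments, read off the future of the chain. -/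
lemma exists_chain_event (hθ : Measurable θ) {C : Set Env}
    (hC : C ∈ measurableCylinders fun _ : ℤ => Set.Ioo (0 : ℝ) 1) :
    ∃ N : ℕ, ∀ M : ℕ, N ≤ M → ∃ D : Set (ℕ → S), MeasurableSet D ∧
      ∀ (x : ℤ → Ω → S) (k : ℤ) (w : Ω),
        shift (-k) (markovEnv θ x w) ∈ C ↔ (fun i : ℕ => x (k - M + i) w) ∈ D := by
  obtain ⟨s, B, hB, rfl⟩ := (mem_measurableCylinders _).1 hC
  -- Site `i` seen from `-k` is the chain time `k - i = (k - M) + (M - i)`. As `M` bounds every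
  -- `|i|`, `M - i` is nonnegative and `toNat` loses nothing.
  refine ⟨s.sup Int.natAbs, fun M hM => ⟨{y | (fun i : s => θ (y (M - (i : ℤ)).toNat)) ∈ B},
    ?_, fun x k w => ?_⟩⟩
  · have : Measurable fun (y : ℕ → S) (i : s) => θ (y (M - (i : ℤ)).toNat) :=
      measurable_pi_lambda _ fun i => hθ.comp (measurable_pi_apply _)
    exact this hB
  · rw [mem_cylinder, Set.mem_ofPred_eq]
    have : s.restrict (shift (-k) (markovEnv θ x w))
        = fun i : s => θ (x (k - M + ((M - (i : ℤ)).toNat : ℕ)) w) := by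
      ext i
      have h1 : Int.natAbs i ≤ M := (Finset.le_sup (f := Int.natAbs) i.2).trans hM
      simp only [Finset.restrict, shift, markovEnv]
      rw [Int.toNat_of_nonneg (by omega)]
      congr 4
      ring
    rw [this]

lemma envLaw_apply (hx : IsStationaryMarkovChain H π μ x) (hθ : Measurable θ) {A : Set Env}
    (hA : MeasurableSet A) : envLaw θ μ x A = μ (markovEnv θ x ⁻¹' A) :=
  Measure.map_apply (measurable_markovEnv hx hθ) hA

lemma isProbabilityMeasure_envLaw [IsProbabilityMeasure μ]
    (hx : IsStationaryMarkovChain H π μ x) (hθ : Measurable θ) :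
    IsProbabilityMeasure (envLaw θ μ x) :=
  Measure.isProbabilityMeasure_map (measurable_markovEnv hx hθ).aemeasurable

/-- The law of a Markov environment is invariant under all shifts. -/
lemma measurePreserving_shift [IsProbabilityMeasure μ]
    (hx : IsStationaryMarkovChain H π μ x) (hθ : Measurable θ) (k : ℤ) :
    MeasurePreserving (shift k) (envLaw θ μ x) (envLaw θ μ x) := by
  have := isProbabilityMeasure_envLaw hx hθ
  refine ⟨measurable_shift k, ?_⟩
  have : IsProbabilityMeasure ((envLaw θ μ x).map (shift k)) :=
    Measure.isProbabilityMeasure_map (by fun_prop)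
  refine ext_of_generate_finite _ generateFrom_measurableCylinders.symm
    isPiSystem_measurableCylinders (fun C hC => ?_) (by simp)
  have hCm := MeasurableSet.of_mem_measurableCylinders hC
  obtain ⟨N, hN⟩ := exists_chain_event (Ω := Ω) hθ hC
  obtain ⟨D, hD, h⟩ := hN N le_rfl
  -- The law of the future from any starting time is the same, so the right side does not depend on
  -- `l`.
  have key : ∀ l : ℤ, μ (markovEnv θ x ⁻¹' (shift (-l) ⁻¹' C)) = π.bind (chainLaw H) D := by
    intro l
    rw [← hx.map_future (l - N),
      Measure.map_apply (measurable_pi_lambda _ fun i => hx.measurable _) hD]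
    congr 1
    ext w
    exact h x l w
  rw [Measure.map_apply (measurable_shift k) hCm, envLaw_apply hx hθ (measurable_shift k hCm),
    envLaw_apply hx hθ hCm]
  have h1 := key (-k)
  have h2 := key 0
  have h3 : shift (-0) ⁻¹' C = C := by ext ω; simp [shift_zero]
  rw [neg_neg] at h1
  rw [h3] at h2
  rw [h1, h2]

lemma measurableSet_past_markovEnv (hθ : Measurable θ) {C : Set Env}
    (hC : C ∈ measurableCylinders fun _ : ℤ => Set.Ioo (0 : ℝ) 1) :
    ∃ N : ℕ, MeasurableSet[past x N] (markovEnv θ x ⁻¹' C) := by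
  obtain ⟨s, B, hB, rfl⟩ := (mem_measurableCylinders _).1 hC
  refine ⟨s.sup Int.natAbs, ?_⟩
  have h : Measurable[past x ((s.sup Int.natAbs : ℕ) : ℤ)] fun w => s.restrict (markovEnv θ x w) := by
    refine @measurable_pi_lambda _ _ _ (past x _) _ _ fun i => ?_
    refine hθ.comp (measurable_past x ?_)
    have h1 : Int.natAbs i ≤ s.sup Int.natAbs := Finset.le_sup (f := Int.natAbs) i.2
    omega
  exact h hB

/-- The minorization integrated against the law of `x k` on a past event. Summing over `J` steps
instead of using one accommodates periodic finite chains. -/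
lemma smul_le_sum_map_restrict [IsProbabilityMeasure μ]
    (hx : IsStationaryMarkovChain H π μ x) {J : ℕ} {c : ENNReal}
    (hmin : ∀ s A, MeasurableSet A → c * π A ≤ ∑ j ∈ Finset.range J, (H ^ j) s A) (k : ℤ)
    {B : Set Ω} (hB : MeasurableSet[past x k] B) :
    (c * μ B) • π ≤ ∑ j ∈ Finset.range J, (μ.restrict B).map (x (k + j)) := by
  refine Measure.le_iff.2 fun A hA => ?_
  rw [Measure.finsetSum_apply, Measure.smul_apply, smul_eq_mul]
  simp_rw [hx.map_restrict_add k hB, Measure.bind_apply hA (Kernel.aemeasurable _)]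
  rw [← lintegral_finsetSum _ fun j _ => (H ^ j).measurable_coe hA]
  calc c * μ B * π A = ∫⁻ _, c * π A ∂((μ.restrict B).map (x k)) := by
        rw [lintegral_const, Measure.map_apply (hx.measurable k) .univ]
        simp only [Set.preimage_univ, Measure.restrict_apply_univ]
        ring
    _ ≤ _ := lintegral_mono fun s => hmin s A hA

/-- Under a minorization condition, pairs of cylinders are asymptotically correlated. -/
lemma measure_mul_measure_le_sum [IsProbabilityMeasure μ]
    (hx : IsStationaryMarkovChain H π μ x) (hθ : Measurable θ) {J : ℕ} {c : ENNReal}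
    (hmin : ∀ s A, MeasurableSet A → c * π A ≤ ∑ j ∈ Finset.range J, (H ^ j) s A)
    {C D : Set Env} (hC : C ∈ measurableCylinders fun _ : ℤ => Set.Ioo (0 : ℝ) 1)
    (hD : D ∈ measurableCylinders fun _ : ℤ => Set.Ioo (0 : ℝ) 1) :
    ∃ N : ℕ, c * envLaw θ μ x C * envLaw θ μ x D
      ≤ ∑ j ∈ Finset.range J, envLaw θ μ x (shift (-((N + j : ℕ) : ℤ)) ⁻¹' C ∩ D) := by
  have hCm := MeasurableSet.of_mem_measurableCylinders hC
  have hDm := MeasurableSet.of_mem_measurableCylinders hD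
  obtain ⟨K, hK⟩ := measurableSet_past_markovEnv (x := x) hθ hD
  obtain ⟨M, hM⟩ := exists_chain_event (Ω := Ω) hθ hC
  obtain ⟨E, hE, h⟩ := hM M le_rfl
  -- `K` places `D` in the past of time `K`; the further `M` places the shifted `C` in the future
  -- after that time.
  refine ⟨K + M, ?_⟩
  have h1 := smul_le_sum_map_restrict hx hmin K hK
  have hmC : envLaw θ μ x C = π.bind (chainLaw H) E := by
    rw [envLaw_apply hx hθ hCm, ← hx.map_future (0 - M),
      Measure.map_apply (measurable_pi_lambda _ fun i => hx.measurable _) hE]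
    congr 1
    ext w
    rw [Set.mem_preimage, Set.mem_preimage, ← h x 0 w, neg_zero, shift_zero]
  have hterm : ∀ j : ℕ, envLaw θ μ x (shift (-((K + M + j : ℕ) : ℤ)) ⁻¹' C ∩ D)
      = ((μ.restrict (markovEnv θ x ⁻¹' D)).map (x (K + j))).bind (chainLaw H) E := by
    intro j
    rw [← hx.map_restrict_future (K + j) (past_mono x (by omega : (K : ℤ) ≤ K + j) _ hK),
      Measure.map_apply (measurable_pi_lambda _ fun i => hx.measurable _) hE,
      Measure.restrict_apply ((measurable_pi_lambda _ fun i => hx.measurable _) hE),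
      envLaw_apply hx hθ ((measurable_shift _ hCm).inter hDm)]
    congr 1
    ext w
    simp only [Set.preimage_inter, Set.mem_inter_iff, Set.mem_preimage, h x]
    have : ((K + M + j : ℕ) : ℤ) - M = K + j := by push_cast; ring
    rw [this]
  simp_rw [hterm, hmC, Measure.bind_apply hE (chainLaw H).aemeasurable]
  rw [← lintegral_finsetSum_measure]
  calc c * (∫⁻ s, chainLaw H s E ∂π) * envLaw θ μ x D
      = ∫⁻ s, chainLaw H s E ∂((c * μ (markovEnv θ x ⁻¹' D)) • π) := by
        rw [lintegral_smul_measure, envLaw_apply hx hθ hDm, smul_eq_mul]; ring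
    _ ≤ _ := lintegral_mono' h1 le_rfl

open scoped symmDiff in
/-- The shift is ergodic for the law of a Markov environment satisfying a minorization
condition. -/
lemma ergodic_shift [IsProbabilityMeasure μ]
    (hx : IsStationaryMarkovChain H π μ x) (hθ : Measurable θ) {J : ℕ} {c : ENNReal} (hc : c ≠ 0)
    (hmin : ∀ s A, MeasurableSet A → c * π A ≤ ∑ j ∈ Finset.range J, (H ^ j) s A) :
    Ergodic (shift 1) (envLaw θ μ x) := by
  have hP := isProbabilityMeasure_envLaw hx hθ
  set P := envLaw θ μ x with hPdef
  refine ⟨measurePreserving_shift hx hθ 1, ⟨fun A hA hinv => ?_⟩⟩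
  have happrox : ∀ {B : Set Env}, MeasurableSet B → ∀ ε : ENNReal, 0 < ε →
      ∃ C ∈ measurableCylinders fun _ : ℤ => Set.Ioo (0 : ℝ) 1, P (C ∆ B) < ε := by
    intro B hB ε hε
    exact exists_measure_symmDiff_lt_of_generateFrom_isSetRing isSetRing_measurableCylinders
      ⟨{Set.univ}, Set.countable_singleton _,
        Set.singleton_subset_iff.2 (univ_mem_measurableCylinders _), by simp⟩
      generateFrom_measurableCylinders.symm hB hε
  -- Cylinders close to `Aᶜ` and `A` are correlated by minorization. Since `A` is invariant, a shift
  -- of the first still nearly avoids the second, so each correlation is at most `2ε`.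
  have hbound : ∀ ε : ENNReal, 0 < ε → c * (P Aᶜ - ε) * (P A - ε) ≤ J * (ε + ε) := by
    intro ε hε
    obtain ⟨C, hC, hCA⟩ := happrox hA.compl ε hε
    obtain ⟨D, hD, hDA⟩ := happrox hA ε hε
    have hCm := MeasurableSet.of_mem_measurableCylinders hC
    obtain ⟨N, hN⟩ := measure_mul_measure_le_sum hx hθ hmin hC hD
    have hlow : ∀ {B E : Set Env}, P (E ∆ B) < ε → P B - ε ≤ P E := by
      intro B E h
      rw [tsub_le_iff_right]
      have h1 : B ⊆ E ∪ E ∆ B := by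
        intro y hy
        by_cases hyE : y ∈ E
        · exact Or.inl hyE
        · exact Or.inr (Or.inr ⟨hy, hyE⟩)
      exact (measure_mono h1).trans ((measure_union_le _ _).trans (by gcongr))
    calc c * (P Aᶜ - ε) * (P A - ε) ≤ c * P C * P D := by
          gcongr
          · exact hlow hCA
          · exact hlow hDA
      _ ≤ _ := hN
      _ ≤ ∑ j ∈ Finset.range J, (ε + ε) := Finset.sum_le_sum fun j _ => ?_
      _ = J * (ε + ε) := by simp [mul_add]
    have hpre : P (shift (-((N + j : ℕ) : ℤ)) ⁻¹' (C ∆ Aᶜ)) < ε := by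
      rwa [(measurePreserving_shift hx hθ _).measure_preimage
        (hCm.symmDiff hA.compl).nullMeasurableSet]
    have h2 : shift (-((N + j : ℕ) : ℤ)) ⁻¹' C ∩ D
        ⊆ shift (-((N + j : ℕ) : ℤ)) ⁻¹' (C ∆ Aᶜ) ∪ D ∆ A := by
      rintro y ⟨hyC, hyD⟩
      by_cases hyA : y ∈ A
      · refine Or.inl (Or.inl ⟨hyC, ?_⟩)
        rw [← preimage_shift_neg hinv (N + j)] at hyA
        exact fun h => h hyA
      · exact Or.inr (Or.inl ⟨hyD, hyA⟩)
    exact (measure_mono h2).trans ((measure_union_le _ _).trans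
      (add_le_add hpre.le hDA.le))
  have hzero : c * P Aᶜ * P A = 0 := by
    by_contra hne
    have h1 : P Aᶜ ≠ 0 := fun h => hne (by simp [h])
    have h2 : P A ≠ 0 := fun h => hne (by simp [h])
    have hlim : Tendsto (fun n : ℕ => (J : ENNReal) * ((n : ENNReal)⁻¹ + (n : ENNReal)⁻¹)) atTop
        (𝓝 (J * (0 + 0))) :=
      ENNReal.Tendsto.const_mul (ENNReal.tendsto_inv_nat_nhds_zero.add
        ENNReal.tendsto_inv_nat_nhds_zero) (Or.inr (ENNReal.natCast_ne_top J))
    have hhalf : ∀ {B : Set Env}, P B ≠ 0 → ∀ᶠ n : ℕ in atTop, P B / 2 ≤ P B - (n : ENNReal)⁻¹ := by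
      intro B hB
      have h3 : P B / 2 ≠ 0 := by simp [hB]
      filter_upwards [(tendsto_order.1 ENNReal.tendsto_inv_nat_nhds_zero).2 _
        (pos_iff_ne_zero.2 h3)] with n hn
      refine ENNReal.le_sub_of_add_le_right (hn.trans_le le_top).ne ?_
      calc P B / 2 + (n : ENNReal)⁻¹ ≤ P B / 2 + P B / 2 := by gcongr
        _ = P B := ENNReal.add_halves _
    have hle : c * (P Aᶜ / 2) * (P A / 2) ≤ J * (0 + 0) := by
      refine ge_of_tendsto hlim ?_
      filter_upwards [hhalf h1, hhalf h2] with n hn1 hn2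
      refine le_trans ?_ (hbound (n : ENNReal)⁻¹ (by simp))
      gcongr
    simp [hc, h1, h2] at hle
  rw [mul_eq_zero, mul_eq_zero] at hzero
  rw [eventuallyConst_set]
  rcases hzero with (h | h) | h
  · exact absurd h hc
  · exact Or.inl (mem_ae_iff.2 h)
  · exact Or.inr (measure_eq_zero_iff_ae_notMem.1 h)

end MarkovEnvironment

/-! ### Weighted transition operators and moments -/

section Weighted

variable {S Ω : Type*} [MeasurableSpace S] [MeasurableSpace Ω]

/-- The operator `g ↦ ∫ H(·, dy) u(y) g(y)`. -/
noncomputable def weightedOp (H : Kernel S S) (u g : S → ENNReal) : S → ENNReal :=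
  fun s => ∫⁻ y, u y * g y ∂(H s)

variable {H : Kernel S S} {u g g' : S → ENNReal}

lemma measurable_weightedOp (hu : Measurable u) (hg : Measurable g) :
    Measurable (weightedOp H u g) :=
  (hu.mul hg).lintegral_kernel

lemma measurable_weightedOp_iterate (hu : Measurable u) (hg : Measurable g) (n : ℕ) :
    Measurable ((weightedOp H u)^[n] g) := by
  induction n with
  | zero => exact hg
  | succ n ih => rw [Function.iterate_succ_apply']; exact measurable_weightedOp hu ih

lemma monotone_weightedOp : Monotone (weightedOp H u) :=
  fun _ _ h _ => lintegral_mono fun y => mul_le_mul_right (h y) _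

lemma weightedOp_const_mul (hu : Measurable u) (hg : Measurable g) (c : ENNReal) :
    weightedOp H u (fun s => c * g s) = fun s => c * weightedOp H u g s := by
  ext s
  simp only [weightedOp]
  rw [← lintegral_const_mul (f := fun y => u y * g y) _ (hu.mul hg)]
  exact lintegral_congr fun y => mul_left_comm _ _ _

lemma weightedOp_iterate_const_mul (hu : Measurable u) (hg : Measurable g) (c : ENNReal) (n : ℕ) :
    (weightedOp H u)^[n] (fun s => c * g s) = fun s => c * (weightedOp H u)^[n] g s := by
  induction n with
  | zero => rfl
  | succ n ih =>
    rw [Function.iterate_succ_apply', Function.iterate_succ_apply', ih,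
      weightedOp_const_mul hu (measurable_weightedOp_iterate hu hg n)]

lemma weightedOp_iterate_le_pow (hu : Measurable u) (hg : Measurable g) {B : ENNReal}
    (hB : ∀ s, u s ≤ B) (n : ℕ) (s : S) :
    (weightedOp H u)^[n] g s ≤ B ^ n * ∫⁻ y, g y ∂((H ^ n : Kernel S S) s) := by
  induction n generalizing g with
  | zero =>
    simp only [Function.iterate_zero, id, pow_zero, one_mul]
    exact (lintegral_dirac' s hg).symm.le
  | succ n ih =>
    rw [Function.iterate_succ_apply]
    refine (ih (measurable_weightedOp hu hg)).trans ?_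
    have h1 : ((H ^ (n + 1) : Kernel S S) s) = ((H ^ n : Kernel S S) s).bind H := by
      rw [pow_succ']; exact Kernel.comp_apply _ _ _
    rw [h1, Measure.lintegral_bind H.aemeasurable hg.aemeasurable, pow_succ, mul_assoc]
    gcongr
    rw [← lintegral_const_mul _ hg.lintegral_kernel]
    refine lintegral_mono fun y => ?_
    rw [← lintegral_const_mul _ hg]
    exact lintegral_mono fun z => mul_le_mul_left (hB z) _

lemma pow_le_weightedOp_iterate_one [IsMarkovKernel H] {b : ENNReal} (hb : ∀ s, b ≤ u s)
    (n : ℕ) (s : S) :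
    b ^ n ≤ (weightedOp H u)^[n] (fun _ => 1) s := by
  induction n generalizing s with
  | zero => simp
  | succ n ih =>
    rw [Function.iterate_succ_apply', pow_succ']
    calc b * b ^ n = ∫⁻ _, b * b ^ n ∂(H s) := by simp
      _ ≤ _ := lintegral_mono fun y => mul_le_mul' (hb y) (ih y)

variable {π : Measure S}

/-- `∫ dπ Kⁿ1`, the `n`-th moment of the multiplicative functional with weight `u`. -/
noncomputable def weightedMoment (H : Kernel S S) (π : Measure S) (u : S → ENNReal) (n : ℕ) :
    ENNReal :=
  ∫⁻ s, (weightedOp H u)^[n] (fun _ => 1) s ∂π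

/-- If a power of `H` is dominated by `π`, then weighted iterates are bounded by their mean. -/
lemma weightedOp_iterate_add_le (hu : Measurable u) {m : ℕ} {C : ENNReal}
    (hdom : ∀ s A, MeasurableSet A → (H ^ m) s A ≤ C * π A) {B : ENNReal}
    (hB : ∀ s, u s ≤ B) (n : ℕ) (hg : Measurable g) (s : S) :
    (weightedOp H u)^[m + n] g s ≤ B ^ m * C * ∫⁻ y, (weightedOp H u)^[n] g y ∂π := by
  rw [Function.iterate_add_apply]
  refine (weightedOp_iterate_le_pow hu (measurable_weightedOp_iterate hu hg n) hB m s).trans ?_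
  rw [mul_assoc]
  gcongr
  rw [← smul_eq_mul, ← lintegral_smul_measure]
  exact lintegral_mono' (Measure.le_iff.2 fun A hA => hdom s A hA) le_rfl

/-- Inserting `m` extra steps between the two blocks costs a factor `b ^ m`. During these steps the
chain forgets its state, by `weightedOp_iterate_add_le`, and the moment factorizes up to a constant.
-/
lemma weightedMoment_mul_pow_le [IsMarkovKernel H] (hu : Measurable u) {m : ℕ} {C : ENNReal}
    (hdom : ∀ s A, MeasurableSet A → (H ^ m) s A ≤ C * π A) {b B : ENNReal}
    (hb : ∀ s, b ≤ u s) (hB : ∀ s, u s ≤ B) (k n : ℕ) :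
    b ^ m * weightedMoment H π u (k + n)
      ≤ B ^ m * C * (weightedMoment H π u k * weightedMoment H π u n) := by
  have m1 : Measurable fun _ : S => (1 : ENNReal) := measurable_const
  calc b ^ m * weightedMoment H π u (k + n)
      = ∫⁻ s, (weightedOp H u)^[k + n] (fun _ => b ^ m * 1) s ∂π := by
        rw [weightedOp_iterate_const_mul hu m1,
          lintegral_const_mul _ (measurable_weightedOp_iterate hu m1 _), weightedMoment]
    _ ≤ ∫⁻ s, (weightedOp H u)^[k + n] ((weightedOp H u)^[m] fun _ => 1) s ∂π := by
        refine lintegral_mono fun s => ?_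
        refine (monotone_weightedOp.iterate (k + n)) (fun y => ?_) s
        rw [mul_one]
        exact pow_le_weightedOp_iterate_one hb m y
    _ = ∫⁻ s, (weightedOp H u)^[k] ((weightedOp H u)^[m + n] fun _ => 1) s ∂π := by
        simp_rw [← Function.iterate_add_apply]
        rw [show k + n + m = k + (m + n) by ring]
    _ ≤ ∫⁻ s, (weightedOp H u)^[k] (fun _ => (B ^ m * C * weightedMoment H π u n) * 1) s ∂π := by
        refine lintegral_mono fun s => ?_
        refine (monotone_weightedOp.iterate k) (fun y => ?_) s
        rw [mul_one]
        exact weightedOp_iterate_add_le hu hdom hB n m1 y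
    _ = _ := by
        rw [weightedOp_iterate_const_mul hu m1,
          lintegral_const_mul _ (measurable_weightedOp_iterate hu m1 _), weightedMoment, weightedMoment]
        ring

variable {μ : Measure Ω} {x : ℤ → Ω → S}

/-- A Feynman–Kac formula: each application of the Markov property absorbs the last factor of the
product into one more application of the operator. -/
lemma IsStationaryMarkovChain.lintegral_mul_prod [IsMarkovKernel H] [IsFiniteMeasure μ]
    (hx : IsStationaryMarkovChain H π μ x) (hu : Measurable u) (k : ℤ) {Y : Ω → ENNReal}
    (hY : Measurable[past x k] Y) (n : ℕ) (hg : Measurable g) :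
    ∫⁻ w, Y w * (∏ i ∈ Finset.range n, u (x (k + 1 + i) w)) * g (x (k + n) w) ∂μ
      = ∫⁻ w, Y w * (weightedOp H u)^[n] g (x k w) ∂μ := by
  induction n generalizing g with
  | zero => simp
  | succ n ih =>
    rw [Function.iterate_succ_apply, ← ih (measurable_weightedOp hu hg)]
    have hZ : Measurable[past x (k + n)] fun w =>
        Y w * ∏ i ∈ Finset.range n, u (x (k + 1 + i) w) := by
      refine Measurable.mul (hY.mono (past_mono x (by omega)) le_rfl)
        (Finset.measurable_fun_prod _ fun i hi => hu.comp (measurable_past x ?_))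
      have := Finset.mem_range.1 hi
      omega
    refine Eq.trans ?_ (hx.lintegral_mul_succ (k + n) hZ (hu.mul hg))
    refine lintegral_congr fun w => ?_
    rw [Finset.prod_range_succ, show k + ((n + 1 : ℕ) : ℤ) = k + n + 1 by push_cast; ring,
      show k + 1 + (n : ℤ) = k + n + 1 by ring]
    ring

/-- The times `0, -1, …, -(n - 1)` are the `n` steps that follow the time `-n`, in reverse order. -/
lemma IsStationaryMarkovChain.lintegral_prod_neg [IsMarkovKernel H] [IsFiniteMeasure μ]
    (hx : IsStationaryMarkovChain H π μ x) (hu : Measurable u) (n : ℕ) :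
    ∫⁻ w, ∏ i ∈ Finset.range n, u (x (-i) w) ∂μ = weightedMoment H π u n := by
  have m1 : Measurable fun _ : S => (1 : ENNReal) := measurable_const
  have h := hx.lintegral_mul_prod hu (-n) (Y := fun _ => 1) measurable_const n m1
  simp only [one_mul, mul_one] at h
  rw [weightedMoment, ← hx.map_eq (-n), lintegral_map (measurable_weightedOp_iterate hu m1 n)
    (hx.measurable _), ← h]
  refine lintegral_congr fun w => ?_
  rw [← Finset.prod_range_reflect]
  refine Finset.prod_congr rfl fun i hi => ?_
  have := Finset.mem_range.1 hi
  congr 2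
  omega

end Weighted

/-! ### Consequences of the mixing assumption -/

section Mixing

variable {S : Type*} [MeasurableSpace S] {H : Kernel S S} [IsMarkovKernel H] {π : Measure S}
  [IsProbabilityMeasure π]

lemma bind_pow_eq (hπ : π.bind H = π) (n : ℕ) : π.bind (H ^ n : Kernel S S) = π := by
  induction n with
  | zero => exact Measure.bind_dirac
  | succ n ih =>
    have : (H ^ (n + 1) : Kernel S S) ∘ₘ π = H ∘ₘ ((H ^ n : Kernel S S) ∘ₘ π) := by
      rw [Measure.comp_assoc, pow_succ']; rfl
    rw [this, ih, hπ]

lemma lintegral_pow_eq (hπ : π.bind H = π) (n : ℕ) {A : Set S} (hA : MeasurableSet A) :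
    ∫⁻ s, (H ^ n : Kernel S S) s A ∂π = π A := by
  conv_rhs => rw [← bind_pow_eq hπ n]
  rw [Measure.bind_apply hA (Kernel.aemeasurable _)]

/-- Some power of `H` is dominated by `π`. -/
lemma exists_pow_le_mul (hπ : π.bind H = π) (h : FiniteIrreducible H ∨ UniformlyDominated H) :
    ∃ (m : ℕ) (C : ENNReal), C ≠ ⊤ ∧ ∀ s A, MeasurableSet A → (H ^ m) s A ≤ C * π A := by
  rcases h with ⟨hfin, hsing, hirr⟩ | ⟨c, ψ, m, hc, hψ, h⟩
  · have := Fintype.ofFinite S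
    -- Some state is charged by `π`; irreducibility leads from it to `t`, and invariance then
    -- charges `t`.
    have hpos : ∀ t, π {t} ≠ 0 := by
      intro t ht
      obtain ⟨s, hs⟩ : ∃ s, π {s} ≠ 0 := by
        by_contra! h0
        have : π Set.univ = 0 := by
          rw [← Set.iUnion_of_singleton S]
          exact measure_iUnion_null h0
        simp at this
      obtain ⟨n, hn⟩ := hirr s t
      have h1 := lintegral_pow_eq hπ n (measurableSet_singleton t)
      rw [ht, lintegral_fintype, Finset.sum_eq_zero_iff] at h1
      have h2 := h1 s (Finset.mem_univ _)
      rw [mul_eq_zero] at h2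
      exact h2.elim (fun h => hn.ne' h) hs
    -- No step is needed: the point mass at `s` is at most `π / π {s}`, and the sum of the inverse
    -- masses bounds all these constants at once.
    refine ⟨0, ∑ t, (π {t})⁻¹, by simp [ENNReal.sum_eq_top, hpos], fun s A hA => ?_⟩
    rw [pow_zero, show (1 : Kernel S S) = Kernel.id from rfl, Kernel.id_apply,
      Measure.dirac_apply' _ hA]
    by_cases hs : s ∈ A
    · rw [Set.indicator_of_mem hs, Pi.one_apply,
        ← ENNReal.inv_mul_cancel (hpos s) (measure_ne_top _ _)]
      gcongr
      · exact Finset.single_le_sum (f := fun t => (π {t})⁻¹) (fun _ _ => zero_le) (Finset.mem_univ s)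
      · simpa using hs
    · simp [hs]
  · refine ⟨m, ENNReal.ofReal c * ENNReal.ofReal c, by finiteness, fun s A hA => ?_⟩
    refine (h s A hA).2.trans ?_
    rw [mul_assoc]
    gcongr
    -- Integrating the lower bound against the invariant law compares `ψ` with `π`; the constant
    -- becomes `c²`.
    have h1 : ENNReal.ofReal c⁻¹ * ψ A ≤ π A := by
      rw [← lintegral_pow_eq hπ m hA]
      calc ENNReal.ofReal c⁻¹ * ψ A = ∫⁻ _, ENNReal.ofReal c⁻¹ * ψ A ∂π := by simp
        _ ≤ _ := lintegral_mono fun s => (h s A hA).1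
    calc ψ A = ENNReal.ofReal c * (ENNReal.ofReal c⁻¹ * ψ A) := by
          rw [← mul_assoc, ← ENNReal.ofReal_mul (by linarith), mul_inv_cancel₀ (by linarith)]
          simp
      _ ≤ _ := by gcongr

/-- A sum of powers of `H` is minorized by `π`. -/
lemma exists_mul_le_sum_pow (hπ : π.bind H = π)
    (h : FiniteIrreducible H ∨ UniformlyDominated H) :
    ∃ (J : ℕ) (c : ENNReal), c ≠ 0 ∧
      ∀ s A, MeasurableSet A → c * π A ≤ ∑ j ∈ Finset.range J, (H ^ j) s A := by
  rcases h with ⟨hfin, hsing, hirr⟩ | ⟨c, ψ, m, hc, hψ, h⟩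
  · have := Fintype.ofFinite S
    choose n hn using hirr
    -- The constant is the least of the finitely many positive probabilities `Hⁿ(s, {t})`. For
    -- nonempty `A`, one point of `A` already suffices because `π A ≤ 1`.
    refine ⟨(Finset.univ.sup fun p : S × S => n p.1 p.2) + 1,
      Finset.univ.inf fun p : S × S => (H ^ n p.1 p.2) p.1 {p.2}, ?_, fun s A hA => ?_⟩
    · refine (pos_iff_ne_zero.1 ?_)
      rw [Finset.lt_inf_iff (by simp)]
      exact fun p _ => hn p.1 p.2
    · rcases A.eq_empty_or_nonempty with rfl | ⟨t, ht⟩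
      · simp
      · calc _ ≤ (H ^ n s t) s {t} * 1 :=
              mul_le_mul' (Finset.inf_le (f := fun p : S × S => (H ^ n p.1 p.2) p.1 {p.2})
                (Finset.mem_univ (s, t))) prob_le_one
          _ ≤ (H ^ n s t) s A := by
              rw [mul_one]; exact measure_mono (Set.singleton_subset_iff.2 ht)
          _ ≤ _ := Finset.single_le_sum (f := fun j => (H ^ j) s A) (fun _ _ => zero_le)
              (Finset.mem_range.2 (Nat.lt_succ_of_le
                (Finset.le_sup (f := fun p : S × S => n p.1 p.2) (Finset.mem_univ (s, t)))))
  · refine ⟨m + 1, ENNReal.ofReal c⁻¹ * ENNReal.ofReal c⁻¹, ?_, fun s A hA => ?_⟩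
    · have : 0 < c := by linarith
      simp [this]
    · have h1 : π A ≤ ENNReal.ofReal c * ψ A := by
        rw [← lintegral_pow_eq hπ m hA]
        calc _ ≤ ∫⁻ _, ENNReal.ofReal c * ψ A ∂π := lintegral_mono fun s => (h s A hA).2
          _ = _ := by simp
      calc _ ≤ ENNReal.ofReal c⁻¹ * ENNReal.ofReal c⁻¹ * (ENNReal.ofReal c * ψ A) := by gcongr
        _ = ENNReal.ofReal c⁻¹ * ψ A := by
            rw [← mul_assoc, mul_assoc (ENNReal.ofReal c⁻¹), ← ENNReal.ofReal_mul
              (inv_nonneg.2 (by linarith)), inv_mul_cancel₀ (by linarith)]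
            simp
        _ ≤ (H ^ m) s A := (h s A hA).1
        _ ≤ _ := Finset.single_le_sum (f := fun j => (H ^ j) s A) (fun _ _ => zero_le)
            (Finset.mem_range.2 (Nat.lt_succ_self m))

end Mixing

/-! ### The walk in a fixed environment -/

section Quenched

variable {ω : Env}

lemma lintegral_stepLaw (ω : Env) (i : ℤ) (g : ℤ → ENNReal) :
    ∫⁻ j, g j ∂(stepLaw ω i)
      = ENNReal.ofReal (ω i) * g (i + 1) + ENNReal.ofReal (1 - ω i) * g (i - 1) := by
  simp [stepLaw, lintegral_add_measure, lintegral_smul_measure]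

lemma integral_stepLaw (ω : Env) (i : ℤ) (g : ℤ → ℝ) :
    ∫ j, g j ∂(stepLaw ω i) = ω i * g (i + 1) + (1 - ω i) * g (i - 1) := by
  have h := (ω i).2
  rw [stepLaw, integral_add_measure, integral_smul_measure, integral_smul_measure, integral_dirac,
    integral_dirac, ENNReal.toReal_ofReal h.1.le, ENNReal.toReal_ofReal (by linarith [h.2])]
  · rfl
  all_goals exact (integrable_dirac (by simp)).smul_measure ENNReal.ofReal_ne_top

lemma map_quenchedLaw_succ (ω : Env) (n : ℕ) :
    (quenchedLaw ω).map (fun X => (Preorder.frestrictLe (π := fun _ => ℤ) n X, X (n + 1)))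
      = ((quenchedLaw ω).map (Preorder.frestrictLe n)) ⊗ₘ stepKernel ω n := by
  rw [quenchedLaw, ← Kernel.partialTraj_compProd_eq_map_traj (Nat.zero_le n),
    Kernel.traj_map_frestrictLe_apply]

lemma ae_quenchedLaw_zero (ω : Env) : ∀ᵐ X ∂(quenchedLaw ω), X 0 = 0 := by
  have h1 := Kernel.traj_map_frestrictLe_apply (κ := stepKernel ω) (X := fun _ => ℤ) 0 0
    (fun _ => 0)
  rw [Kernel.partialTraj_self, Kernel.id_apply] at h1
  have h2 : ∀ᵐ z ∂(quenchedLaw ω).map (Preorder.frestrictLe (π := fun _ => ℤ) 0),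
      z ⟨0, Finset.mem_Iic.2 le_rfl⟩ = 0 := by
    rw [quenchedLaw, h1, ae_dirac_iff (Set.to_countable _).measurableSet]
  exact ae_of_ae_map (Preorder.measurable_frestrictLe 0).aemeasurable h2

lemma ae_quenchedLaw_step (ω : Env) (n : ℕ) :
    ∀ᵐ X ∂(quenchedLaw ω), X (n + 1) = X n + 1 ∨ X (n + 1) = X n - 1 := by
  have h : ∀ᵐ p ∂(quenchedLaw ω).map
      (fun X => (Preorder.frestrictLe (π := fun _ => ℤ) n X, X (n + 1))),
      p.2 = p.1 ⟨n, Finset.mem_Iic.2 le_rfl⟩ + 1 ∨ p.2 = p.1 ⟨n, Finset.mem_Iic.2 le_rfl⟩ - 1 := by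
    rw [map_quenchedLaw_succ]
    refine Measure.ae_compProd_of_ae_ae (Set.to_countable _).measurableSet (ae_of_all _ fun z => ?_)
    change ∀ᵐ j ∂(stepLaw ω (z ⟨n, Finset.mem_Iic.2 le_rfl⟩)), _
    rw [ae_iff, ← lintegral_indicator_one (Set.to_countable _).measurableSet, lintegral_stepLaw]
    simp
  exact ae_of_ae_map (by fun_prop) h

lemma ae_quenchedLaw_nearestNeighbor (ω : Env) :
    ∀ᵐ X ∂(quenchedLaw ω), X 0 = 0 ∧ ∀ n, X (n + 1) = X n + 1 ∨ X (n + 1) = X n - 1 :=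
  (ae_quenchedLaw_zero ω).and (ae_all_iff.2 (ae_quenchedLaw_step ω))

lemma abs_le_of_nearestNeighbor {X : ℕ → ℤ}
    (hX : X 0 = 0 ∧ ∀ n, X (n + 1) = X n + 1 ∨ X (n + 1) = X n - 1) (n : ℕ) : |X n| ≤ n := by
  induction n with
  | zero => simp [hX.1]
  | succ n ih =>
    push_cast
    rw [abs_le] at ih ⊢
    rcases hX.2 n with h | h <;> rw [h] <;> constructor <;> linarith [ih.1, ih.2]

/-- A function of the path up to time `n` factors through the restriction to times `≤ n`. -/
lemma exists_eq_comp_frestrictLe {β : Type*} {n : ℕ} {f : (ℕ → ℤ) → β}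
    (hf : DependsOn f (Set.Iic n)) :
    ∃ F : (Finset.Iic n → ℤ) → β, ∀ X, f X = F (Preorder.frestrictLe (π := fun _ => ℤ) n X) := by
  refine ⟨fun z => f fun i => if h : i ≤ n then z ⟨i, Finset.mem_Iic.2 h⟩ else 0, fun X => ?_⟩
  refine hf fun i hi => ?_
  rw [dif_pos (show i ≤ n from hi)]
  rfl

lemma measurable_of_dependsOn_Iic {n : ℕ} {f : (ℕ → ℤ) → ℝ} (hf : DependsOn f (Set.Iic n)) :
    Measurable f := by
  obtain ⟨F, hF⟩ := exists_eq_comp_frestrictLe hf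
  rw [show f = F ∘ Preorder.frestrictLe (π := fun _ => ℤ) n from funext hF]
  exact (measurable_of_countable F).comp (Preorder.measurable_frestrictLe n)

lemma stronglyMeasurable_piLE_of_dependsOn_Iic {n : ℕ} {f : (ℕ → ℤ) → ℝ}
    (hf : DependsOn f (Set.Iic n)) :
    StronglyMeasurable[Filtration.piLE (X := fun _ => ℤ) n] f := by
  obtain ⟨F, hF⟩ := exists_eq_comp_frestrictLe hf
  rw [show f = F ∘ Preorder.frestrictLe (π := fun _ => ℤ) n from funext hF,
    Filtration.piLE_eq_comap_frestrictLe]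
  exact ((measurable_of_countable F).comp (comap_measurable _)).stronglyMeasurable

/-- Nearest-neighbour paths from `0` have finitely many possible histories up to time `n`, so no
growth condition on functions of the walk is ever required. -/
lemma integrable_of_dependsOn_Iic (ω : Env) {n : ℕ} {f : (ℕ → ℤ) → ℝ}
    (hf : DependsOn f (Set.Iic n)) : Integrable f (quenchedLaw ω) := by
  obtain ⟨F, hF⟩ := exists_eq_comp_frestrictLe hf
  have hfin : (Set.univ.pi fun _ : Finset.Iic n => Set.Icc (-n : ℤ) n).Finite :=
    Set.Finite.pi fun _ => Set.finite_Icc _ _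
  obtain ⟨B, hB⟩ := (hfin.image fun z => ‖F z‖).bddAbove
  refine Integrable.of_bound (measurable_of_dependsOn_Iic hf).aestronglyMeasurable B ?_
  filter_upwards [ae_quenchedLaw_nearestNeighbor ω] with X hX
  rw [hF X]
  refine hB ⟨_, fun i _ => ?_, rfl⟩
  have h1 := abs_le.1 (abs_le_of_nearestNeighbor hX i)
  have h2 := Finset.mem_Iic.1 i.2
  simp only [Preorder.frestrictLe_apply, Set.mem_Icc]
  omega

/-- The generator of the walk in the environment `ω`. -/
noncomputable def drift (ω : Env) (h : ℤ → ℝ) (i : ℤ) : ℝ :=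
  ω i * h (i + 1) + (1 - ω i) * h (i - 1) - h i

/-- The martingale increment `h(X_{k+1}) - h(X_k) - Lh(X_k)`. -/
noncomputable def increment (ω : Env) (h : ℤ → ℝ) (k : ℕ) (X : ℕ → ℤ) : ℝ :=
  h (X (k + 1)) - h (X k) - drift ω h (X k)

lemma dependsOn_increment (ω : Env) (h : ℤ → ℝ) {k n : ℕ} (hkn : k < n) :
    DependsOn (increment ω h k) (Set.Iic n) := by
  intro X Y hXY
  have h1 := hXY k (by simp; omega)
  have h2 := hXY (k + 1) (by simp; omega)
  simp only [increment, h1, h2]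

lemma dependsOn_mul {n : ℕ} {f g : (ℕ → ℤ) → ℝ} (hf : DependsOn f (Set.Iic n))
    (hg : DependsOn g (Set.Iic n)) : DependsOn (fun X => f X * g X) (Set.Iic n) :=
  fun X Y h => by simp only [hf h, hg h]

/-- Given the history, the next position has law `stepLaw` at the current site, and `drift` is
exactly the mean change of `h` under it. -/
lemma integral_mul_increment (ω : Env) (h : ℤ → ℝ) {k : ℕ} {f : (ℕ → ℤ) → ℝ}
    (hf : DependsOn f (Set.Iic k)) :
    ∫ X, f X * increment ω h k X ∂(quenchedLaw ω) = 0 := by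
  obtain ⟨F, hF⟩ := exists_eq_comp_frestrictLe hf
  have hint : Integrable (fun X => f X * increment ω h k X) (quenchedLaw ω) :=
    integrable_of_dependsOn_Iic ω (n := k + 1) (dependsOn_mul
      (fun X Y hXY => hf fun i hi => hXY i (le_trans hi (Nat.le_succ k)))
      (dependsOn_increment ω h (Nat.lt_succ_self k)))
  let G : (Finset.Iic k → ℤ) × ℤ → ℝ := fun p =>
    F p.1 * (h p.2 - h (p.1 ⟨k, Finset.mem_Iic.2 le_rfl⟩)
      - drift ω h (p.1 ⟨k, Finset.mem_Iic.2 le_rfl⟩))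
  have hGm : Measurable G := measurable_of_countable G
  have hG : (fun X => f X * increment ω h k X)
      = G ∘ fun X => (Preorder.frestrictLe (π := fun _ => ℤ) k X, X (k + 1)) := by
    ext X; simp only [hF X]; rfl
  have hφ : Measurable fun X : ℕ → ℤ => (Preorder.frestrictLe (π := fun _ => ℤ) k X, X (k + 1)) := by
    fun_prop
  rw [hG] at hint ⊢
  rw [← integrable_map_measure hGm.aestronglyMeasurable hφ.aemeasurable,
    map_quenchedLaw_succ] at hint
  have h1 := integral_map (μ := quenchedLaw ω) hφ.aemeasurable
    (hGm.aestronglyMeasurable (μ := (quenchedLaw ω).map _))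
  simp only [Function.comp_def]
  rw [← h1, map_quenchedLaw_succ, Measure.integral_compProd hint]
  refine integral_eq_zero_of_ae (ae_of_all _ fun z => ?_)
  change ∫ j, G (z, j) ∂(stepLaw ω (z ⟨k, Finset.mem_Iic.2 le_rfl⟩)) = 0
  rw [integral_stepLaw]
  simp only [G, drift]
  ring

lemma integral_increment (ω : Env) (h : ℤ → ℝ) (k : ℕ) :
    ∫ X, increment ω h k X ∂(quenchedLaw ω) = 0 := by
  simpa using integral_mul_increment ω h (k := k) (f := fun _ => 1) (fun _ _ _ => rfl)

/-- The martingale with increments `c_k · increment k`. -/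
noncomputable def martingaleSum (ω : Env) (h : ℤ → ℝ) (c : ℕ → ℝ) (n : ℕ) (X : ℕ → ℤ) : ℝ :=
  ∑ k ∈ Finset.range n, c k * increment ω h k X

lemma dependsOn_martingaleSum (ω : Env) (h : ℤ → ℝ) (c : ℕ → ℝ) (n : ℕ) :
    DependsOn (martingaleSum ω h c n) (Set.Iic n) := fun _ _ hXY =>
  Finset.sum_congr rfl fun k hk => by rw [dependsOn_increment ω h (Finset.mem_range.1 hk) hXY]

lemma martingale_martingaleSum (ω : Env) (h : ℤ → ℝ) (c : ℕ → ℝ) :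
    Martingale (martingaleSum ω h c) (Filtration.piLE (X := fun _ => ℤ)) (quenchedLaw ω) := by
  refine martingale_of_setIntegral_eq_succ
    (fun n => stronglyMeasurable_piLE_of_dependsOn_Iic (dependsOn_martingaleSum ω h c n))
    (fun n => integrable_of_dependsOn_Iic ω (dependsOn_martingaleSum ω h c n)) fun n s hs => ?_
  have hs' := Filtration.piLE.le n s hs
  rw [Filtration.piLE_eq_comap_frestrictLe] at hs
  obtain ⟨B, hB, rfl⟩ := hs
  have h1 : ∀ X, martingaleSum ω h c (n + 1) X
      = martingaleSum ω h c n X + c n * increment ω h n X := fun X => by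
    simp only [martingaleSum, Finset.sum_range_succ]
  simp only [h1]
  have hi := integrable_of_dependsOn_Iic ω (dependsOn_martingaleSum ω h c n)
  have hi2 : Integrable (fun X => c n * increment ω h n X) (quenchedLaw ω) :=
    (integrable_of_dependsOn_Iic ω (dependsOn_increment ω h (Nat.lt_succ_self n))).const_mul _
  rw [integral_add hi.integrableOn hi2.integrableOn, ← integral_indicator hs' (f := fun X => _ * _)]
  have h2 : ∫ X, (Preorder.frestrictLe (π := fun _ => ℤ) n ⁻¹' B).indicator
      (fun X => c n * increment ω h n X) X ∂(quenchedLaw ω)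
      = ∫ X, (Preorder.frestrictLe (π := fun _ => ℤ) n ⁻¹' B).indicator
        (fun _ => c n) X * increment ω h n X ∂(quenchedLaw ω) := by
    refine integral_congr_ae (ae_of_all _ fun X => ?_)
    by_cases hX : X ∈ Preorder.frestrictLe (π := fun _ => ℤ) n ⁻¹' B <;> simp [hX]
  rw [h2, integral_mul_increment, add_zero]
  intro X Y hXY
  have : Preorder.frestrictLe (π := fun _ => ℤ) n X = Preorder.frestrictLe (π := fun _ => ℤ) n Y := by
    ext i; exact hXY i (Finset.mem_Iic.1 i.2)
  have hmem : (X ∈ Preorder.frestrictLe (π := fun _ => ℤ) n ⁻¹' B)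
      = (Y ∈ Preorder.frestrictLe (π := fun _ => ℤ) n ⁻¹' B) := congrArg (· ∈ B) this
  by_cases hX : X ∈ Preorder.frestrictLe (π := fun _ => ℤ) n ⁻¹' B
  · exact (Set.indicator_of_mem hX _).trans (Set.indicator_of_mem (hmem.mp hX) fun _ => c n).symm
  · exact (Set.indicator_of_notMem hX _).trans (Set.indicator_of_notMem (hmem ▸ hX) fun _ => c n).symm

/-- Martingale increments are orthogonal: each cross term vanishes by `integral_mul_increment`. -/
lemma integral_sq_martingaleSum (ω : Env) (h : ℤ → ℝ) (c : ℕ → ℝ) (n : ℕ) :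
    ∫ X, martingaleSum ω h c n X ^ 2 ∂(quenchedLaw ω)
      = ∑ k ∈ Finset.range n, ∫ X, (c k * increment ω h k X) ^ 2 ∂(quenchedLaw ω) := by
  induction n with
  | zero => simp [martingaleSum]
  | succ n ih =>
    rw [Finset.sum_range_succ, ← ih]
    have hd := dependsOn_martingaleSum ω h c n
    have hdi := dependsOn_increment ω h (Nat.lt_succ_self n)
    have i1 : Integrable (fun X => martingaleSum ω h c n X ^ 2) (quenchedLaw ω) :=
      integrable_of_dependsOn_Iic ω (n := n) fun X Y hXY => by simp only [hd hXY]
    have i2 : Integrable (fun X => (c n * increment ω h n X) ^ 2) (quenchedLaw ω) :=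
      integrable_of_dependsOn_Iic ω (n := n + 1) fun X Y hXY => by simp only [hdi hXY]
    have hd2 : DependsOn (fun X => 2 * c n * martingaleSum ω h c n X) (Set.Iic n) :=
      fun X Y hXY => by simp only [hd hXY]
    have i3 : Integrable (fun X => 2 * c n * martingaleSum ω h c n X * increment ω h n X)
        (quenchedLaw ω) :=
      integrable_of_dependsOn_Iic ω (n := n + 1) (dependsOn_mul
        (fun X Y hXY => hd2 fun i hi => hXY i (le_trans hi (Nat.le_succ n))) hdi)
    have h1 : ∀ X, martingaleSum ω h c (n + 1) X ^ 2
        = martingaleSum ω h c n X ^ 2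
          + 2 * c n * martingaleSum ω h c n X * increment ω h n X
          + (c n * increment ω h n X) ^ 2 := fun X => by
      simp only [martingaleSum, Finset.sum_range_succ]; ring
    simp only [h1]
    have i13 : Integrable (fun X => martingaleSum ω h c n X ^ 2
        + 2 * c n * martingaleSum ω h c n X * increment ω h n X) (quenchedLaw ω) := i1.add i3
    rw [integral_add i13 i2, integral_add i1 i3, integral_mul_increment ω h hd2, add_zero]

lemma ae_exists_tendsto_martingaleSum (ω : Env) (h : ℤ → ℝ) (c : ℕ → ℝ) {K : ℝ}
    (hK : ∀ n, ∑ k ∈ Finset.range n, ∫ X, (c k * increment ω h k X) ^ 2 ∂(quenchedLaw ω) ≤ K) :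
    ∀ᵐ X ∂(quenchedLaw ω), ∃ l, Tendsto (fun n => martingaleSum ω h c n X) atTop (𝓝 l) := by
  refine Submartingale.exists_ae_tendsto_of_bdd (R := (1 + K).toNNReal)
    (martingale_martingaleSum ω h c).submartingale fun n => ?_
  have hd := dependsOn_martingaleSum ω h c n
  have i0 := integrable_of_dependsOn_Iic ω hd
  have i1 : Integrable (fun X => martingaleSum ω h c n X ^ 2) (quenchedLaw ω) :=
      integrable_of_dependsOn_Iic ω (n := n) fun X Y hXY => by simp only [hd hXY]
  rw [eLpNorm_one_eq_lintegral_enorm, ← ofReal_integral_norm_eq_lintegral_enorm i0]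
  refine ENNReal.ofReal_le_ofReal ?_
  -- The bound `|t| ≤ 1 + t²` turns boundedness in L² into the L¹ boundedness required for almost
  -- sure convergence.
  calc ∫ X, ‖martingaleSum ω h c n X‖ ∂(quenchedLaw ω)
      ≤ ∫ X, (1 + martingaleSum ω h c n X ^ 2) ∂(quenchedLaw ω) := by
        refine integral_mono i0.norm ((integrable_const _).add i1) fun X => ?_
        rw [Real.norm_eq_abs]
        nlinarith [sq_abs (martingaleSum ω h c n X), sq_nonneg (|martingaleSum ω h c n X| - 1),
          abs_nonneg (martingaleSum ω h c n X)]
    _ = 1 + ∑ k ∈ Finset.range n, ∫ X, (c k * increment ω h k X) ^ 2 ∂(quenchedLaw ω) := by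
        rw [integral_add (integrable_const _) i1, integral_sq_martingaleSum]
        simp
    _ ≤ 1 + K := by linarith [hK n]

/-- **Kronecker's lemma** for the weights `1 / (k + 1)`. -/
lemma tendsto_sum_div_of_tendsto_sum_inv_mul {a : ℕ → ℝ} {l : ℝ}
    (h : Tendsto (fun n => ∑ k ∈ Finset.range n, ((k : ℝ) + 1)⁻¹ * a k) atTop (𝓝 l)) :
    Tendsto (fun n : ℕ => (∑ k ∈ Finset.range n, a k) / n) atTop (𝓝 0) := by
  set s : ℕ → ℝ := fun n => ∑ k ∈ Finset.range n, ((k : ℝ) + 1)⁻¹ * a k with hs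
  -- Abel summation. After division by `n`, what remains is `s n` minus its Cesàro mean, and both
  -- tend to `l`.
  have habel : ∀ n : ℕ, ∑ k ∈ Finset.range n, a k = n * s n - ∑ k ∈ Finset.range n, s k := by
    intro n
    induction n with
    | zero => simp
    | succ n ih =>
      have hn : ((n : ℝ) + 1) ≠ 0 := by positivity
      have h1 : s (n + 1) = s n + ((n : ℝ) + 1)⁻¹ * a n := by simp [hs, Finset.sum_range_succ]
      rw [Finset.sum_range_succ, ih, Finset.sum_range_succ, h1]
      push_cast
      field_simp
      ring
  have h2 : Tendsto (fun n => s n - (n : ℝ)⁻¹ * ∑ k ∈ Finset.range n, s k) atTop (𝓝 (l - l)) :=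
    h.sub h.cesaro
  rw [sub_self] at h2
  refine h2.congr' ?_
  filter_upwards [eventually_ne_atTop 0] with n hn
  have : (n : ℝ) ≠ 0 := by exact_mod_cast hn
  rw [habel]
  field_simp

/-- The oscillation of `h` around `i`. -/
def localVar (h : ℤ → ℝ) (i : ℤ) : ℝ := |h (i + 1) - h i| + |h i - h (i - 1)|

lemma localVar_nonneg (h : ℤ → ℝ) (i : ℤ) : 0 ≤ localVar h i := by
  unfold localVar; positivity

lemma abs_drift_le (ω : Env) (h : ℤ → ℝ) (i : ℤ) : |drift ω h i| ≤ localVar h i := by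
  have h1 := (ω i).2
  have h2 : drift ω h i = ω i * (h (i + 1) - h i) - (1 - ω i) * (h i - h (i - 1)) := by
    simp only [drift]; ring
  rw [h2, localVar]
  refine (abs_sub _ _).trans (add_le_add ?_ ?_)
  · rw [abs_mul, abs_of_pos h1.1]
    exact mul_le_of_le_one_left (abs_nonneg _) h1.2.le
  · rw [abs_mul, abs_of_pos (by linarith [h1.2])]
    exact mul_le_of_le_one_left (abs_nonneg _) (by linarith [h1.1])

lemma ae_sq_increment_le (ω : Env) (h : ℤ → ℝ) (k : ℕ) :
    ∀ᵐ X ∂(quenchedLaw ω), increment ω h k X ^ 2 ≤ 4 * localVar h (X k) ^ 2 := by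
  filter_upwards [ae_quenchedLaw_step ω k] with X hX
  have h1 : |h (X (k + 1)) - h (X k)| ≤ localVar h (X k) := by
    unfold localVar
    rcases hX with hX | hX <;> rw [hX]
    · exact le_add_of_nonneg_right (abs_nonneg _)
    · rw [abs_sub_comm]; exact le_add_of_nonneg_left (abs_nonneg _)
  have h2 : |increment ω h k X| ≤ 2 * localVar h (X k) := by
    unfold increment
    refine (abs_sub _ _).trans ?_
    linarith [abs_drift_le ω h (X k)]
  rw [← sq_abs]
  calc |increment ω h k X| ^ 2 ≤ (2 * localVar h (X k)) ^ 2 := by gcongr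
    _ = _ := by ring

/-- The law of large numbers for the martingale part of `h(X_n)`. -/
lemma ae_tendsto_martingale_div (ω : Env) (h : ℤ → ℝ)
    (hfin : ∑' k : ℕ, ∫⁻ X, ENNReal.ofReal ((((k : ℝ) + 1)⁻¹ * localVar h (X k)) ^ 2) ∂(quenchedLaw ω)
      ≠ ⊤) :
    ∀ᵐ X ∂(quenchedLaw ω), Tendsto (fun n : ℕ =>
      (h (X n) - ∑ k ∈ Finset.range n, drift ω h (X k)) / n) atTop (𝓝 0) := by
  set b : ℕ → ENNReal := fun k =>
    ∫⁻ X, ENNReal.ofReal ((((k : ℝ) + 1)⁻¹ * localVar h (X k)) ^ 2) ∂(quenchedLaw ω) with hb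
  have hvar : ∀ k : ℕ, ∫ X, (((k : ℝ) + 1)⁻¹ * increment ω h k X) ^ 2 ∂(quenchedLaw ω)
      ≤ 4 * (b k).toReal := by
    intro k
    have hdep : DependsOn (fun X : ℕ → ℤ => (((k : ℝ) + 1)⁻¹ * localVar h (X k)) ^ 2)
        (Set.Iic k) := fun X Y hXY => by
      have := hXY k (by simp)
      simp only [this]
    have i1 := integrable_of_dependsOn_Iic ω hdep
    have i2 : Integrable (fun X => (((k : ℝ) + 1)⁻¹ * increment ω h k X) ^ 2) (quenchedLaw ω) :=
      integrable_of_dependsOn_Iic ω (n := k + 1) fun X Y hXY => by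
        simp only [dependsOn_increment ω h (Nat.lt_succ_self k) hXY]
    have h1 : (b k).toReal
        = ∫ X, (((k : ℝ) + 1)⁻¹ * localVar h (X k)) ^ 2 ∂(quenchedLaw ω) := by
      rw [integral_eq_lintegral_of_nonneg_ae (ae_of_all _ fun X => sq_nonneg _)
        i1.aestronglyMeasurable]
    rw [h1, ← integral_const_mul]
    refine integral_mono_ae i2 (i1.const_mul 4) ?_
    filter_upwards [ae_sq_increment_le ω h k] with X hX
    rw [mul_pow, mul_pow]
    nlinarith [sq_nonneg (((k : ℝ) + 1)⁻¹)]
  have hK : ∀ n, ∑ k ∈ Finset.range n,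
      ∫ X, (((k : ℝ) + 1)⁻¹ * increment ω h k X) ^ 2 ∂(quenchedLaw ω)
      ≤ 4 * (∑' k, b k).toReal := by
    intro n
    refine (Finset.sum_le_sum fun k _ => hvar k).trans ?_
    rw [← Finset.mul_sum, ← ENNReal.toReal_sum fun k _ => ENNReal.ne_top_of_tsum_ne_top hfin k]
    gcongr
    exact ENNReal.sum_le_tsum _
  filter_upwards [ae_exists_tendsto_martingaleSum ω h (fun k => ((k : ℝ) + 1)⁻¹) hK,
    ae_quenchedLaw_zero ω] with X ⟨l, hl⟩ h0
  have h1 := tendsto_sum_div_of_tendsto_sum_inv_mul hl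
  have h2 : ∀ n, ∑ k ∈ Finset.range n, increment ω h k X
      = h (X n) - ∑ k ∈ Finset.range n, drift ω h (X k) - h 0 := by
    intro n
    simp only [increment, Finset.sum_sub_distrib]
    rw [← Finset.sum_sub_distrib, Finset.sum_range_sub (fun k => h (X k)), h0]
    ring
  have h3 := h1.add (tendsto_const_div_atTop_nhds_zero_nat (h 0))
  rw [add_zero] at h3
  refine h3.congr fun n => ?_
  rw [h2, ← add_div]
  congr 1
  ring

/-- The Green function at `i` is bounded by a nonnegative potential of the unit charge at `i`. -/
lemma tsum_quenchedLaw_le_of_drift_eq (ω : Env) {h : ℤ → ℝ} {i : ℤ} (h0 : ∀ j, 0 ≤ h j)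
    (hL : ∀ j, drift ω h j = if j = i then -1 else 0) :
    ∑' k : ℕ, quenchedLaw ω {X | X k = i} ≤ ENNReal.ofReal (h 0) := by
  refine ENNReal.tsum_le_of_sum_range_le fun n => ?_
  have hms : ∀ k : ℕ, MeasurableSet {X : ℕ → ℤ | X k = i} := fun k =>
    measurable_pi_apply (X := fun _ : ℕ => ℤ) k (measurableSet_singleton i)
  have hih : ∀ k : ℕ, Integrable (fun X : ℕ → ℤ => h (X k)) (quenchedLaw ω) := fun k =>
    integrable_of_dependsOn_Iic ω (n := k) fun X Y hXY => by
      have := hXY k (by simp); simp only [this]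
  have hid : ∀ k : ℕ, Integrable (fun X : ℕ → ℤ => drift ω h (X k)) (quenchedLaw ω) := fun k =>
    integrable_of_dependsOn_Iic ω (n := k) fun X Y hXY => by
      have := hXY k (by simp); simp only [this]
  -- Since the drift is minus the indicator of `i`, the occupation probabilities telescope to `h 0 -
  -- E h(X_n)`, and `h` is nonnegative.
  have hstep : ∀ k : ℕ, (quenchedLaw ω).real {X | X k = i}
      = ∫ X, h (X k) ∂(quenchedLaw ω) - ∫ X, h (X (k + 1)) ∂(quenchedLaw ω) := by
    intro k
    have h1 := integral_increment ω h k
    have h2 : ∫ X, drift ω h (X k) ∂(quenchedLaw ω) = -(quenchedLaw ω).real {X | X k = i} := by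
      rw [← integral_indicator_one (hms k), ← integral_neg]
      refine integral_congr_ae (ae_of_all _ fun X => ?_)
      by_cases hX : X k = i <;> simp [hL, hX]
    simp only [increment] at h1
    have hsub : Integrable (fun X : ℕ → ℤ => h (X (k + 1)) - h (X k)) (quenchedLaw ω) :=
      (hih _).sub (hih _)
    rw [integral_sub hsub (hid k), integral_sub (hih _) (hih _), h2] at h1
    linarith
  have hsum : ∑ k ∈ Finset.range n, (quenchedLaw ω).real {X | X k = i} ≤ h 0 := by
    simp only [hstep]
    rw [Finset.sum_range_sub']
    have h1 : ∫ X, h (X 0) ∂(quenchedLaw ω) = h 0 := by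
      have : (fun X : ℕ → ℤ => h (X 0)) =ᵐ[quenchedLaw ω] fun _ => h 0 := by
        filter_upwards [ae_quenchedLaw_zero ω] with X hX
        rw [hX]
      rw [integral_congr_ae this]
      simp
    have h2 : 0 ≤ ∫ X, h (X n) ∂(quenchedLaw ω) := integral_nonneg fun X => h0 _
    linarith
  calc ∑ k ∈ Finset.range n, quenchedLaw ω {X | X k = i}
      = ENNReal.ofReal (∑ k ∈ Finset.range n, (quenchedLaw ω).real {X | X k = i}) := by
        rw [ENNReal.ofReal_sum_of_nonneg fun _ _ => measureReal_nonneg]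
        simp
    _ ≤ _ := ENNReal.ofReal_le_ofReal hsum

end Quenched

/-! ### Harmonic coordinates and Green functions -/

lemma ratio_pos (a : Set.Ioo (0 : ℝ) 1) : 0 < ratio a :=
  div_pos (by linarith [a.2.2]) a.2.1

lemma mul_ratio (a : Set.Ioo (0 : ℝ) 1) : (a : ℝ) * ratio a = 1 - a :=
  mul_div_cancel₀ _ a.2.1.ne'

/-- The function on `ℤ` with increments `f` that vanishes at `0`. -/
noncomputable def siteSum (f : ℤ → ℝ) (i : ℤ) : ℝ :=
  ∑ j ∈ Finset.Ico 0 i, f j - ∑ j ∈ Finset.Ico i 0, f j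

lemma siteSum_succ (f : ℤ → ℝ) (i : ℤ) : siteSum f (i + 1) = siteSum f i + f i := by
  unfold siteSum
  rcases le_or_gt 0 i with hi | hi
  · have h1 : Finset.Ico 0 (i + 1) = insert i (Finset.Ico 0 i) := by
      ext j; simp only [Finset.mem_Ico, Finset.mem_insert]; omega
    have h2 : Finset.Ico (i + 1) 0 = ∅ := Finset.Ico_eq_empty (by omega)
    have h3 : Finset.Ico i 0 = ∅ := Finset.Ico_eq_empty (by omega)
    rw [h1, h2, h3, Finset.sum_insert (by simp)]
    simp [add_comm]
  · have h1 : Finset.Ico i 0 = insert i (Finset.Ico (i + 1) 0) := by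
      ext j; simp only [Finset.mem_Ico, Finset.mem_insert]; omega
    have h2 : Finset.Ico 0 (i + 1) = ∅ := Finset.Ico_eq_empty (by omega)
    have h3 : Finset.Ico 0 i = ∅ := Finset.Ico_eq_empty (by omega)
    rw [h1, h2, h3, Finset.sum_insert (by simp)]
    simp

lemma siteSum_natCast (f : ℤ → ℝ) (n : ℕ) :
    siteSum f n = ∑ j ∈ Finset.range n, f (j : ℤ) := by
  induction n with
  | zero => simp [siteSum]
  | succ n ih => rw [Finset.sum_range_succ, ← ih, ← siteSum_succ]; push_cast; rfl

lemma siteSum_sub_pred (f : ℤ → ℝ) (i : ℤ) : siteSum f i - siteSum f (i - 1) = f (i - 1) := by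
  have := siteSum_succ f (i - 1)
  rw [sub_add_cancel] at this
  rw [this]; ring

lemma strictMono_siteSum {f : ℤ → ℝ} (hf : ∀ i, 0 < f i) : StrictMono (siteSum f) :=
  strictMono_int_of_lt_succ fun i => by rw [siteSum_succ]; linarith [hf i]

lemma drift_siteSum (ω : Env) (f : ℤ → ℝ) (i : ℤ) :
    drift ω (siteSum f) i = ω i * f i - (1 - ω i) * f (i - 1) := by
  have h := siteSum_sub_pred f i
  rw [drift, siteSum_succ, show siteSum f (i - 1) = siteSum f i - f (i - 1) by linarith]
  ring

lemma localVar_siteSum (f : ℤ → ℝ) (i : ℤ) : localVar (siteSum f) i = |f i| + |f (i - 1)| := by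
  rw [localVar, siteSum_succ, siteSum_sub_pred, add_sub_cancel_left]

/-- An upper bound for the speed from a bounded function whose drift is at most `1`. -/
lemma ae_eventually_le_mul_of_drift_le (ω : Env) {f : ℤ → ℝ} {C m : ℝ} (hC : ∀ i, |f i| ≤ C)
    (hf : ∀ i, ω i * f i - (1 - ω i) * f (i - 1) ≤ 1) (hm : 0 < m)
    (hlim : Tendsto (fun n : ℕ => (∑ j ∈ Finset.range n, f (j : ℤ)) / n) atTop (𝓝 m)) :
    ∀ᵐ X ∂(quenchedLaw ω), ∀ δ : ℝ, 1 / m < δ → ∀ᶠ n : ℕ in atTop, (X n : ℝ) ≤ δ * n := by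
  have hfin : ∑' k : ℕ, ∫⁻ X, ENNReal.ofReal
      ((((k : ℝ) + 1)⁻¹ * localVar (siteSum f) (X k)) ^ 2) ∂(quenchedLaw ω) ≠ ⊤ := by
    have hs : Summable fun k : ℕ => (((k : ℝ) + 1)⁻¹ * (2 * C)) ^ 2 := by
      have h1 := ((summable_nat_add_iff 1).2
        (Real.summable_one_div_nat_pow.2 one_lt_two)).mul_right ((2 * C) ^ 2)
      refine h1.congr fun k => ?_
      push_cast
      rw [mul_pow (_ : ℝ)⁻¹, inv_pow, one_div]
    refine ne_top_of_le_ne_top hs.tsum_ofReal_ne_top (ENNReal.tsum_le_tsum fun k => ?_)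
    calc _ ≤ ∫⁻ _, ENNReal.ofReal ((((k : ℝ) + 1)⁻¹ * (2 * C)) ^ 2) ∂(quenchedLaw ω) := by
          refine lintegral_mono fun X => ENNReal.ofReal_le_ofReal ?_
          have h1 := localVar_nonneg (siteSum f) (X k)
          have h2 : localVar (siteSum f) (X k) ≤ 2 * C := by
            rw [localVar_siteSum]; linarith [hC (X k), hC (X k - 1)]
          gcongr
      _ = _ := by simp
  filter_upwards [ae_tendsto_martingale_div ω (siteSum f) hfin] with X hX δ hδ
  have hδ0 : 0 < δ := lt_trans (by positivity) hδ
  rw [div_lt_iff₀ hm] at hδ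
  -- With `1 < a < δ m`, the martingale law and the drift bound give `h(X_n) < a n` eventually,
  -- while `X_n > δ n` would give `h(X_n) > (a/δ) X_n > a n`. The lower bound on `n` ensures that
  -- `X_n` is large enough for the averages of `f` to exceed `a/δ`.
  obtain ⟨a, ha1, ha2⟩ := exists_between hδ
  have ham : a / δ < m := by rw [div_lt_iff₀ hδ0]; linarith
  obtain ⟨N, hN⟩ := eventually_atTop.1 ((tendsto_order.1 hlim).1 _ ham)
  filter_upwards [(tendsto_order.1 hX).2 (a - 1) (by linarith), eventually_gt_atTop 0,
    tendsto_natCast_atTop_atTop.eventually (eventually_ge_atTop ((N + 1 : ℕ) / δ))] with n h1 h2 h3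
  by_contra! h4
  have hn : (0 : ℝ) < n := by exact_mod_cast h2
  have h5 : ((N + 1 : ℕ) : ℝ) < X n := by
    rw [div_le_iff₀ hδ0] at h3; linarith
  have h6 : ((N + 1 : ℕ) : ℤ) < X n := by exact_mod_cast h5
  obtain ⟨p, hp⟩ := Int.eq_ofNat_of_zero_le (show 0 ≤ X n by omega)
  have hpN : N ≤ p := by omega
  have hp0 : (0 : ℝ) < p := by
    have : 0 < p := by omega
    exact_mod_cast this
  have h7 := hN p hpN
  rw [lt_div_iff₀ hp0, ← siteSum_natCast] at h7
  rw [div_lt_iff₀ hn, hp] at h1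
  have h8 : ∑ k ∈ Finset.range n, drift ω (siteSum f) (X k) ≤ n := by
    calc _ ≤ ∑ k ∈ Finset.range n, (1 : ℝ) :=
          Finset.sum_le_sum fun k _ => by rw [drift_siteSum]; exact hf _
      _ = n := by simp
  have h9 : δ * n < p := by rw [hp] at h4; exact_mod_cast h4
  have h10 : a * n < a / δ * p := by
    have ha0 : 0 < a := by linarith
    calc a * n = a / δ * (δ * n) := by field_simp
      _ < a / δ * p := by gcongr
  linarith

/-- The products `ρ_{i+1} ⋯ ρ_{i+k}`. -/
noncomputable def rightProd (ω : Env) (i : ℤ) (k : ℕ) : ℝ :=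
  ∏ r ∈ Finset.range k, ratio (ω (i + 1 + r))

lemma rightProd_nonneg (ω : Env) (i : ℤ) (k : ℕ) : 0 ≤ rightProd ω i k :=
  Finset.prod_nonneg fun _ _ => (ratio_pos _).le

lemma rightProd_succ (ω : Env) (i : ℤ) (k : ℕ) :
    rightProd ω i (k + 1) = rightProd ω i k * ratio (ω (i + 1 + k)) :=
  Finset.prod_range_succ _ _

/-- The potential of a unit charge at `i`. -/
noncomputable def potential (ω : Env) (i j : ℤ) : ℝ :=
  (1 / (ω i : ℝ)) * ∑' k, rightProd ω i (k + (j - i).toNat)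

lemma potential_nonneg (ω : Env) (i j : ℤ) : 0 ≤ potential ω i j :=
  mul_nonneg (one_div_nonneg.2 (ω i).2.1.le) (tsum_nonneg fun _ => rightProd_nonneg _ _ _)

lemma potential_sub_succ {ω : Env} {i : ℤ} (hs : Summable (rightProd ω i)) (n : ℕ) :
    potential ω i (i + n) - potential ω i (i + n + 1) = 1 / (ω i : ℝ) * rightProd ω i n := by
  have h1 : (i + n - i).toNat = n := by omega
  have h2 : (i + n + 1 - i).toNat = n + 1 := by omega
  have h3 := ((summable_nat_add_iff n).2 hs).tsum_eq_zero_add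
  rw [potential, potential, h1, h2, h3, zero_add]
  have h4 : ∀ k, rightProd ω i (k + 1 + n) = rightProd ω i (k + (n + 1)) := fun k => by
    rw [add_right_comm, add_assoc]
  simp only [h4]
  ring

lemma potential_of_le {ω : Env} {i j : ℤ} (h : j ≤ i) : potential ω i j = potential ω i i := by
  have h1 : (j - i).toNat = 0 := by omega
  simp [potential, h1]

/-- The potential is constant to the left of `i`. To the right its decrements are multiplied by
`ρ_j` at each site `j`, which is harmonicity. At `i` a right step, of probability `ω_i`, lowers it
by `1/ω_i`. -/
lemma drift_potential {ω : Env} {i : ℤ} (hs : Summable (rightProd ω i)) (j : ℤ) :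
    drift ω (potential ω i) j = if j = i then -1 else 0 := by
  have hd : drift ω (potential ω i) j = (1 - ω j) * (potential ω i (j - 1) - potential ω i j)
      - ω j * (potential ω i j - potential ω i (j + 1)) := by simp only [drift]; ring
  have hωi := (ω i).2.1.ne'
  rw [hd]
  rcases lt_trichotomy j i with h | rfl | h
  · rw [if_neg h.ne, potential_of_le h.le, potential_of_le (by omega : j - 1 ≤ i),
      potential_of_le (by omega : j + 1 ≤ i)]
    ring
  · have h1 := potential_sub_succ hs 0
    simp only [Nat.cast_zero, add_zero] at h1
    rw [if_pos rfl, h1, potential_of_le (by omega : j - 1 ≤ j)]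
    simp only [rightProd, Finset.range_zero, Finset.prod_empty]
    field_simp
    ring
  · obtain ⟨n, hn⟩ := Int.eq_ofNat_of_zero_le (show 0 ≤ j - i - 1 by omega)
    obtain rfl : j = i + 1 + n := by omega
    have h1 := potential_sub_succ hs n
    have h2 := potential_sub_succ hs (n + 1)
    rw [if_neg h.ne']
    have e1 : i + 1 + (n : ℤ) - 1 = i + n := by ring
    have e2 : i + (n : ℤ) + 1 = i + 1 + n := by ring
    have e3 : i + ((n + 1 : ℕ) : ℤ) = i + 1 + n := by push_cast; ring
    rw [e2] at h1
    rw [e3] at h2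
    rw [e1, h1, h2, rightProd_succ, ← mul_ratio]
    ring

lemma potential_le_self {ω : Env} {i : ℤ} (hs : Summable (rightProd ω i)) (j : ℤ) :
    potential ω i j ≤ potential ω i i := by
  unfold potential
  rw [sub_self, Int.toNat_zero]
  refine mul_le_mul_of_nonneg_left ?_ (one_div_nonneg.2 (ω i).2.1.le)
  simp only [add_zero]
  have h := hs.sum_add_tsum_nat_add (j - i).toNat
  linarith [Finset.sum_nonneg fun k (_ : k ∈ Finset.range (j - i).toNat) =>
    rightProd_nonneg ω i k]

lemma tsum_quenchedLaw_le_potential {ω : Env} {i : ℤ} (hs : Summable (rightProd ω i)) :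
    ∑' k : ℕ, quenchedLaw ω {X | X k = i} ≤ ENNReal.ofReal (potential ω i 0) :=
  tsum_quenchedLaw_le_of_drift_eq ω (potential_nonneg ω i) (drift_potential hs)

/-- The walk is bounded below if its hitting probabilities of the negative sites are summable. -/
lemma ae_bddBelow_of_tsum_potential {ω : Env} (hs : ∀ i, Summable (rightProd ω i))
    (hfin : ∑' n : ℕ, min (ENNReal.ofReal (potential ω (-(n + 1 : ℤ)) 0)) 1 ≠ ⊤) :
    ∀ᵐ X ∂(quenchedLaw ω), ∃ N : ℕ, ∀ n, -(N : ℤ) ≤ X n := by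
  -- A hitting probability is at most the expected number of visits. Borel–Cantelli then allows only
  -- finitely many negative sites to be hit.
  have h1 : ∑' n : ℕ, quenchedLaw ω {X | ∃ k, X k = -(n + 1 : ℤ)} ≠ ⊤ := by
    refine ne_top_of_le_ne_top hfin (ENNReal.tsum_le_tsum fun n => le_min ?_ prob_le_one)
    refine le_trans ?_ (tsum_quenchedLaw_le_potential (hs _))
    rw [Set.ofPred_exists]
    exact measure_iUnion_le _
  filter_upwards [ae_eventually_notMem h1] with X hX
  obtain ⟨N, hN⟩ := eventually_atTop.1 hX
  refine ⟨N, fun n => ?_⟩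
  by_contra! h
  obtain ⟨p, hp⟩ := Int.eq_ofNat_of_zero_le (show 0 ≤ -X n - 1 by omega)
  exact hN p (by omega) ⟨n, by omega⟩

/-- The sum over time is rewritten as a sum over sites weighted by the Green function, and the
potential at `i` is largest at `i` itself. -/
lemma tsum_lintegral_le_tsum_potential {ω : Env} (hs : ∀ i, Summable (rightProd ω i))
    (G : ℤ → ENNReal) :
    ∑' k : ℕ, ∫⁻ X, G (X k) ∂(quenchedLaw ω)
      ≤ ∑' i : ℤ, G i * ENNReal.ofReal (potential ω i i) := by
  have h1 : ∀ k : ℕ, ∫⁻ X, G (X k) ∂(quenchedLaw ω)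
      = ∑' i : ℤ, G i * quenchedLaw ω {X | X k = i} := by
    intro k
    have hk : Measurable fun X : ℕ → ℤ => X k := measurable_pi_apply k
    rw [← lintegral_map (measurable_of_countable G) hk, lintegral_countable']
    refine tsum_congr fun i => ?_
    rw [Measure.map_apply hk (measurableSet_singleton i)]
    rfl
  simp only [h1]
  rw [ENNReal.tsum_comm]
  refine ENNReal.tsum_le_tsum fun i => ?_
  rw [ENNReal.tsum_mul_left]
  gcongr
  exact (tsum_quenchedLaw_le_potential (hs i)).trans
    (ENNReal.ofReal_le_ofReal (potential_le_self (hs i) 0))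

/-- The law of large numbers in an environment with a well-behaved harmonic coordinate. -/
lemma ae_tendsto_div_of_drift_eq {ω : Env} {f : ℤ → ℝ} {ε m : ℝ} (hε : 0 < ε)
    (hell : ∀ i, (ω i : ℝ) < 1 - ε) (hpos : ∀ i, 0 < f i)
    (hf : ∀ i, ω i * f i = 1 + (1 - ω i) * f (i - 1))
    (hs : ∀ i, Summable (rightProd ω i))
    (hfin : ∑' i : ℤ, ENNReal.ofReal ((f i / (|(i : ℝ)| + 1)) ^ 2)
      * ENNReal.ofReal (potential ω i i) ≠ ⊤) (hm : 0 < m)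
    (hlim : Tendsto (fun n : ℕ => (∑ j ∈ Finset.range n, f (j : ℤ)) / n) atTop (𝓝 m)) :
    ∀ᵐ X ∂(quenchedLaw ω), Tendsto (fun n : ℕ => (X n : ℝ) / n) atTop (𝓝 m⁻¹) := by
  -- Ellipticity and the recursion bound `f (i - 1)` by `f i / ε`, so the oscillation at `i` is
  -- governed by `f i` alone.
  have hvar : ∀ i, localVar (siteSum f) i ≤ (1 + ε⁻¹) * f i := by
    intro i
    rw [localVar_siteSum, abs_of_pos (hpos i), abs_of_pos (hpos _)]
    have h1 : ε * f (i - 1) ≤ f i := by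
      have := (ω i).2
      nlinarith [hpos i, hpos (i - 1), hf i, hell i]
    have h2 : f (i - 1) ≤ ε⁻¹ * f i := by
      rw [inv_mul_eq_div, le_div_iff₀ hε]; linarith
    linarith
  -- Because `|X_k| ≤ k`, the weight `1/(k+1)` may be replaced by `1/(|X_k|+1)`. The summand then
  -- depends on the site only, and the Green function bound applies.
  have hfin' : ∑' k : ℕ, ∫⁻ X, ENNReal.ofReal
      ((((k : ℝ) + 1)⁻¹ * localVar (siteSum f) (X k)) ^ 2) ∂(quenchedLaw ω) ≠ ⊤ := by
    set G : ℤ → ENNReal := fun i =>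
      ENNReal.ofReal ((1 + ε⁻¹) ^ 2) * ENNReal.ofReal ((f i / (|(i : ℝ)| + 1)) ^ 2) with hG
    have h1 : ∑' i : ℤ, G i * ENNReal.ofReal (potential ω i i) ≠ ⊤ := by
      simp only [hG, mul_assoc]
      rw [ENNReal.tsum_mul_left]
      exact ENNReal.mul_ne_top ENNReal.ofReal_ne_top hfin
    refine ne_top_of_le_ne_top h1 (le_trans (ENNReal.tsum_le_tsum fun k => ?_)
      (tsum_lintegral_le_tsum_potential hs G))
    refine lintegral_mono_ae ?_
    filter_upwards [ae_quenchedLaw_nearestNeighbor ω] with X hX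
    rw [hG]
    simp only
    rw [← ENNReal.ofReal_mul (sq_nonneg _), ← mul_pow]
    refine ENNReal.ofReal_le_ofReal ?_
    have hk : |(X k : ℝ)| + 1 ≤ k + 1 := by
      have : |X k| ≤ (k : ℤ) := abs_le_of_nearestNeighbor hX k
      have h2 : |(X k : ℝ)| ≤ k := by exact_mod_cast this
      linarith
    have h3 := localVar_nonneg (siteSum f) (X k)
    refine pow_le_pow_left₀ (by positivity) ?_ 2
    calc ((k : ℝ) + 1)⁻¹ * localVar (siteSum f) (X k)
        ≤ (|(X k : ℝ)| + 1)⁻¹ * ((1 + ε⁻¹) * f (X k)) := by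
          gcongr
          exact hvar _
      _ = _ := by rw [div_eq_mul_inv]; ring
  filter_upwards [ae_tendsto_martingale_div ω (siteSum f) hfin'] with X hX
  have hdrift : ∀ i, drift ω (siteSum f) i = 1 := fun i => by
    rw [drift_siteSum, hf]; ring
  have h1 : Tendsto (fun n : ℕ => siteSum f (X n) / n) atTop (𝓝 1) := by
    have h2 := hX.add_const 1
    rw [zero_add] at h2
    refine h2.congr' ?_
    filter_upwards [eventually_ne_atTop 0] with n hn
    have : (n : ℝ) ≠ 0 := by exact_mod_cast hn
    simp only [hdrift, Finset.sum_const, Finset.card_range, nsmul_eq_mul, mul_one]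
    field_simp
    ring
  have hmono := strictMono_siteSum hpos
  -- Transience needs no separate argument: `h(X_n)` grows linearly and `h` is strictly increasing.
  have hXtop : Tendsto X atTop atTop := by
    refine tendsto_atTop.2 fun K => ?_
    have h2 : Tendsto (fun n : ℕ => siteSum f (X n)) atTop atTop := by
      have h3 := h1.pos_mul_atTop one_pos tendsto_natCast_atTop_atTop
      refine h3.congr' ?_
      filter_upwards [eventually_ne_atTop 0] with n hn
      have : (n : ℝ) ≠ 0 := by exact_mod_cast hn
      field_simp
    filter_upwards [h2.eventually (eventually_ge_atTop (siteSum f K))] with n hn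
    exact hmono.le_iff_le.1 hn
  have hXnat : Tendsto (fun n => (X n).toNat) atTop atTop := by
    refine tendsto_atTop.2 fun K => ?_
    filter_upwards [hXtop.eventually (eventually_ge_atTop (K : ℤ))] with n hn
    omega
  have h4 := hlim.comp hXnat
  have h5 : Tendsto (fun n : ℕ => siteSum f (X n) / n
      / ((∑ j ∈ Finset.range (X n).toNat, f (j : ℤ)) / ((X n).toNat : ℝ))) atTop (𝓝 (1 / m)) :=
    h1.div h4 hm.ne'
  rw [one_div] at h5
  refine h5.congr' ?_
  filter_upwards [eventually_ne_atTop 0, hXtop.eventually (eventually_ge_atTop 1)] with n hn hXn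
  have hn0 : (n : ℝ) ≠ 0 := by exact_mod_cast hn
  have e1 : (((X n).toNat : ℕ) : ℤ) = X n := by omega
  have e2 : (((X n).toNat : ℕ) : ℝ) = X n := by exact_mod_cast e1
  rw [← siteSum_natCast, e1, e2]
  have hX0 : (X n : ℝ) ≠ 0 := by
    have : X n ≠ 0 := by omega
    exact_mod_cast this
  have hg0 : siteSum f (X n) ≠ 0 := by
    have h6 : siteSum f 0 < siteSum f (X n) := hmono (by omega)
    have h7 : siteSum f 0 = 0 := by simp [siteSum]
    rw [h7] at h6
    exact h6.ne'
  field_simp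

/-! ### Products of the `ρ_i` along a stationary environment -/

lemma measurable_ratio : Measurable ratio := by
  unfold ratio; fun_prop

/-- `ρ_a ρ_{a+1} ⋯ ρ_{a+n-1}`, as an extended nonnegative real. -/
noncomputable def siteProd (ω : Env) (a : ℤ) (n : ℕ) : ENNReal :=
  ∏ r ∈ Finset.range n, ENNReal.ofReal (ratio (ω (a + r)))

/-- `E_P ∏_{i<n} ρ_i^β`, as an extended nonnegative real. -/
noncomputable def siteMoment (P : Measure Env) (β : ℝ) (n : ℕ) : ENNReal :=
  ∫⁻ ω, siteProd ω 0 n ^ β ∂P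

@[fun_prop]
lemma measurable_siteProd (a : ℤ) (n : ℕ) : Measurable fun ω => siteProd ω a n :=
  Finset.measurable_fun_prod _ fun r _ =>
    (measurable_ratio.comp (measurable_pi_apply (a + (r : ℤ)))).ennreal_ofReal

lemma siteProd_shift (k a : ℤ) (n : ℕ) (ω : Env) :
    siteProd (shift k ω) a n = siteProd ω (a + k) n := by
  simp only [siteProd, shift, add_right_comm]

lemma siteProd_ne_top (ω : Env) (a : ℤ) (n : ℕ) : siteProd ω a n ≠ ⊤ :=
  ENNReal.prod_ne_top fun _ _ => ENNReal.ofReal_ne_top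

lemma siteProd_eq_ofReal (ω : Env) (i : ℤ) (k : ℕ) :
    siteProd ω (i + 1) k = ENNReal.ofReal (rightProd ω i k) :=
  (ENNReal.ofReal_prod_of_nonneg fun _ _ => (ratio_pos _).le).symm

lemma siteProd_add (ω : Env) (a : ℤ) (l k : ℕ) :
    siteProd ω a (l + k) = siteProd ω a l * siteProd ω (a + l) k := by
  simp only [siteProd, Finset.prod_range_add]
  push_cast
  simp only [add_assoc]

lemma siteProd_zero (ω : Env) (a : ℤ) : siteProd ω a 0 = 1 := by simp [siteProd]

lemma siteProd_one (ω : Env) (a : ℤ) : siteProd ω a 1 = ENNReal.ofReal (ratio (ω a)) := by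
  simp [siteProd]

/-- The summands `(1/ω_{-l}) ρ_{-l+1} ⋯ ρ_0` of the mean crossing time. -/
noncomputable def crossingTerm (ω : Env) (l : ℕ) : ENNReal :=
  ENNReal.ofReal (1 / (ω (-l) : ℝ)) * siteProd ω (-l + 1) l

/-- The expected time to go from `0` to `1`. -/
noncomputable def crossingTime (ω : Env) : ENNReal := ∑' l, crossingTerm ω l

/-- A bound for the expected number of visits to `0`. -/
noncomputable def greenBound (ω : Env) : ENNReal :=
  ENNReal.ofReal (1 / (ω 0 : ℝ)) * ∑' k, siteProd ω 1 k

@[fun_prop]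
lemma measurable_crossingTerm (l : ℕ) : Measurable fun ω => crossingTerm ω l := by
  unfold crossingTerm
  have h : Measurable fun ω : Env => ENNReal.ofReal (1 / (ω (-l) : ℝ)) := by fun_prop
  exact h.mul (measurable_siteProd _ _)

@[fun_prop]
lemma measurable_crossingTime : Measurable crossingTime :=
  Measurable.tsum fun l => measurable_crossingTerm l

@[fun_prop]
lemma measurable_greenBound : Measurable greenBound := by
  unfold greenBound
  have h : Measurable fun ω : Env => ENNReal.ofReal (1 / (ω 0 : ℝ)) := by fun_prop
  exact h.mul (Measurable.tsum fun k => measurable_siteProd _ _)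

lemma crossingTerm_zero (ω : Env) : crossingTerm ω 0 = ENNReal.ofReal (1 / (ω 0 : ℝ)) := by
  simp [crossingTerm, siteProd_zero]

lemma crossingTerm_succ (ω : Env) (l : ℕ) :
    crossingTerm ω (l + 1) = ENNReal.ofReal (ratio (ω 0)) * crossingTerm (shift (-1) ω) l := by
  have h1 : -((l + 1 : ℕ) : ℤ) + 1 = -l := by push_cast; ring
  have h2 : -((l + 1 : ℕ) : ℤ) = -l + -1 := by push_cast; ring
  rw [crossingTerm, crossingTerm, siteProd_shift, h1, siteProd_add, siteProd_one, shift_apply, h2]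
  simp only [add_neg_cancel_right, neg_add_cancel]
  ring

/-- Multiplied by `ω 0`, this is the recursion expressing that the coordinate with increments
`crossingTime` has drift one. -/
lemma crossingTime_eq (ω : Env) :
    crossingTime ω = ENNReal.ofReal (1 / (ω 0 : ℝ))
      + ENNReal.ofReal (ratio (ω 0)) * crossingTime (shift (-1) ω) := by
  rw [crossingTime, tsum_eq_zero_add' ENNReal.summable, crossingTerm_zero]
  simp only [crossingTerm_succ]
  rw [ENNReal.tsum_mul_left, crossingTime]

lemma one_le_ofReal_one_div (a : Set.Ioo (0 : ℝ) 1) : 1 ≤ ENNReal.ofReal (1 / (a : ℝ)) := by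
  rw [ENNReal.one_le_ofReal, le_div_iff₀ a.2.1]
  linarith [a.2.2]

lemma one_le_crossingTime (ω : Env) : 1 ≤ crossingTime ω := by
  rw [crossingTime_eq]
  exact (one_le_ofReal_one_div _).trans le_self_add

lemma one_le_greenBound (ω : Env) : 1 ≤ greenBound ω := by
  have h : siteProd ω 1 0 ≤ ∑' k, siteProd ω 1 k := ENNReal.le_tsum 0
  rw [siteProd_zero] at h
  calc (1 : ENNReal) = 1 * 1 := by simp
    _ ≤ _ := mul_le_mul' (one_le_ofReal_one_div _) h

lemma summable_rightProd_of_tsum_siteProd {ω : Env} {i : ℤ}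
    (h : ∑' k, siteProd ω (i + 1) k ≠ ⊤) : Summable (rightProd ω i) := by
  refine (ENNReal.summable_toReal h).congr fun k => ?_
  rw [siteProd_eq_ofReal, ENNReal.toReal_ofReal (rightProd_nonneg _ _ _)]

lemma summable_rightProd_of_greenBound {ω : Env} {i : ℤ} (h : greenBound (shift i ω) ≠ ⊤) :
    Summable (rightProd ω i) := by
  refine summable_rightProd_of_tsum_siteProd fun h2 => h ?_
  simp only [greenBound, siteProd_shift, add_comm 1 i, h2]
  exact ENNReal.mul_top (one_pos.trans_le (one_le_ofReal_one_div _)).ne'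

lemma ofReal_potential {ω : Env} {i : ℤ} (hs : Summable (rightProd ω i)) :
    ENNReal.ofReal (potential ω i i) = greenBound (shift i ω) := by
  have h1 := (ω i).2.1
  rw [potential, ENNReal.ofReal_mul (by positivity), sub_self, Int.toNat_zero]
  simp only [add_zero, greenBound, siteProd_shift, add_comm 1 i, siteProd_eq_ofReal, shift_apply,
    zero_add]
  rw [ENNReal.ofReal_tsum_of_nonneg (fun k => rightProd_nonneg _ _ _) hs]

section Stationary

variable {P : Measure Env} [IsProbabilityMeasure P]

lemma lintegral_siteProd_rpow (hP : ∀ k, MeasurePreserving (shift k) P P) (β : ℝ) (a : ℤ) (n : ℕ) :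
    ∫⁻ ω, siteProd ω a n ^ β ∂P = siteMoment P β n := by
  have h := (hP a).lintegral_comp (f := fun ω => siteProd ω 0 n ^ β)
    ((measurable_siteProd 0 n).pow_const β)
  simp only [siteProd_shift, zero_add] at h
  exact h

lemma lintegral_siteProd (hP : ∀ k, MeasurePreserving (shift k) P P) (a : ℤ) (n : ℕ) :
    ∫⁻ ω, siteProd ω a n ∂P = siteMoment P 1 n := by
  simpa using lintegral_siteProd_rpow hP 1 a n

lemma ae_forall_shift (hP : ∀ k, MeasurePreserving (shift k) P P) {p : Env → Prop}
    (h : ∀ᵐ ω ∂P, p ω) : ∀ᵐ ω ∂P, ∀ k, p (shift k ω) :=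
  ae_all_iff.2 fun k => (hP k).quasiMeasurePreserving.ae h

lemma ae_forall_elliptic (hP : ∀ k, MeasurePreserving (shift k) P P) {ε : ℝ}
    (hell : ∀ᵐ ω ∂P, ε < (ω 0 : ℝ) ∧ (ω 0 : ℝ) < 1 - ε) :
    ∀ᵐ ω ∂P, ∀ k, ε < (ω k : ℝ) ∧ (ω k : ℝ) < 1 - ε := by
  filter_upwards [ae_forall_shift hP hell] with ω h k
  simpa [shift] using h k

lemma ofReal_one_div_le {ε a : ℝ} (hε : 0 < ε) (h : ε < a) :
    ENNReal.ofReal (1 / a) ≤ ENNReal.ofReal (1 / ε) :=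
  ENNReal.ofReal_le_ofReal (one_div_le_one_div_of_le hε h.le)

lemma tsum_geometric_two_ne_top {C q : ENNReal} (hC : C ≠ ⊤) (hq : q < 1) :
    ∑' (l : ℕ) (k : ℕ), C * q ^ (l + k) ≠ ⊤ := by
  have h1 : (1 - q)⁻¹ ≠ ⊤ := ENNReal.inv_ne_top.2 (tsub_pos_of_lt hq).ne'
  simp only [pow_add, ENNReal.tsum_mul_left, ENNReal.tsum_mul_right, ENNReal.tsum_geometric]
  exact ENNReal.mul_ne_top hC (ENNReal.mul_ne_top h1 h1)

/-- The products in `crossingTime` end at site `0` and those in `greenBound` begin at site `1`. Each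
pair concatenates to one block of length `l + k`, so first moments suffice and no independence is
involved. -/
lemma lintegral_crossingTime_mul_greenBound_ne_top
    (hP : ∀ k, MeasurePreserving (shift k) P P) {ε : ℝ} (hε : 0 < ε)
    (hell : ∀ᵐ ω ∂P, ε < (ω 0 : ℝ) ∧ (ω 0 : ℝ) < 1 - ε) {C q : ENNReal} (hC : C ≠ ⊤) (hq : q < 1)
    (hmom : ∀ n, siteMoment P 1 n ≤ C * q ^ n) :
    ∫⁻ ω, crossingTime ω * greenBound ω ∂P ≠ ⊤ := by
  set b := ENNReal.ofReal (1 / ε)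
  have hbound : ∀ᵐ ω ∂P, crossingTime ω * greenBound ω
      ≤ ∑' (l : ℕ) (k : ℕ), b * b * siteProd ω (-l + 1) (l + k) := by
    filter_upwards [ae_forall_elliptic hP hell] with ω hω
    rw [crossingTime, ← ENNReal.tsum_mul_right]
    refine ENNReal.tsum_le_tsum fun l => ?_
    rw [greenBound, ← mul_assoc, ← ENNReal.tsum_mul_left]
    refine ENNReal.tsum_le_tsum fun k => ?_
    rw [siteProd_add, crossingTerm, neg_add_cancel_comm]
    calc ENNReal.ofReal (1 / (ω (-l) : ℝ)) * siteProd ω (-l + 1) l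
          * ENNReal.ofReal (1 / (ω 0 : ℝ)) * siteProd ω 1 k
        ≤ b * siteProd ω (-l + 1) l * b * siteProd ω 1 k := by
          gcongr
          · exact ofReal_one_div_le hε (hω _).1
          · exact ofReal_one_div_le hε (hω _).1
      _ = _ := by ring
  refine ne_top_of_le_ne_top ?_ (lintegral_mono_ae hbound)
  rw [lintegral_tsum fun l => (Measurable.tsum fun k =>
    (measurable_siteProd _ _).const_mul _).aemeasurable]
  have h1 : ∀ l : ℕ, ∫⁻ ω, ∑' k : ℕ, b * b * siteProd ω (-l + 1) (l + k) ∂P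
      = ∑' k : ℕ, b * b * siteMoment P 1 (l + k) := by
    intro l
    rw [lintegral_tsum fun k => ((measurable_siteProd _ _).const_mul _).aemeasurable]
    refine tsum_congr fun k => ?_
    rw [lintegral_const_mul _ (measurable_siteProd _ _), lintegral_siteProd hP]
  simp only [h1]
  refine ne_top_of_le_ne_top (tsum_geometric_two_ne_top (C := b * b * C) ?_ hq)
    (ENNReal.tsum_le_tsum fun l => ENNReal.tsum_le_tsum fun k => ?_)
  · exact ENNReal.mul_ne_top (ENNReal.mul_ne_top ENNReal.ofReal_ne_top ENNReal.ofReal_ne_top) hC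
  · rw [mul_assoc (b * b)]
    gcongr
    exact hmom _

/-- The minimum is at most `2x/(n+1+x)`, and the square of the latter is dominated by a telescoping
difference with sum `4x² · (1/x)`. -/
lemma min_div_le {x : ℝ} (hx : 0 < x) (n : ℕ) :
    min (x / ((n : ℝ) + 1)) 1 ^ 2 ≤ 4 * x ^ 2 * (1 / ((n : ℝ) + x) - 1 / (((n + 1 : ℕ) : ℝ) + x)) := by
  have hn : (0 : ℝ) ≤ n := Nat.cast_nonneg n
  have h1 : min (x / ((n : ℝ) + 1)) 1 ≤ 2 * x / ((n : ℝ) + 1 + x) := by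
    rw [le_div_iff₀ (by positivity)]
    rcases le_total x ((n : ℝ) + 1) with h | h
    · calc _ ≤ x / ((n : ℝ) + 1) * (2 * ((n : ℝ) + 1)) := by
            gcongr
            · exact min_le_left _ _
            · linarith
        _ = 2 * x := by field_simp
    · calc _ ≤ 1 * (2 * x) := by
            gcongr
            · exact min_le_right _ _
            · linarith
        _ = 2 * x := by ring
  have h0 : 0 ≤ min (x / ((n : ℝ) + 1)) 1 := le_min (by positivity) zero_le_one
  calc min (x / ((n : ℝ) + 1)) 1 ^ 2 ≤ (2 * x / ((n : ℝ) + 1 + x)) ^ 2 := by gcongr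
    _ = 4 * x ^ 2 * (1 / (((n : ℝ) + 1 + x) * ((n : ℝ) + 1 + x))) := by field_simp; ring
    _ ≤ 4 * x ^ 2 * (1 / (((n : ℝ) + x) * ((n : ℝ) + 1 + x))) := by gcongr; linarith
    _ = _ := by push_cast; field_simp; ring

lemma tsum_min_div_le_nat (x : ENNReal) :
    ∑' n : ℕ, min (x / ENNReal.ofReal ((n : ℝ) + 1)) 1 ^ 2 ≤ 4 * x := by
  rcases eq_or_ne x ⊤ with rfl | hx
  · simp
  rcases eq_or_ne x 0 with rfl | hx0
  · simp
  obtain ⟨y, hy, rfl⟩ : ∃ y : ℝ, 0 < y ∧ x = ENNReal.ofReal y :=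
    ⟨x.toReal, ENNReal.toReal_pos hx0 hx, (ENNReal.ofReal_toReal hx).symm⟩
  refine ENNReal.tsum_le_of_sum_range_le fun N => ?_
  have h1 : ∀ n : ℕ, min (ENNReal.ofReal y / ENNReal.ofReal ((n : ℝ) + 1)) 1 ^ 2
      = ENNReal.ofReal (min (y / ((n : ℝ) + 1)) 1 ^ 2) := by
    intro n
    have hn : (0 : ℝ) < (n : ℝ) + 1 := by positivity
    rw [ENNReal.ofReal_pow (le_min (by positivity) zero_le_one), ENNReal.ofReal_min,
      ENNReal.ofReal_div_of_pos hn, ENNReal.ofReal_one]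
  simp only [h1]
  rw [← ENNReal.ofReal_sum_of_nonneg fun _ _ => sq_nonneg _,
    show (4 : ENNReal) = ENNReal.ofReal 4 by simp, ← ENNReal.ofReal_mul (by norm_num)]
  refine ENNReal.ofReal_le_ofReal ((Finset.sum_le_sum fun n _ => min_div_le hy n).trans ?_)
  rw [← Finset.mul_sum, Finset.sum_range_sub' fun n : ℕ => 1 / ((n : ℝ) + y)]
  have h2 : 0 ≤ 1 / ((N : ℝ) + y) := by positivity
  calc _ ≤ 4 * y ^ 2 * (1 / (((0 : ℕ) : ℝ) + y)) := by gcongr; linarith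
    _ = 4 * y := by simp; field_simp

/-- The truncation makes the sum of squares linear in `x`, so a first moment of `x` controls it. -/
lemma tsum_min_div_le_int (x : ENNReal) :
    ∑' i : ℤ, min (x / ENNReal.ofReal (|(i : ℝ)| + 1)) 1 ^ 2 ≤ 8 * x := by
  have h1 : HasSum (fun n : ℕ => min (x / ENNReal.ofReal (|((n : ℤ) : ℝ)| + 1)) 1 ^ 2)
    (∑' n : ℕ, min (x / ENNReal.ofReal (|((n : ℤ) : ℝ)| + 1)) 1 ^ 2) := ENNReal.summable.hasSum
  have h2 : HasSum (fun n : ℕ => min (x / ENNReal.ofReal (|((-(n + 1 : ℤ) : ℤ) : ℝ)| + 1)) 1 ^ 2)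
    (∑' n : ℕ, min (x / ENNReal.ofReal (|((-(n + 1 : ℤ) : ℤ) : ℝ)| + 1)) 1 ^ 2) :=
    ENNReal.summable.hasSum
  have h3 := HasSum.of_nat_of_neg_add_one
    (f := fun i : ℤ => min (x / ENNReal.ofReal (|(i : ℝ)| + 1)) 1 ^ 2) h1 h2
  rw [h3.tsum_eq, show (8 : ENNReal) = 4 + 4 by norm_num, add_mul]
  refine add_le_add ?_ ?_ <;> refine le_trans (ENNReal.tsum_le_tsum fun n => ?_)
    (tsum_min_div_le_nat x)
  · simp
  · have h4 : (n : ℝ) + 1 ≤ |((-(n + 1 : ℤ) : ℤ) : ℝ)| + 1 := by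
      push_cast
      rw [abs_neg, abs_of_nonneg (by positivity)]
      linarith
    gcongr

lemma tsum_ne_top_of_eventually_le {ι : Type*} {a b : ι → ENNReal} (ha : ∀ i, a i ≠ ⊤)
    (h : ∀ᶠ i in cofinite, a i ≤ b i) (hb : ∑' i, b i ≠ ⊤) : ∑' i, a i ≠ ⊤ := by
  classical
  have hfin : {i | ¬ a i ≤ b i}.Finite := h
  have hle : ∀ i, a i ≤ b i + if i ∈ hfin.toFinset then a i else 0 := by
    intro i
    by_cases hi : a i ≤ b i
    · exact hi.trans le_self_add
    · rw [if_pos (by simpa using hi)]; exact le_add_self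
  refine ne_top_of_le_ne_top ?_ (ENNReal.tsum_le_tsum hle)
  rw [ENNReal.tsum_add, tsum_eq_sum (s := hfin.toFinset) fun i hi => if_neg hi]
  refine ENNReal.add_ne_top.2 ⟨hb, ENNReal.sum_ne_top.2 fun i _ => ?_⟩
  split_ifs
  exact ha i

/-- All but finitely many terms of the convergent series are below `1`. Since `b i ≥ 1`, the
truncation is inactive there. -/
lemma tsum_sq_mul_ne_top {ι : Type*} {a b : ι → ENNReal} (ha : ∀ i, a i ≠ ⊤) (hb : ∀ i, b i ≠ ⊤)
    (hb1 : ∀ i, 1 ≤ b i) (h : ∑' i, min (a i) 1 ^ 2 * b i ≠ ⊤) : ∑' i, a i ^ 2 * b i ≠ ⊤ := by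
  have hlt : ∀ᶠ i in cofinite, min (a i) 1 ^ 2 * b i < 1 :=
    (ENNReal.tendsto_cofinite_zero_of_tsum_ne_top h).eventually (gt_mem_nhds one_pos)
  refine tsum_ne_top_of_eventually_le
    (fun i => ENNReal.mul_ne_top (ENNReal.pow_ne_top (ha i)) (hb i)) (hlt.mono fun i hi => ?_) h
  have h1 : a i ≤ 1 := by
    by_contra! h1
    rw [min_eq_right h1.le, one_pow, one_mul] at hi
    exact absurd (hb1 i) (not_le.2 hi)
  rw [min_eq_left h1]

lemma isSpeed_of_ae_ae {v : ℝ} (h : ∀ᵐ ω ∂P, ∀ᵐ X ∂(quenchedLaw ω),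
    Tendsto (fun n : ℕ => (X n : ℝ) / n) atTop (𝓝 v)) : IsSpeed P v := by
  refine Measure.ae_compProd_of_ae_ae ?_ h
  refine measurableSet_tendsto (f := fun (n : ℕ) (z : Env × (ℕ → ℤ)) => (z.2 n : ℝ) / n) _
    fun n => ?_
  have h1 : Measurable fun z : Env × (ℕ → ℤ) => z.2 n :=
    (measurable_pi_apply n).comp measurable_snd
  exact ((measurable_of_countable fun i : ℤ => (i : ℝ)).comp h1).div_const _

lemma birkhoffSum_shift (g : Env → ℝ) (n : ℕ) (ω : Env) :
    birkhoffSum (shift 1) g n ω = ∑ j ∈ Finset.range n, g (shift (j : ℤ) ω) :=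
  Finset.sum_congr rfl fun j _ => by rw [shift_iterate]

/-- The ballistic case: if the moments `E_P ∏_{i<n} ρ_i` decay exponentially, then the speed is
the inverse of the mean crossing time. -/
theorem isSpeed_inv_lintegral_crossingTime (hP : ∀ k, MeasurePreserving (shift k) P P)
    (herg : Ergodic (shift 1) P) {ε : ℝ} (hε : 0 < ε)
    (hell : ∀ᵐ ω ∂P, ε < (ω 0 : ℝ) ∧ (ω 0 : ℝ) < 1 - ε) {C q : ENNReal} (hC : C ≠ ⊤) (hq : q < 1)
    (hmom : ∀ n, siteMoment P 1 n ≤ C * q ^ n) :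
    ∫⁻ ω, crossingTime ω ∂P ≠ ⊤ ∧ 0 < (∫⁻ ω, crossingTime ω ∂P).toReal ∧
      IsSpeed P (∫⁻ ω, crossingTime ω ∂P).toReal⁻¹ := by
  have hfg := lintegral_crossingTime_mul_greenBound_ne_top hP hε hell hC hq hmom
  have hf : ∫⁻ ω, crossingTime ω ∂P ≠ ⊤ := ne_top_of_le_ne_top hfg
    (lintegral_mono fun ω => le_mul_of_one_le_right' (one_le_greenBound ω))
  have hg : ∫⁻ ω, greenBound ω ∂P ≠ ⊤ := ne_top_of_le_ne_top hfg
    (lintegral_mono fun ω => le_mul_of_one_le_left' (one_le_crossingTime ω))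
  have hpos : 0 < (∫⁻ ω, crossingTime ω ∂P).toReal := by
    refine ENNReal.toReal_pos (one_pos.trans_le ?_).ne' hf
    calc (1 : ENNReal) = ∫⁻ _, 1 ∂P := by simp
      _ ≤ _ := lintegral_mono one_le_crossingTime
  refine ⟨hf, hpos, isSpeed_of_ae_ae ?_⟩
  have hint : Integrable (fun ω => (crossingTime ω).toReal) P :=
    integrable_toReal_of_lintegral_ne_top measurable_crossingTime.aemeasurable hf
  have hmean : ∫ ω, (crossingTime ω).toReal ∂P = (∫⁻ ω, crossingTime ω ∂P).toReal :=
    integral_toReal measurable_crossingTime.aemeasurable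
      (ae_lt_top measurable_crossingTime hf)
  -- Stationarity removes the shifts under the integral, and the mean is at most `8 E (f g)`. The
  -- truncation is lifted afterwards, environment by environment.
  have hsum : ∀ᵐ ω ∂P, ∑' i : ℤ, min (crossingTime (shift i ω) / ENNReal.ofReal (|(i : ℝ)| + 1)) 1
      ^ 2 * greenBound (shift i ω) < ⊤ := by
    have hm : ∀ i : ℤ, Measurable fun ω =>
        min (crossingTime ω / ENNReal.ofReal (|(i : ℝ)| + 1)) 1 ^ 2 * greenBound ω := fun i => by
      fun_prop
    refine ae_lt_top (Measurable.tsum fun i => (hm i).comp (measurable_shift i)) ?_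
    rw [lintegral_tsum (f := fun (i : ℤ) ω => min (crossingTime (shift i ω) /
      ENNReal.ofReal (|(i : ℝ)| + 1)) 1 ^ 2 * greenBound (shift i ω))
      fun i => ((hm i).comp (measurable_shift i)).aemeasurable]
    simp_rw [fun i : ℤ => (hP i).lintegral_comp (hm i)]
    rw [← lintegral_tsum fun i => (hm i).aemeasurable]
    have h8 : ∫⁻ ω, 8 * (crossingTime ω * greenBound ω) ∂P ≠ ⊤ := by
      rw [lintegral_const_mul _ (by fun_prop)]
      exact ENNReal.mul_ne_top (by norm_num) hfg
    refine ne_top_of_le_ne_top h8 (lintegral_mono fun ω => ?_)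
    rw [ENNReal.tsum_mul_right, ← mul_assoc]
    exact mul_le_mul_left (tsum_min_div_le_int _) _
  filter_upwards [ae_forall_elliptic hP hell, hsum,
    ae_forall_shift hP (ae_lt_top measurable_crossingTime hf),
    ae_forall_shift hP (ae_lt_top measurable_greenBound hg),
    ae_tendsto_birkhoffSum_div herg measurable_crossingTime.ennreal_toReal hint]
    with ω h1 h2 h3 h4 h5
  have hs : ∀ i, Summable (rightProd ω i) := fun i => summable_rightProd_of_greenBound (h4 i).ne
  refine ae_tendsto_div_of_drift_eq (f := fun i => (crossingTime (shift i ω)).toReal) hε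
    (fun i => (h1 i).2) (fun i => ?_) (fun i => ?_) hs ?_ hpos ?_
  · exact ENNReal.toReal_pos (one_pos.trans_le (one_le_crossingTime _)).ne' (h3 i).ne
  · have h6 := crossingTime_eq (shift i ω)
    rw [shift_shift, neg_add_eq_sub, shift_apply, zero_add] at h6
    have h7 := (ω i).2
    rw [h6, ENNReal.toReal_add ENNReal.ofReal_ne_top
      (ENNReal.mul_ne_top ENNReal.ofReal_ne_top (h3 _).ne), ENNReal.toReal_mul,
      ENNReal.toReal_ofReal (one_div_nonneg.2 h7.1.le), ENNReal.toReal_ofReal (ratio_pos _).le,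
      mul_add, ← mul_assoc, mul_ratio, mul_one_div_cancel h7.1.ne']
  · have h6 := tsum_sq_mul_ne_top (fun i : ℤ => ENNReal.div_ne_top (h3 i).ne
      (by positivity : ENNReal.ofReal (|(i : ℝ)| + 1) ≠ 0)) (fun i => (h4 i).ne)
      (fun i => one_le_greenBound _) h2.ne
    convert h6 using 4 with i
    · have hi : (0 : ℝ) < |(i : ℝ)| + 1 := by positivity
      rw [ENNReal.ofReal_pow (by positivity), ENNReal.ofReal_div_of_pos hi,
        ENNReal.ofReal_toReal (h3 i).ne]
    · exact ofReal_potential (hs _)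
  · rw [← hmean]
    simpa only [birkhoffSum_shift] using h5

end Stationary

/-! ### The sub-ballistic case -/

/-- Used to bound hitting probabilities when only moments of order `β ≤ 1` are summable. If all
terms are at most `1`, each is below its power; otherwise one power already reaches `1`. -/
lemma min_tsum_one_le {ι : Type*} {β : ℝ} (hβ0 : 0 < β) (hβ1 : β ≤ 1) (x : ι → ENNReal) :
    min (∑' k, x k) 1 ≤ ∑' k, x k ^ β := by
  by_cases h : ∀ k, x k ≤ 1
  · refine (min_le_left _ _).trans (ENNReal.tsum_le_tsum fun k => ?_)
    simpa using ENNReal.rpow_le_rpow_of_exponent_ge (h k) hβ1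
  · push Not at h
    obtain ⟨k, hk⟩ := h
    refine (min_le_right _ _).trans (le_trans ?_ (ENNReal.le_tsum k))
    exact ENNReal.one_le_rpow hk.le hβ0

lemma tsum_ne_top_of_tsum_rpow_ne_top {ι : Type*} {β : ℝ} (hβ0 : 0 < β) (hβ1 : β ≤ 1)
    {x : ι → ENNReal} (hx : ∀ k, x k ≠ ⊤) (h : ∑' k, x k ^ β ≠ ⊤) : ∑' k, x k ≠ ⊤ := by
  have hlt : ∀ᶠ k in cofinite, x k ^ β < 1 :=
    (ENNReal.tendsto_cofinite_zero_of_tsum_ne_top h).eventually (gt_mem_nhds one_pos)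
  refine tsum_ne_top_of_eventually_le hx (hlt.mono fun k hk => ?_) h
  have h1 : x k ≤ 1 := by
    by_contra! h1
    exact absurd (ENNReal.one_le_rpow h1.le hβ0) (not_le.2 hk)
  simpa using ENNReal.rpow_le_rpow_of_exponent_ge h1 hβ1

lemma min_mul_one_le {c : ENNReal} (hc : 1 ≤ c) (x : ENNReal) : min (c * x) 1 ≤ c * min x 1 := by
  rw [mul_min]
  exact min_le_min le_rfl (by simpa using hc)

lemma ofReal_potential_neg {ω : Env} (n : ℕ) (hs : Summable (rightProd ω (-(n + 1 : ℤ)))) :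
    ENNReal.ofReal (potential ω (-(n + 1 : ℤ)) 0) = ENNReal.ofReal (1 / (ω (-(n + 1 : ℤ)) : ℝ))
      * ∑' k, siteProd ω (-n) (k + (n + 1)) := by
  have h1 := (ω (-(n + 1 : ℤ))).2.1
  have h2 : (0 - -(n + 1 : ℤ)).toNat = n + 1 := by omega
  have h3 : (-n : ℤ) = -(n + 1 : ℤ) + 1 := by ring
  rw [potential, ENNReal.ofReal_mul (by positivity), h2, ENNReal.ofReal_tsum_of_nonneg
    (fun k => rightProd_nonneg _ _ _) ((summable_nat_add_iff (n + 1)).2 hs)]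
  simp only [h3, siteProd_eq_ofReal]

/-- The truncated expected time to go from `0` to `1`. -/
noncomputable def truncatedCrossingTime (K : ℕ) (ω : Env) : ℝ :=
  (∑ l ∈ Finset.range K, crossingTerm ω l).toReal

@[fun_prop]
lemma measurable_truncatedCrossingTime (K : ℕ) : Measurable (truncatedCrossingTime K) :=
  (Finset.measurable_fun_sum _ fun l _ => measurable_crossingTerm l).ennreal_toReal

lemma crossingTerm_ne_top (ω : Env) (l : ℕ) : crossingTerm ω l ≠ ⊤ :=
  ENNReal.mul_ne_top ENNReal.ofReal_ne_top (siteProd_ne_top _ _ _)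

lemma sum_crossingTerm_ne_top (ω : Env) (K : ℕ) : ∑ l ∈ Finset.range K, crossingTerm ω l ≠ ⊤ :=
  ENNReal.sum_ne_top.2 fun _ _ => crossingTerm_ne_top _ _

/-- Discarding the last term turns the recursion of `crossingTime` into an inequality. The truncated
function thus has drift at most one, and ellipticity makes it bounded. -/
lemma truncatedCrossingTime_le_succ (K : ℕ) (ω : Env) :
    truncatedCrossingTime K ω
      ≤ 1 / (ω 0 : ℝ) + ratio (ω 0) * truncatedCrossingTime K (shift (-1) ω) := by
  have h1 : ∑ l ∈ Finset.range K, crossingTerm ω l ≤ ENNReal.ofReal (1 / (ω 0 : ℝ))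
      + ENNReal.ofReal (ratio (ω 0)) * ∑ l ∈ Finset.range K, crossingTerm (shift (-1) ω) l := by
    rw [Finset.mul_sum, ← crossingTerm_zero, add_comm]
    simp only [← crossingTerm_succ]
    rw [← Finset.sum_range_succ']
    exact Finset.sum_le_sum_of_subset (Finset.range_subset_range.2 K.le_succ)
  have h2 := ENNReal.toReal_mono (ENNReal.add_ne_top.2 ⟨ENNReal.ofReal_ne_top,
    ENNReal.mul_ne_top ENNReal.ofReal_ne_top (sum_crossingTerm_ne_top _ _)⟩) h1
  rwa [ENNReal.toReal_add ENNReal.ofReal_ne_top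
    (ENNReal.mul_ne_top ENNReal.ofReal_ne_top (sum_crossingTerm_ne_top _ _)), ENNReal.toReal_mul,
    ENNReal.toReal_ofReal (one_div_nonneg.2 (ω 0).2.1.le),
    ENNReal.toReal_ofReal (ratio_pos _).le] at h2

lemma ratio_le {ε : ℝ} (hε : 0 < ε) {a : Set.Ioo (0 : ℝ) 1} (h : ε < a) : ratio a ≤ 1 / ε := by
  have := a.2
  rw [ratio]
  exact div_le_div₀ zero_le_one (by linarith [this.1]) hε h.le

lemma crossingTerm_le {ε : ℝ} (hε : 0 < ε) {ω : Env} (h : ∀ k, ε < (ω k : ℝ)) (l : ℕ) :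
    crossingTerm ω l ≤ ENNReal.ofReal (1 / ε) ^ (l + 1) := by
  rw [pow_succ', crossingTerm]
  refine mul_le_mul' (ofReal_one_div_le hε (h _)) ?_
  rw [siteProd]
  refine (Finset.prod_le_pow_card _ _ (ENNReal.ofReal (1 / ε)) fun r _ => ?_).trans (by simp)
  exact ENNReal.ofReal_le_ofReal (ratio_le hε (h _))

lemma exists_truncatedCrossingTime_le {ε : ℝ} (hε : 0 < ε) (K : ℕ) :
    ∃ C : ℝ, ∀ ω : Env, (∀ k, ε < (ω k : ℝ)) → |truncatedCrossingTime K ω| ≤ C := by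
  refine ⟨(∑ l ∈ Finset.range K, ENNReal.ofReal (1 / ε) ^ (l + 1)).toReal, fun ω h => ?_⟩
  rw [truncatedCrossingTime, abs_of_nonneg ENNReal.toReal_nonneg]
  refine ENNReal.toReal_mono (ENNReal.sum_ne_top.2 fun _ _ => ENNReal.pow_ne_top
    ENNReal.ofReal_ne_top) (Finset.sum_le_sum fun l _ => crossingTerm_le hε h l)

lemma siteProd_le_crossingTerm (ω : Env) (l : ℕ) : siteProd ω (-l + 1) l ≤ crossingTerm ω l :=
  le_mul_of_one_le_left' (one_le_ofReal_one_div _)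

section Stationary

variable {P : Measure Env} [IsProbabilityMeasure P]

/-- As `1/ω ≥ 1`, the mean of the truncation dominates a partial sum of the divergent series of
first moments. -/
lemma tendsto_integral_truncatedCrossingTime (hP : ∀ k, MeasurePreserving (shift k) P P)
    (hint : ∀ K, Integrable (truncatedCrossingTime K) P) (htop : ∑' n, siteMoment P 1 n = ⊤) :
    Tendsto (fun K => ∫ ω, truncatedCrossingTime K ω ∂P) atTop atTop := by
  have h1 : ∀ K, ∑ n ∈ Finset.range K, siteMoment P 1 n
      ≤ ENNReal.ofReal (∫ ω, truncatedCrossingTime K ω ∂P) := by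
    intro K
    rw [ofReal_integral_eq_lintegral_ofReal (hint K)
      (ae_of_all _ fun ω => ENNReal.toReal_nonneg)]
    simp only [truncatedCrossingTime, ENNReal.ofReal_toReal (sum_crossingTerm_ne_top _ _)]
    rw [lintegral_finsetSum _ fun l _ => measurable_crossingTerm l]
    refine Finset.sum_le_sum fun l _ => ?_
    rw [← lintegral_siteProd hP (-l + 1)]
    exact lintegral_mono fun ω => siteProd_le_crossingTerm ω l
  have h2 : Tendsto (fun K => ∑ n ∈ Finset.range K, siteMoment P 1 n) atTop (𝓝 ⊤) :=
    htop ▸ ENNReal.tendsto_nat_tsum _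
  have h3 := tendsto_of_tendsto_of_tendsto_of_le_of_le h2 tendsto_const_nhds h1
    fun _ => le_top
  exact ENNReal.tendsto_ofReal_nhds_top.1 h3

lemma ae_tsum_min_potential_ne_top (hP : ∀ k, MeasurePreserving (shift k) P P) {ε : ℝ} (hε : 0 < ε)
    (hell : ∀ᵐ ω ∂P, ε < (ω 0 : ℝ) ∧ (ω 0 : ℝ) < 1 - ε) {β : ℝ} (hβ0 : 0 < β) (hβ1 : β ≤ 1)
    {C q : ENNReal} (hC : C ≠ ⊤) (hq : q < 1) (hmom : ∀ n, siteMoment P β n ≤ C * q ^ n) :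
    ∀ᵐ ω ∂P, (∀ i, Summable (rightProd ω i)) ∧
      ∑' n : ℕ, min (ENNReal.ofReal (potential ω (-(n + 1 : ℤ)) 0)) 1 ≠ ⊤ := by
  have hmeas : ∀ (a : ℤ) (n : ℕ), Measurable fun ω => siteProd ω a n ^ β := fun a n =>
    (measurable_siteProd a n).pow_const β
  have h1 : ∀ i : ℤ, ∀ᵐ ω ∂P, ∑' k, siteProd ω (i + 1) k ^ β < ⊤ := by
    intro i
    refine ae_lt_top (Measurable.tsum fun k => hmeas _ _) ?_
    rw [lintegral_tsum fun k => (hmeas _ _).aemeasurable]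
    simp only [lintegral_siteProd_rpow hP]
    refine ne_top_of_le_ne_top ?_ (ENNReal.tsum_le_tsum hmom)
    rw [ENNReal.tsum_mul_left, ENNReal.tsum_geometric]
    exact ENNReal.mul_ne_top hC (ENNReal.inv_ne_top.2 (tsub_pos_of_lt hq).ne')
  have h2 : ∀ᵐ ω ∂P, ∑' (n : ℕ) (k : ℕ), siteProd ω (-n) (k + (n + 1)) ^ β < ⊤ := by
    refine ae_lt_top (Measurable.tsum fun n => Measurable.tsum fun k => hmeas _ _) ?_
    rw [lintegral_tsum fun n => (Measurable.tsum fun k => hmeas _ _).aemeasurable]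
    have h3 : ∀ n : ℕ, ∫⁻ ω, ∑' k : ℕ, siteProd ω (-n) (k + (n + 1)) ^ β ∂P
        = ∑' k : ℕ, siteMoment P β (k + (n + 1)) := by
      intro n
      rw [lintegral_tsum fun k => (hmeas _ _).aemeasurable]
      simp only [lintegral_siteProd_rpow hP]
    simp only [h3]
    -- A visit to `-(n + 1)` from `0` involves products of at least `n + 1` factors, so the decay is
    -- geometric in `n` as well as in `k`.
    refine ne_top_of_le_ne_top (tsum_geometric_two_ne_top hC hq)
      (ENNReal.tsum_le_tsum fun n => ENNReal.tsum_le_tsum fun k => (hmom _).trans ?_)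
    exact mul_le_mul_right (pow_le_pow_right_of_le_one' hq.le (by omega)) _
  filter_upwards [ae_all_iff.2 h1, h2, ae_forall_elliptic hP hell] with ω h1 h2 h3
  have hs : ∀ i, Summable (rightProd ω i) := fun i => summable_rightProd_of_tsum_siteProd
    (tsum_ne_top_of_tsum_rpow_ne_top hβ0 hβ1 (fun k => siteProd_ne_top _ _ _) (h1 i).ne)
  refine ⟨hs, ne_top_of_le_ne_top (b := ENNReal.ofReal (1 / ε) *
    ∑' (n : ℕ) (k : ℕ), siteProd ω (-n) (k + (n + 1)) ^ β)
    (ENNReal.mul_ne_top ENNReal.ofReal_ne_top h2.ne) ?_⟩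
  rw [← ENNReal.tsum_mul_left]
  refine ENNReal.tsum_le_tsum fun n => ?_
  rw [ofReal_potential_neg n (hs _)]
  refine (min_mul_one_le (one_le_ofReal_one_div _) _).trans
    (mul_le_mul' (ofReal_one_div_le hε (h3 _).1) (min_tsum_one_le hβ0 hβ1 _))

/-- The sub-ballistic case: the walk is transient to the right, but the mean crossing time is
infinite. -/
theorem isSpeed_zero (hP : ∀ k, MeasurePreserving (shift k) P P)
    (herg : Ergodic (shift 1) P) {ε : ℝ} (hε : 0 < ε)
    (hell : ∀ᵐ ω ∂P, ε < (ω 0 : ℝ) ∧ (ω 0 : ℝ) < 1 - ε) {β : ℝ} (hβ0 : 0 < β) (hβ1 : β ≤ 1)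
    {C q : ENNReal} (hC : C ≠ ⊤) (hq : q < 1) (hmom : ∀ n, siteMoment P β n ≤ C * q ^ n)
    (htop : ∑' n, siteMoment P 1 n = ⊤) : IsSpeed P 0 := by
  have hell' := ae_forall_elliptic hP hell
  have hint : ∀ K, Integrable (truncatedCrossingTime K) P := by
    intro K
    obtain ⟨B, hB⟩ := exists_truncatedCrossingTime_le hε K
    refine Integrable.of_bound (measurable_truncatedCrossingTime K).aestronglyMeasurable B ?_
    filter_upwards [hell'] with ω hω
    exact hB ω fun k => (hω k).1
  have hmean := tendsto_integral_truncatedCrossingTime hP hint htop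
  refine isSpeed_of_ae_ae ?_
  filter_upwards [hell', ae_tsum_min_potential_ne_top hP hε hell hβ0 hβ1 hC hq hmom,
    ae_all_iff.2 fun K => ae_tendsto_birkhoffSum_div herg (measurable_truncatedCrossingTime K)
      (hint K)] with ω h1 h2 h3
  have hupper : ∀ᵐ X ∂(quenchedLaw ω), ∀ K, 0 < ∫ ω, truncatedCrossingTime K ω ∂P →
      ∀ δ, 1 / (∫ ω, truncatedCrossingTime K ω ∂P) < δ → ∀ᶠ n : ℕ in atTop, (X n : ℝ) ≤ δ * n := by
    refine ae_all_iff.2 fun K => ?_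
    by_cases hK : 0 < ∫ ω, truncatedCrossingTime K ω ∂P
    · obtain ⟨B, hB⟩ := exists_truncatedCrossingTime_le hε K
      have h4 := ae_eventually_le_mul_of_drift_le ω (C := B)
        (f := fun i => truncatedCrossingTime K (shift i ω))
        (fun i => hB _ fun k => (h1 _).1) (fun i => ?_) hK ?_
      · filter_upwards [h4] with X hX _ using hX
      · have h5 := truncatedCrossingTime_le_succ K (shift i ω)
        rw [shift_shift, neg_add_eq_sub, shift_apply, zero_add] at h5
        have h7 := (ω i).2
        have h8 := mul_le_mul_of_nonneg_left h5 h7.1.le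
        rw [mul_add, ← mul_assoc, mul_ratio, mul_one_div_cancel h7.1.ne'] at h8
        linarith
      · simpa only [birkhoffSum_shift] using h3 K
    · exact ae_of_all _ fun X h => absurd h hK
  filter_upwards [hupper, ae_bddBelow_of_tsum_potential h2.1 h2.2] with X hX ⟨N, hN⟩
  rw [Metric.tendsto_atTop']
  intro δ hδ
  -- A truncated mean above `2/δ` forces `X_n ≤ (δ/2) n` eventually; the maximum with `0` secures
  -- its positivity. The lower bound `-δ n < X_n` comes from `X_n ≥ -N`.
  obtain ⟨K, hK⟩ := (hmean.eventually (eventually_gt_atTop (max 0 (2 / δ)))).exists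
  have hKpos := (le_max_left _ _).trans_lt hK
  have hKδ : 1 / (∫ ω, truncatedCrossingTime K ω ∂P) < δ / 2 := by
    rw [one_div_lt hKpos (by positivity), one_div_div]
    exact (le_max_right _ _).trans_lt hK
  obtain ⟨n₁, hn₁⟩ := eventually_atTop.1 (hX K hKpos _ hKδ)
  obtain ⟨n₂, hn₂⟩ := exists_nat_gt ((N : ℝ) / δ)
  refine ⟨max n₁ n₂, fun n hn => ?_⟩
  have hn0 : (0 : ℝ) < n := by
    have : 0 < n := (Nat.zero_le _).trans_lt hn
    exact_mod_cast this
  have h5 := hn₁ n ((le_max_left _ _).trans hn.le)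
  have h6 : (n₂ : ℝ) ≤ n := by exact_mod_cast (le_max_right _ _).trans hn.le
  have h7 : -(N : ℝ) ≤ X n := by exact_mod_cast hN n
  have h8 : (N : ℝ) < δ * n := by
    rw [div_lt_iff₀ hδ] at hn₂
    nlinarith
  rw [Real.dist_eq, sub_zero, abs_lt, lt_div_iff₀ hn0, div_lt_iff₀ hn0]
  constructor <;> nlinarith [mul_pos hδ hn0]

end Stationary

/-! ### Convex functions vanishing at `0` -/

/-- The point `t` lies between `0` and `β` or between `β` and `κ`, and each chord is negative in its
interior and at `β`. -/
lemma _root_.ConvexOn.neg_of_mem_Ioo {f : ℝ → ℝ} (hf : ConvexOn ℝ (Set.Ici 0) f) (h0 : f 0 = 0)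
    {β κ : ℝ} (hβ : 0 < β) (hfβ : f β < 0) (hκ : 0 < κ) (hfκ : f κ = 0) {t : ℝ}
    (ht : t ∈ Set.Ioo 0 κ) : f t < 0 := by
  have hmem : ∀ {s : ℝ}, 0 < s → s ∈ Set.Ici (0 : ℝ) := fun hs => hs.le
  rcases le_or_gt t β with h | h
  · have h1 : 0 ≤ 1 - t / β := by rw [sub_nonneg, div_le_one hβ]; exact h
    have h2 := hf.2 (hmem hβ) Set.self_mem_Ici (div_pos ht.1 hβ).le h1 (by ring)
    simp only [smul_eq_mul, mul_zero, add_zero, h0, div_mul_cancel₀ _ hβ.ne'] at h2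
    exact h2.trans_lt (mul_neg_of_pos_of_neg (div_pos ht.1 hβ) hfβ)
  · have h3 : 0 < κ - β := by linarith [ht.2]
    have h1 : 0 < (κ - t) / (κ - β) := div_pos (by linarith [ht.2]) h3
    have h1' : 0 ≤ (t - β) / (κ - β) := div_nonneg (by linarith) h3.le
    have h2 := hf.2 (hmem hβ) (hmem hκ) h1.le h1' (by field_simp; ring)
    have h4 : (κ - t) / (κ - β) * β + (t - β) / (κ - β) * κ = t := by field_simp; ring
    simp only [smul_eq_mul, hfκ, mul_zero, add_zero, h4] at h2
    exact h2.trans_lt (mul_neg_of_pos_of_neg h1 hfβ)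

lemma _root_.ConvexOn.nonneg_of_zero_le {f : ℝ → ℝ} (hf : ConvexOn ℝ (Set.Ici 0) f) (h0 : f 0 = 0)
    {κ t : ℝ} (hκ : 0 < κ) (hfκ : f κ = 0) (ht : κ ≤ t) : 0 ≤ f t := by
  have ht0 := hκ.trans_le ht
  have h1 : 0 ≤ 1 - κ / t := by rw [sub_nonneg, div_le_one ht0]; exact ht
  have h2 := hf.2 (show t ∈ Set.Ici (0 : ℝ) from ht0.le) Set.self_mem_Ici (div_pos hκ ht0).le h1
    (by ring)
  simp only [smul_eq_mul, mul_zero, add_zero, h0, div_mul_cancel₀ _ ht0.ne', hfκ] at h2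
  exact nonneg_of_mul_nonneg_right h2 (div_pos hκ ht0)

/-- Convexity makes `f` negative on `(0, β]`, so `β < β'`; it also makes `f` continuous in the
interior, and the intermediate value theorem applies. -/
lemma _root_.ConvexOn.exists_eq_zero {f : ℝ → ℝ} (hf : ConvexOn ℝ (Set.Ici 0) f) (h0 : f 0 = 0)
    {β β' : ℝ} (hβ : 0 < β) (hfβ : f β < 0) (hβ' : 0 < β') (hfβ' : 0 ≤ f β') :
    ∃ κ, 0 < κ ∧ f κ = 0 := by
  have hlt : β ≤ β' := by
    by_contra! h
    have h1 : 0 ≤ 1 - β' / β := by rw [sub_nonneg, div_le_one hβ]; exact h.le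
    have h2 := hf.2 (show β ∈ Set.Ici (0 : ℝ) from hβ.le) Set.self_mem_Ici (div_pos hβ' hβ).le h1
      (by ring)
    simp only [smul_eq_mul, mul_zero, add_zero, h0, div_mul_cancel₀ _ hβ.ne'] at h2
    exact absurd (h2.trans_lt (mul_neg_of_pos_of_neg (div_pos hβ' hβ) hfβ)) (not_lt.2 hfβ')
  have hcont : ContinuousOn f (Set.Icc β β') := by
    refine (hf.continuousOn_interior).mono fun s hs => ?_
    rw [interior_Ici]
    exact hβ.trans_le hs.1
  obtain ⟨κ, hκ, h⟩ := intermediate_value_Icc hlt hcont ⟨hfβ.le, hfβ'⟩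
  exact ⟨κ, hβ.trans_le hκ.1, h⟩

/-! ### The exponential rate of the moments -/

lemma siteProd_ne_zero (ω : Env) (a : ℤ) (n : ℕ) : siteProd ω a n ≠ 0 :=
  Finset.prod_ne_zero_iff.2 fun _ _ => (ENNReal.ofReal_pos.2 (ratio_pos _)).ne'

lemma siteProd_rpow (ω : Env) (a : ℤ) (n : ℕ) {β : ℝ} (hβ : 0 ≤ β) :
    siteProd ω a n ^ β = ∏ r ∈ Finset.range n, ENNReal.ofReal (ratio (ω (a + r))) ^ β :=
  (ENNReal.prod_rpow_of_nonneg hβ).symm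

lemma le_ratio {ε : ℝ} {a : Set.Ioo (0 : ℝ) 1} (h : (a : ℝ) < 1 - ε) : ε ≤ ratio a := by
  have := a.2
  rw [ratio, le_div_iff₀ this.1]
  nlinarith [this.1, this.2]

section Rate

variable {P : Measure Env} [IsProbabilityMeasure P]

lemma siteMoment_zero_left (n : ℕ) : siteMoment P 0 n = 1 := by simp [siteMoment]

lemma logMoment_eq {β : ℝ} (hβ : 0 ≤ β) (n : ℕ) :
    logMoment P β n = Real.log (siteMoment P β n).toReal / n := by
  have h1 : ∀ ω : Env, ENNReal.ofReal (∏ i ∈ Finset.range n, ratio (ω (i : ℤ)) ^ β)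
      = siteProd ω 0 n ^ β := by
    intro ω
    rw [siteProd_rpow _ _ _ hβ, ENNReal.ofReal_prod_of_nonneg
      fun i _ => Real.rpow_nonneg (ratio_pos _).le _]
    simp only [zero_add, ENNReal.ofReal_rpow_of_pos (ratio_pos _)]
  have hmeas : Measurable fun ω : Env => ∏ i ∈ Finset.range n, ratio (ω (i : ℤ)) ^ β :=
    Finset.measurable_fun_prod _ fun i _ =>
      (measurable_ratio.comp (measurable_pi_apply (i : ℤ))).pow_const β
  rw [logMoment, integral_eq_lintegral_of_nonneg_ae (ae_of_all _ fun ω => Finset.prod_nonneg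
    fun i _ => Real.rpow_nonneg (ratio_pos _).le _) hmeas.aestronglyMeasurable]
  simp only [h1]
  rw [siteMoment, one_div, inv_mul_eq_div]

variable {ε : ℝ} (hε : 0 < ε) (hell : ∀ᵐ ω ∂P, ∀ k, ε < (ω k : ℝ) ∧ (ω k : ℝ) < 1 - ε)

include hε hell

lemma siteMoment_le_pow {β : ℝ} (hβ : 0 ≤ β) (n : ℕ) :
    siteMoment P β n ≤ (ENNReal.ofReal (1 / ε) ^ β) ^ n := by
  calc siteMoment P β n ≤ ∫⁻ _, (ENNReal.ofReal (1 / ε) ^ β) ^ n ∂P := by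
        refine lintegral_mono_ae ?_
        filter_upwards [hell] with ω hω
        rw [siteProd_rpow _ _ _ hβ]
        refine (Finset.prod_le_pow_card _ _ (ENNReal.ofReal (1 / ε) ^ β) fun r _ => ?_).trans
          (by simp)
        exact ENNReal.rpow_le_rpow (ENNReal.ofReal_le_ofReal (ratio_le hε (hω _).1)) hβ
    _ = _ := by simp

lemma pow_le_siteMoment {β : ℝ} (hβ : 0 ≤ β) (n : ℕ) :
    (ENNReal.ofReal ε ^ β) ^ n ≤ siteMoment P β n := by
  calc (ENNReal.ofReal ε ^ β) ^ n = ∫⁻ _, (ENNReal.ofReal ε ^ β) ^ n ∂P := by simp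
    _ ≤ _ := by
        refine lintegral_mono_ae ?_
        filter_upwards [hell] with ω hω
        rw [siteProd_rpow _ _ _ hβ]
        have h := Finset.pow_card_le_prod (Finset.range n)
          (fun r : ℕ => ENNReal.ofReal (ratio (ω (0 + (r : ℤ)))) ^ β) (ENNReal.ofReal ε ^ β)
          fun r _ => ENNReal.rpow_le_rpow (ENNReal.ofReal_le_ofReal (le_ratio (hω _).2)) hβ
        simpa using h

lemma siteMoment_ne_top {β : ℝ} (hβ : 0 ≤ β) (n : ℕ) : siteMoment P β n ≠ ⊤ :=
  ne_top_of_le_ne_top (ENNReal.pow_ne_top (ENNReal.rpow_ne_top_of_nonneg hβ ENNReal.ofReal_ne_top))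
    (siteMoment_le_pow hε hell hβ n)

lemma siteMoment_toReal_pos {β : ℝ} (hβ : 0 ≤ β) (n : ℕ) : 0 < (siteMoment P β n).toReal := by
  refine ENNReal.toReal_pos (ne_of_gt (lt_of_lt_of_le ?_ (pow_le_siteMoment hε hell hβ n)))
    (siteMoment_ne_top hε hell hβ n)
  exact ENNReal.pow_pos (ENNReal.rpow_pos (ENNReal.ofReal_pos.2 hε) ENNReal.ofReal_ne_top) n

/-- Hölder's inequality with exponents `1/a` and `1/b`, followed by the logarithm. -/
lemma logMoment_convex {a b β γ : ℝ} (ha : 0 ≤ a) (hb : 0 ≤ b) (hab : a + b = 1) (hβ : 0 ≤ β)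
    (hγ : 0 ≤ γ) (n : ℕ) :
    logMoment P (a * β + b * γ) n ≤ a * logMoment P β n + b * logMoment P γ n := by
  have h1 : siteMoment P (a * β + b * γ) n ≤ siteMoment P β n ^ a * siteMoment P γ n ^ b := by
    refine le_of_eq_of_le ?_ (ENNReal.lintegral_mul_norm_pow_le
      ((measurable_siteProd 0 n).pow_const β).aemeasurable
      ((measurable_siteProd 0 n).pow_const γ).aemeasurable ha hb hab)
    refine lintegral_congr fun ω => ?_
    rw [ENNReal.rpow_add _ _ (siteProd_ne_zero _ _ _) (siteProd_ne_top _ _ _), mul_comm a, mul_comm b,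
      ENNReal.rpow_mul, ENNReal.rpow_mul]
  have hp1 := siteMoment_toReal_pos hε hell hβ n
  have hp2 := siteMoment_toReal_pos hε hell hγ n
  have h2 := ENNReal.toReal_mono (ENNReal.mul_ne_top
    (ENNReal.rpow_ne_top_of_nonneg ha (siteMoment_ne_top hε hell hβ n))
    (ENNReal.rpow_ne_top_of_nonneg hb (siteMoment_ne_top hε hell hγ n))) h1
  rw [ENNReal.toReal_mul, ← ENNReal.toReal_rpow, ← ENNReal.toReal_rpow] at h2
  have h3 := Real.log_le_log (siteMoment_toReal_pos hε hell (by positivity) n) h2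
  rw [Real.log_mul (Real.rpow_pos_of_pos hp1 _).ne' (Real.rpow_pos_of_pos hp2 _).ne',
    Real.log_rpow hp1, Real.log_rpow hp2] at h3
  rw [logMoment_eq hβ, logMoment_eq hγ, logMoment_eq (by positivity), ← mul_div_assoc,
    ← mul_div_assoc, ← add_div]
  gcongr

/-- Adding `log C` makes the logarithms subadditive. Fekete's limit is an infimum, which gives the
second claim; it keeps the moments away from zero when `l = 0`, where the limit alone would not. -/
lemma exists_tendsto_logMoment {β : ℝ} (hβ : 0 ≤ β) {C : ENNReal} (hC : C ≠ ⊤)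
    (hsub : ∀ k n, siteMoment P β (k + n) ≤ C * (siteMoment P β k * siteMoment P β n)) :
    ∃ l : ℝ, Tendsto (logMoment P β) atTop (𝓝 l) ∧
      ∃ c : ℝ, ∀ n : ℕ, n ≠ 0 → n * l - c ≤ Real.log (siteMoment P β n).toReal := by
  have hpos := siteMoment_toReal_pos hε hell hβ
  have hfin := siteMoment_ne_top hε hell hβ
  have hC0 : 0 < C.toReal := by
    refine ENNReal.toReal_pos (fun h => ?_) hC
    have h1 := hsub 0 0
    rw [h, zero_mul, nonpos_iff_eq_zero] at h1
    have h2 := hpos 0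
    simp [h1] at h2
  set u : ℕ → ℝ := fun n => Real.log (siteMoment P β n).toReal + Real.log C.toReal with hu
  have hsubadd : Subadditive u := by
    intro k n
    have h1 := ENNReal.toReal_mono (ENNReal.mul_ne_top hC (ENNReal.mul_ne_top (hfin k) (hfin n)))
      (hsub k n)
    rw [ENNReal.toReal_mul, ENNReal.toReal_mul] at h1
    have h2 := Real.log_le_log (hpos _) h1
    rw [Real.log_mul hC0.ne' (mul_pos (hpos _) (hpos _)).ne',
      Real.log_mul (hpos _).ne' (hpos _).ne'] at h2
    simp only [hu]
    linarith
  set m : ℝ := (ENNReal.ofReal ε ^ β).toReal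
  have hm : 0 < m := ENNReal.toReal_pos
    (ENNReal.rpow_pos (ENNReal.ofReal_pos.2 hε) ENNReal.ofReal_ne_top).ne'
    (ENNReal.rpow_ne_top_of_nonneg hβ ENNReal.ofReal_ne_top)
  have hlow : ∀ n : ℕ, n * Real.log m ≤ Real.log (siteMoment P β n).toReal := by
    intro n
    rw [← Real.log_pow]
    refine Real.log_le_log (pow_pos hm n) ?_
    rw [← ENNReal.toReal_pow]
    exact ENNReal.toReal_mono (hfin n) (pow_le_siteMoment hε hell hβ n)
  have hbdd : BddBelow (Set.range fun n => u n / n) := by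
    refine ⟨-|Real.log m| - |Real.log C.toReal|, ?_⟩
    rintro _ ⟨n, rfl⟩
    rcases Nat.eq_zero_or_pos n with rfl | hn
    · simp only [Nat.cast_zero, div_zero]
      linarith [abs_nonneg (Real.log m), abs_nonneg (Real.log C.toReal)]
    · have hn' : (1 : ℝ) ≤ n := by exact_mod_cast hn
      rw [le_div_iff₀ (by linarith)]
      simp only [hu]
      nlinarith [hlow n, neg_abs_le (Real.log m), neg_abs_le (Real.log C.toReal),
        abs_nonneg (Real.log C.toReal)]
  refine ⟨hsubadd.lim, ?_, Real.log C.toReal, fun n hn => ?_⟩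
  · have h1 := (hsubadd.tendsto_lim hbdd).sub
      (tendsto_const_div_atTop_nhds_zero_nat (Real.log C.toReal))
    rw [sub_zero] at h1
    refine h1.congr fun n => ?_
    rw [logMoment_eq hβ, ← sub_div, hu]
    simp
  · have h1 := hsubadd.lim_le_div hbdd hn
    have hn' : (0 : ℝ) < n := by exact_mod_cast Nat.pos_of_ne_zero hn
    rw [le_div_iff₀ hn'] at h1
    simp only [hu] at h1
    linarith

lemma exists_siteMoment_le_geometric {β l : ℝ} (hβ : 0 ≤ β)
    (hl : Tendsto (logMoment P β) atTop (𝓝 l)) (hneg : l < 0) :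
    ∃ C q : ENNReal, C ≠ ⊤ ∧ q < 1 ∧ ∀ n, siteMoment P β n ≤ C * q ^ n := by
  obtain ⟨N, hN⟩ := eventually_atTop.1 ((hl.eventually (gt_mem_nhds (show l < l / 2 by linarith))).and
    (eventually_gt_atTop 0))
  set q : ENNReal := ENNReal.ofReal (Real.exp (l / 2))
  have hq0 : q ≠ 0 := (ENNReal.ofReal_pos.2 (Real.exp_pos _)).ne'
  have hqt : q ≠ ⊤ := ENNReal.ofReal_ne_top
  -- The `1` serves the indices `n ≥ N`, where the rate `l / 2` is already effective; the sum serves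
  -- the finitely many earlier ones.
  refine ⟨1 + ∑ i ∈ Finset.range N, siteMoment P β i / q ^ i, q, ?_, ?_, fun n => ?_⟩
  · exact ENNReal.add_ne_top.2 ⟨ENNReal.one_ne_top, ENNReal.sum_ne_top.2 fun i _ =>
      ENNReal.div_ne_top (siteMoment_ne_top hε hell hβ i) (pow_ne_zero _ hq0)⟩
  · rw [← ENNReal.ofReal_one, ENNReal.ofReal_lt_ofReal_iff one_pos, Real.exp_lt_one_iff]
    linarith
  · rcases lt_or_ge n N with h | h
    · have h1 : siteMoment P β n / q ^ n ≤ ∑ i ∈ Finset.range N, siteMoment P β i / q ^ i :=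
        Finset.single_le_sum (f := fun i => siteMoment P β i / q ^ i) (fun _ _ => zero_le)
          (Finset.mem_range.2 h)
      calc siteMoment P β n = siteMoment P β n / q ^ n * q ^ n :=
            (ENNReal.div_mul_cancel (pow_ne_zero _ hq0) (ENNReal.pow_ne_top hqt)).symm
        _ ≤ _ := by gcongr; exact h1.trans le_add_self
    · obtain ⟨h1, h2⟩ := hN n h
      have hn' : (0 : ℝ) < n := by exact_mod_cast h2
      rw [logMoment_eq hβ, div_lt_iff₀ hn',
        Real.log_lt_iff_lt_exp (siteMoment_toReal_pos hε hell hβ n)] at h1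
      have h3 : siteMoment P β n ≤ q ^ n := by
        rw [← ENNReal.ofReal_toReal (siteMoment_ne_top hε hell hβ n), ← ENNReal.ofReal_pow
          (Real.exp_pos _).le, ← Real.exp_nat_mul, mul_comm]
        exact ENNReal.ofReal_le_ofReal h1.le
      exact h3.trans (le_mul_of_one_le_left' le_self_add)

lemma tsum_siteMoment_eq_top {β l c : ℝ} (hβ : 0 ≤ β) (hl : 0 ≤ l)
    (h : ∀ n : ℕ, n ≠ 0 → n * l - c ≤ Real.log (siteMoment P β n).toReal) :
    ∑' n, siteMoment P β n = ⊤ := by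
  have h1 : ∀ n, ENNReal.ofReal (Real.exp (-c)) ≤ siteMoment P β (n + 1) := by
    intro n
    rw [← ENNReal.ofReal_toReal (siteMoment_ne_top hε hell hβ (n + 1))]
    refine ENNReal.ofReal_le_ofReal ?_
    rw [← Real.le_log_iff_exp_le (siteMoment_toReal_pos hε hell hβ _)]
    refine le_trans ?_ (h (n + 1) n.succ_ne_zero)
    have : 0 ≤ ((n + 1 : ℕ) : ℝ) * l := by positivity
    linarith
  rw [tsum_eq_zero_add' ENNReal.summable, eq_top_iff]
  refine le_trans ?_ (le_add_self.trans' (ENNReal.tsum_le_tsum h1))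
  rw [ENNReal.tsum_const_eq_top_of_ne_zero (ENNReal.ofReal_pos.2 (Real.exp_pos _)).ne']

variable (hsub : ∀ β : ℝ, 0 ≤ β → ∃ C : ENNReal, C ≠ ⊤ ∧
  ∀ k n, siteMoment P β (k + n) ≤ C * (siteMoment P β k * siteMoment P β n))

include hsub

lemma exists_convexOn_rate : ∃ Λ : ℝ → ℝ, ConvexOn ℝ (Set.Ici 0) Λ ∧ Λ 0 = 0 ∧ ∀ β, 0 ≤ β →
    Tendsto (logMoment P β) atTop (𝓝 (Λ β)) ∧
      ∃ c : ℝ, ∀ n : ℕ, n ≠ 0 → n * Λ β - c ≤ Real.log (siteMoment P β n).toReal := by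
  have h : ∀ β, ∃ l : ℝ, 0 ≤ β → Tendsto (logMoment P β) atTop (𝓝 l) ∧
      ∃ c : ℝ, ∀ n : ℕ, n ≠ 0 → n * l - c ≤ Real.log (siteMoment P β n).toReal := by
    intro β
    by_cases hβ : 0 ≤ β
    · obtain ⟨C, hC, hCs⟩ := hsub β hβ
      obtain ⟨l, hl⟩ := exists_tendsto_logMoment hε hell hβ hC hCs
      exact ⟨l, fun _ => hl⟩
    · exact ⟨0, fun h => absurd h hβ⟩
  choose Λ hΛ using h
  refine ⟨Λ, ⟨convex_Ici 0, ?_⟩, ?_, hΛ⟩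
  · intro β hβ γ hγ a b ha hb hab
    have hβ' : 0 ≤ β := hβ
    have hγ' : 0 ≤ γ := hγ
    simp only [smul_eq_mul]
    exact le_of_tendsto_of_tendsto' (hΛ _ (by positivity)).1
      (((hΛ β hβ').1.const_mul a).add ((hΛ γ hγ').1.const_mul b))
      (logMoment_convex hε hell ha hb hab hβ' hγ')
  · refine tendsto_nhds_unique (hΛ 0 le_rfl).1 (tendsto_const_nhds.congr fun n => ?_)
    rw [logMoment_eq le_rfl, siteMoment_zero_left]
    simp

/-- Existence and uniqueness of the index. -/
theorem existsUnique_isIndex (hneg : ∃ β > 0, limsup (logMoment P β) atTop < 0)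
    (hnonneg : ∃ β > 0, 0 ≤ limsup (logMoment P β) atTop) : ∃! κ : ℝ, IsIndex P κ := by
  obtain ⟨Λ, hconv, h0, hΛ⟩ := exists_convexOn_rate hε hell hsub
  obtain ⟨β, hβ, h1⟩ := hneg
  obtain ⟨β', hβ', h2⟩ := hnonneg
  rw [(hΛ β hβ.le).1.limsup_eq] at h1
  rw [(hΛ β' hβ'.le).1.limsup_eq] at h2
  obtain ⟨κ, hκ, hκ0⟩ := hconv.exists_eq_zero h0 hβ h1 hβ' h2
  refine ⟨κ, ⟨hκ, hκ0 ▸ (hΛ κ hκ.le).1⟩, ?_⟩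
  rintro κ' ⟨hκ', hlim⟩
  have hκ'0 : Λ κ' = 0 := tendsto_nhds_unique (hΛ κ' hκ'.le).1 hlim
  rcases lt_trichotomy κ κ' with h | h | h
  · exact absurd hκ0 (hconv.neg_of_mem_Ioo h0 hβ h1 hκ' hκ'0 ⟨hκ, h⟩).ne
  · exact h.symm
  · exact absurd hκ'0 (hconv.neg_of_mem_Ioo h0 hβ h1 hκ hκ0 ⟨hκ', h⟩).ne

/-- Below the index the moments decay exponentially. -/
theorem IsIndex.exists_siteMoment_le {κ : ℝ} (hκ : IsIndex P κ)
    (hneg : ∃ β > 0, limsup (logMoment P β) atTop < 0) {t : ℝ} (ht : t ∈ Set.Ioo 0 κ) :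
    ∃ C q : ENNReal, C ≠ ⊤ ∧ q < 1 ∧ ∀ n, siteMoment P t n ≤ C * q ^ n := by
  obtain ⟨Λ, hconv, h0, hΛ⟩ := exists_convexOn_rate hε hell hsub
  obtain ⟨β, hβ, h1⟩ := hneg
  rw [(hΛ β hβ.le).1.limsup_eq] at h1
  have hκ0 : Λ κ = 0 := tendsto_nhds_unique (hΛ κ hκ.1.le).1 hκ.2
  exact exists_siteMoment_le_geometric hε hell ht.1.le (hΛ t ht.1.le).1
    (hconv.neg_of_mem_Ioo h0 hβ h1 hκ.1 hκ0 ht)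

/-- From the index on, the moments are not summable. -/
theorem IsIndex.tsum_siteMoment {κ : ℝ} (hκ : IsIndex P κ) {t : ℝ} (ht : κ ≤ t) :
    ∑' n, siteMoment P t n = ⊤ := by
  obtain ⟨Λ, hconv, h0, hΛ⟩ := exists_convexOn_rate hε hell hsub
  have hκ0 : Λ κ = 0 := tendsto_nhds_unique (hΛ κ hκ.1.le).1 hκ.2
  have ht0 : 0 ≤ t := hκ.1.le.trans ht
  obtain ⟨c, hc⟩ := (hΛ t ht0).2
  exact tsum_siteMoment_eq_top hε hell ht0 (hconv.nonneg_of_zero_le h0 hκ.1 hκ0 ht) hc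

end Rate

/-! ### The speed equation -/

section SpeedEquation

variable {S Ω : Type*} [MeasurableSpace S] [MeasurableSpace Ω]

/-- `ρ` as an extended nonnegative real. -/
noncomputable def weight (θ : S → Set.Ioo (0 : ℝ) 1) (s : S) : ENNReal :=
  ENNReal.ofReal (ratio (θ s))

/-- The inhomogeneity `1 + 1/ρ` as an extended nonnegative real. -/
noncomputable def source (θ : S → Set.Ioo (0 : ℝ) 1) (s : S) : ENNReal :=
  ENNReal.ofReal (1 + 1 / ratio (θ s))

/-- The Neumann series solving the speed equation. -/
noncomputable def neumannSeries (H : Kernel S S) (θ : S → Set.Ioo (0 : ℝ) 1) (s : S) : ENNReal :=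
  ∑' n, (weightedOp H (weight θ))^[n] (source θ) s

variable {H : Kernel S S} {π : Measure S} {θ : S → Set.Ioo (0 : ℝ) 1} {μ : Measure Ω}
  {x : ℤ → Ω → S}

lemma measurable_weight (hθ : Measurable θ) : Measurable (weight θ) :=
  (measurable_ratio.comp hθ).ennreal_ofReal

lemma measurable_source (hθ : Measurable θ) : Measurable (source θ) :=
  (((measurable_ratio.comp hθ).const_div 1).const_add 1).ennreal_ofReal

lemma measurable_neumannSeries (hθ : Measurable θ) : Measurable (neumannSeries H θ) :=
  Measurable.tsum fun n =>
    measurable_weightedOp_iterate (measurable_weight hθ) (measurable_source hθ) n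

lemma neumannSeries_eq (hθ : Measurable θ) (s : S) :
    neumannSeries H θ s = source θ s + weightedOp H (weight θ) (neumannSeries H θ) s := by
  have hm := fun n => measurable_weightedOp_iterate (H := H) (measurable_weight hθ)
    (measurable_source hθ) n
  have h1 : weightedOp H (weight θ) (neumannSeries H θ) s
      = ∑' n, (weightedOp H (weight θ))^[n + 1] (source θ) s := by
    simp only [Function.iterate_succ_apply']
    simp only [weightedOp, neumannSeries]
    simp only [← ENNReal.tsum_mul_left]
    exact lintegral_tsum fun n => ((measurable_weight hθ).mul (hm n)).aemeasurable
  rw [h1, neumannSeries, tsum_eq_zero_add' ENNReal.summable]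
  rfl

lemma one_le_neumannSeries (hθ : Measurable θ) (s : S) : 1 ≤ neumannSeries H θ s := by
  rw [neumannSeries_eq hθ]
  refine le_trans ?_ le_self_add
  rw [source, ENNReal.one_le_ofReal]
  have := ratio_pos (θ s)
  have : 0 ≤ 1 / ratio (θ s) := by positivity
  linarith

/-- Since `ρ (1 + 1/ρ) = ρ + 1 = 1/ω`, the inhomogeneity of the equation matches the factor `1/ω` in
`crossingTerm`. -/
lemma weight_mul_source (θ : S → Set.Ioo (0 : ℝ) 1) (s : S) :
    weight θ s * source θ s = ENNReal.ofReal (1 / (θ s : ℝ)) := by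
  have h1 := ratio_pos (θ s)
  have h2 := (θ s).2.1
  rw [weight, source, ← ENNReal.ofReal_mul h1.le, mul_add, mul_one_div_cancel h1.ne', ratio]
  congr 1
  field_simp
  ring

lemma isMarkovKernel_pow [IsMarkovKernel H] (n : ℕ) : IsMarkovKernel (H ^ n : Kernel S S) := by
  induction n with
  | zero => exact inferInstanceAs (IsMarkovKernel (Kernel.id : Kernel S S))
  | succ n ih =>
    rw [pow_succ]
    exact inferInstanceAs (IsMarkovKernel ((H ^ n : Kernel S S) ∘ₖ H))

section Elliptic

variable [IsMarkovKernel H] [IsProbabilityMeasure π] {ε : ℝ} (hε : 0 < ε)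
  (hell : ∀ s, ε < (θ s : ℝ) ∧ (θ s : ℝ) < 1 - ε) (hθ : Measurable θ)

include hε hell

lemma weight_le (s : S) : weight θ s ≤ ENNReal.ofReal (1 / ε) :=
  ENNReal.ofReal_le_ofReal (ratio_le hε (hell s).1)

lemma source_le (s : S) : source θ s ≤ ENNReal.ofReal (1 + 1 / ε) := by
  refine ENNReal.ofReal_le_ofReal ?_
  gcongr
  exact le_ratio (hell s).2

include hθ

lemma lintegral_weightedOp_iterate_le {g : S → ENNReal} {R : ENNReal} (hR : ∀ s, g s ≤ R)
    (n : ℕ) : ∫⁻ s, (weightedOp H (weight θ))^[n] g s ∂π ≤ R * weightedMoment H π (weight θ) n := by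
  rw [weightedMoment, ← lintegral_const_mul _
    (measurable_weightedOp_iterate (measurable_weight hθ) measurable_const n)]
  refine lintegral_mono fun s => ?_
  have h1 := (monotone_weightedOp (H := H) (u := weight θ)).iterate n
    (show g ≤ fun s => R * 1 from fun s => by simpa using hR s) s
  rwa [weightedOp_iterate_const_mul (measurable_weight hθ) measurable_const] at h1

/-- Ellipticity bounds the first `m` terms. From then on, domination bounds each term uniformly by a
`π`-mean, and these means decay geometrically. -/
lemma exists_neumannSeries_le {m : ℕ} {C : ENNReal} (hC : C ≠ ⊤)
    (hdom : ∀ s A, MeasurableSet A → (H ^ m) s A ≤ C * π A) {C' q : ENNReal} (hC' : C' ≠ ⊤)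
    (hq : q < 1) (hmom : ∀ n, weightedMoment H π (weight θ) n ≤ C' * q ^ n) :
    ∃ M : ENNReal, M ≠ ⊤ ∧ ∀ s, neumannSeries H θ s ≤ M := by
  set B := ENNReal.ofReal (1 / ε)
  set R := ENNReal.ofReal (1 + 1 / ε)
  have hB : B ≠ ⊤ := ENNReal.ofReal_ne_top
  have hR : R ≠ ⊤ := ENNReal.ofReal_ne_top
  refine ⟨∑ n ∈ Finset.range m, B ^ n * R + B ^ m * C * (R * (C' * (1 - q)⁻¹)), ?_, fun s => ?_⟩
  · refine ENNReal.add_ne_top.2 ⟨ENNReal.sum_ne_top.2 fun n _ =>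
      ENNReal.mul_ne_top (ENNReal.pow_ne_top hB) hR, ?_⟩
    exact ENNReal.mul_ne_top (ENNReal.mul_ne_top (ENNReal.pow_ne_top hB) hC)
      (ENNReal.mul_ne_top hR (ENNReal.mul_ne_top hC'
        (ENNReal.inv_ne_top.2 (tsub_pos_of_lt hq).ne')))
  · rw [neumannSeries, ← ENNReal.summable.sum_add_tsum_nat_add' (k := m)]
    refine add_le_add (Finset.sum_le_sum fun n _ => ?_) ?_
    · refine (weightedOp_iterate_le_pow (measurable_weight hθ) (measurable_source hθ)
        (weight_le hε hell) n s).trans ?_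
      gcongr
      have := isMarkovKernel_pow (H := H) n
      calc _ ≤ ∫⁻ _, R ∂((H ^ n : Kernel S S) s) := lintegral_mono fun y => source_le hε hell y
        _ = R := by simp
    · rw [← ENNReal.tsum_geometric, ← ENNReal.tsum_mul_left, ← ENNReal.tsum_mul_left,
        ← ENNReal.tsum_mul_left]
      refine ENNReal.tsum_le_tsum fun n => ?_
      rw [add_comm n m]
      refine (weightedOp_iterate_add_le (measurable_weight hθ) hdom (weight_le hε hell) n
        (measurable_source hθ) s).trans ?_
      gcongr
      refine (lintegral_weightedOp_iterate_le hε hell hθ (source_le hε hell) n).trans ?_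
      gcongr
      exact hmom n

lemma solvesAt_neumannSeries {M : ENNReal} (hM : M ≠ ⊤) (hle : ∀ s, neumannSeries H θ s ≤ M)
    (s : S) : SolvesAt H θ (fun s => (neumannSeries H θ s).toReal) s := by
  have hfin : ∀ s, neumannSeries H θ s ≠ ⊤ := fun s => ne_top_of_le_ne_top hM (hle s)
  have hmeas := measurable_neumannSeries (H := H) hθ
  have h1 : ∫ y, ratio (θ y) * (neumannSeries H θ y).toReal ∂(H s)
      = (weightedOp H (weight θ) (neumannSeries H θ) s).toReal := by
    rw [integral_eq_lintegral_of_nonneg_ae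
      (ae_of_all _ fun y => mul_nonneg (ratio_pos _).le ENNReal.toReal_nonneg)
      ((measurable_ratio.comp hθ).mul hmeas.ennreal_toReal).aestronglyMeasurable, weightedOp]
    congr 1
    refine lintegral_congr fun y => ?_
    rw [ENNReal.ofReal_mul (ratio_pos _).le, ENNReal.ofReal_toReal (hfin y), weight]
  have h2 : weightedOp H (weight θ) (neumannSeries H θ) s ≠ ⊤ := fun h =>
    hfin s (by rw [neumannSeries_eq hθ, h, add_top])
  have h3 := ratio_pos (θ s)
  rw [SolvesAt, h1, neumannSeries_eq hθ, source, ENNReal.toReal_add ENNReal.ofReal_ne_top h2,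
    ENNReal.toReal_ofReal (by positivity)]
  ring

/-- Subtraction cancels the inhomogeneity, so the difference of two solutions is a fixed point of
the operator. -/
lemma enorm_sub_le_weightedOp {ξ η : S → ℝ} (hξ : IsPosBounded ξ) (hη : IsPosBounded η) {s : S}
    (h1 : SolvesAt H θ ξ s) (h2 : SolvesAt H θ η s) :
    ‖ξ s - η s‖ₑ ≤ weightedOp H (weight θ) (fun y => ‖ξ y - η y‖ₑ) s := by
  have hint : ∀ {ζ : S → ℝ}, IsPosBounded ζ → Integrable (fun y => ratio (θ y) * ζ y) (H s) := by
    rintro ζ ⟨hm, hp, C, hC⟩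
    refine Integrable.of_bound ((measurable_ratio.comp hθ).mul hm).aestronglyMeasurable
      (1 / ε * C) (ae_of_all _ fun y => ?_)
    rw [norm_mul, Real.norm_of_nonneg (ratio_pos _).le, Real.norm_of_nonneg (hp y).le]
    exact mul_le_mul (ratio_le hε (hell y).1) (hC y) (hp y).le (by positivity)
  have h3 : ξ s - η s = ∫ y, ratio (θ y) * (ξ y - η y) ∂(H s) := by
    rw [h1, h2]
    simp only [mul_sub]
    rw [integral_sub (hint hξ) (hint hη)]
    ring
  rw [h3]
  refine (enorm_integral_le_lintegral_enorm _).trans (le_of_eq ?_)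
  refine lintegral_congr fun y => ?_
  rw [enorm_mul, Real.enorm_of_nonneg (ratio_pos _).le, weight]

omit hε hell hθ in
lemma IsPosBounded.exists_enorm_sub_le {ξ η : S → ℝ} (hξ : IsPosBounded ξ) (hη : IsPosBounded η) :
    ∃ R : ENNReal, R ≠ ⊤ ∧ ∀ s, ‖ξ s - η s‖ₑ ≤ R := by
  obtain ⟨-, hp, C, hC⟩ := hξ
  obtain ⟨-, hp', C', hC'⟩ := hη
  refine ⟨ENNReal.ofReal (C + C'), ENNReal.ofReal_ne_top, fun s => ?_⟩
  rw [← ofReal_norm, Real.norm_eq_abs]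
  refine ENNReal.ofReal_le_ofReal (abs_le.2 ⟨?_, ?_⟩) <;>
    linarith [hp s, hp' s, hC s, hC' s]

/-- Bounded solutions of the speed equation are unique up to `π`-null sets. -/
lemma ae_eq_of_ae_solvesAt (hπ : π.bind H = π) {C' q : ENNReal} (hC' : C' ≠ ⊤)
    (hq : q < 1) (hmom : ∀ n, weightedMoment H π (weight θ) n ≤ C' * q ^ n) {ξ η : S → ℝ}
    (hξ : IsPosBounded ξ) (hη : IsPosBounded η) (h1 : ∀ᵐ s ∂π, SolvesAt H θ ξ s)
    (h2 : ∀ᵐ s ∂π, SolvesAt H θ η s) : ξ =ᵐ[π] η := by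
  set e : S → ENNReal := fun y => ‖ξ y - η y‖ₑ
  have he : Measurable e := (hξ.1.sub hη.1).enorm
  have hle : e ≤ᵐ[π] weightedOp H (weight θ) e := by
    filter_upwards [h1, h2] with s h1 h2 using enorm_sub_le_weightedOp hε hell hθ hξ hη h1 h2
  -- By invariance, a `π`-null set is also null for `H s` at `π`-almost every `s`, so the operator
  -- respects almost everywhere inequalities.
  have hmono : ∀ {f g : S → ENNReal}, f ≤ᵐ[π] g →
      weightedOp H (weight θ) f ≤ᵐ[π] weightedOp H (weight θ) g := by
    intro f g hfg
    have h3 : ∀ᵐ s ∂(π.bind H), f s ≤ g s := hπ.symm ▸ hfg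
    filter_upwards [Measure.ae_ae_of_ae_bind H.aemeasurable h3] with s hs
    exact lintegral_mono_ae (hs.mono fun y hy => mul_le_mul_right hy _)
  have hiter : ∀ n, e ≤ᵐ[π] (weightedOp H (weight θ))^[n] e := by
    intro n
    induction n with
    | zero => exact EventuallyLE.refl _ _
    | succ n ih =>
      rw [Function.iterate_succ_apply']
      exact hle.trans (hmono ih)
  obtain ⟨R, hR, hRe⟩ := hξ.exists_enorm_sub_le hη
  have hbound : ∀ n, ∫⁻ s, e s ∂π ≤ R * C' * q ^ n := fun n => by
    calc ∫⁻ s, e s ∂π ≤ ∫⁻ s, (weightedOp H (weight θ))^[n] e s ∂π := lintegral_mono_ae (hiter n)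
      _ ≤ R * weightedMoment H π (weight θ) n :=
          lintegral_weightedOp_iterate_le hε hell hθ hRe n
      _ ≤ R * (C' * q ^ n) := by gcongr; exact hmom n
      _ = _ := by ring
  have hlim : Tendsto (fun n => R * C' * q ^ n) atTop (𝓝 0) := by
    simpa using ENNReal.Tendsto.const_mul (ENNReal.tendsto_pow_atTop_nhds_zero_of_lt_one hq)
      (Or.inr (ENNReal.mul_ne_top hR hC'))
  have hzero : ∫⁻ s, e s ∂π = 0 := le_antisymm (ge_of_tendsto' hlim hbound) zero_le
  filter_upwards [(lintegral_eq_zero_iff he).1 hzero] with s hs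
  simpa [e, sub_eq_zero] using hs

/-- Bounded solutions of the speed equation that agree up to `π`-null sets are equal. -/
lemma eq_of_solvesAt_of_ae_eq {m : ℕ} {C : ENNReal}
    (hdom : ∀ s A, MeasurableSet A → (H ^ m) s A ≤ C * π A) {ξ η : S → ℝ}
    (hξ : IsPosBounded ξ) (hη : IsPosBounded η) (h1 : ∀ s, SolvesAt H θ ξ s)
    (h2 : ∀ s, SolvesAt H θ η s) (hae : ξ =ᵐ[π] η) : ξ = η := by
  set e : S → ENNReal := fun y => ‖ξ y - η y‖ₑ
  have he : Measurable e := (hξ.1.sub hη.1).enorm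
  have hle : e ≤ weightedOp H (weight θ) e := fun s =>
    enorm_sub_le_weightedOp hε hell hθ hξ hη (h1 s) (h2 s)
  have hiter : ∀ n, e ≤ (weightedOp H (weight θ))^[n] e := by
    intro n
    induction n with
    | zero => exact le_rfl
    | succ n ih =>
      rw [Function.iterate_succ_apply']
      exact hle.trans (monotone_weightedOp ih)
  have hzero : ∫⁻ s, e s ∂π = 0 := by
    rw [lintegral_eq_zero_iff he]
    filter_upwards [hae] with s hs
    simp [e, hs]
  ext s
  -- After `m` steps the bound at every single state is a multiple of the `π`-mean of `e`, which is
  -- zero.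
  have h3 := (hiter m s).trans (weightedOp_iterate_add_le (measurable_weight hθ) hdom
    (weight_le hε hell) 0 he s)
  rw [Function.iterate_zero, id, hzero, mul_zero, nonpos_iff_eq_zero] at h3
  simpa [e, sub_eq_zero] using h3

end Elliptic

/-! ### Moments of a Markov environment -/

lemma IsStationaryMarkovChain.siteMoment_envLaw [IsMarkovKernel H] [IsFiniteMeasure μ]
    (hx : IsStationaryMarkovChain H π μ x) (hθ : Measurable θ) {β : ℝ} (hβ : 0 ≤ β) (n : ℕ) :
    siteMoment (envLaw θ μ x) β n = weightedMoment H π (fun s => weight θ s ^ β) n := by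
  rw [siteMoment, envLaw, lintegral_map ((measurable_siteProd 0 n).pow_const β)
    (measurable_markovEnv hx hθ), ← hx.lintegral_prod_neg ((measurable_weight hθ).pow_const β)]
  refine lintegral_congr fun w => ?_
  simp only [siteProd_rpow _ _ _ hβ, markovEnv, weight, zero_add]

/-- The sites `-n, …, 0` are the chain times `n, …, 0`. Splitting `1/ω_{-n}` as weight times source
exhibits the `n`-th term of the Neumann series at `x 0`, before the Markov property is applied. -/
lemma crossingTerm_markovEnv (w : Ω) (n : ℕ) :
    crossingTerm (markovEnv θ x w) n = weight θ (x 0 w)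
      * (∏ i ∈ Finset.range n, weight θ (x (0 + 1 + i) w)) * source θ (x (0 + n) w) := by
  have h1 : weight θ (x 0 w) * ∏ i ∈ Finset.range n, weight θ (x (0 + 1 + i) w)
      = (∏ i ∈ Finset.range n, weight θ (x i w)) * weight θ (x n w) := by
    rw [← Finset.prod_range_succ (fun i : ℕ => weight θ (x i w)), Finset.prod_range_succ', mul_comm]
    simp only [zero_add, Nat.cast_zero, Nat.cast_add, Nat.cast_one, add_comm (1 : ℤ)]
  rw [h1, zero_add, mul_assoc, weight_mul_source, crossingTerm, mul_comm, siteProd]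
  simp only [markovEnv, neg_neg]
  congr 1
  rw [← Finset.prod_range_reflect]
  refine Finset.prod_congr rfl fun r hr => ?_
  have hr' := Finset.mem_range.1 hr
  rw [weight]
  congr 4
  omega

lemma IsStationaryMarkovChain.lintegral_crossingTime [IsMarkovKernel H] [IsFiniteMeasure μ]
    (hx : IsStationaryMarkovChain H π μ x) (hθ : Measurable θ) :
    ∫⁻ ω, crossingTime ω ∂(envLaw θ μ x) = ∫⁻ s, weight θ s * neumannSeries H θ s ∂π := by
  have hm := fun n => measurable_weightedOp_iterate (H := H) (measurable_weight hθ)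
    (measurable_source hθ) n
  have hY : Measurable[past x 0] fun w => weight θ (x 0 w) :=
    (measurable_weight hθ).comp (measurable_past x le_rfl)
  rw [envLaw, lintegral_map measurable_crossingTime (measurable_markovEnv hx hθ), ← hx.map_eq 0,
    lintegral_map ((measurable_weight hθ).fun_mul (measurable_neumannSeries hθ)) (hx.measurable 0)]
  simp only [crossingTime, neumannSeries, ← ENNReal.tsum_mul_left]
  have h1 : ∀ n, Measurable fun w => crossingTerm (markovEnv θ x w) n := fun n =>
    (measurable_crossingTerm n).comp (measurable_markovEnv hx hθ)
  have h2 : ∀ n, Measurable fun w =>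
      weight θ (x 0 w) * (weightedOp H (weight θ))^[n] (source θ) (x 0 w) := fun n =>
    ((measurable_weight hθ).mul (hm n)).comp (hx.measurable 0)
  rw [lintegral_tsum fun n => (h1 n).aemeasurable, lintegral_tsum fun n => (h2 n).aemeasurable]
  refine tsum_congr fun n => ?_
  simp only [crossingTerm_markovEnv]
  exact hx.lintegral_mul_prod (measurable_weight hθ) 0 hY n (measurable_source hθ)

end SpeedEquation

section Main

variable {S Ω : Type*} [MeasurableSpace S] [MeasurableSpace Ω] {H : Kernel S S} {π : Measure S}
  {θ θ' : S → Set.Ioo (0 : ℝ) 1} {μ : Measure Ω} {x : ℤ → Ω → S}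

/-! ### Uniformly elliptic Markov environments -/

section Elliptic

variable [IsMarkovKernel H] [IsProbabilityMeasure π] [IsProbabilityMeasure μ]
  (hx : IsStationaryMarkovChain H π μ x) (hθ : Measurable θ) {ε : ℝ} (hε : 0 < ε)
  (hell : ∀ s, ε < (θ s : ℝ) ∧ (θ s : ℝ) < 1 - ε)
  (hA1 : FiniteIrreducible H ∨ UniformlyDominated H)

include hx hθ in
lemma IsStationaryMarkovChain.siteMoment_one_envLaw (n : ℕ) :
    siteMoment (envLaw θ μ x) 1 n = weightedMoment H π (weight θ) n := by
  rw [hx.siteMoment_envLaw hθ zero_le_one]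
  simp only [ENNReal.rpow_one]

include hx hθ hell in
lemma ae_elliptic_envLaw :
    ∀ᵐ ω ∂(envLaw θ μ x), ∀ k, ε < (ω k : ℝ) ∧ (ω k : ℝ) < 1 - ε := by
  refine ae_all_iff.2 fun k => ?_
  refine (ae_map_iff (measurable_markovEnv hx hθ).aemeasurable ?_).2
    (ae_of_all _ fun w => hell _)
  have h1 : Measurable fun ω : Env => (ω k : ℝ) := by fun_prop
  exact (measurableSet_lt measurable_const h1).inter (measurableSet_lt h1 measurable_const)

include hx hθ hε hell hA1

lemma siteMoment_envLaw_add_le {β : ℝ} (hβ : 0 ≤ β) : ∃ C : ENNReal, C ≠ ⊤ ∧ ∀ k n,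
    siteMoment (envLaw θ μ x) β (k + n)
      ≤ C * (siteMoment (envLaw θ μ x) β k * siteMoment (envLaw θ μ x) β n) := by
  obtain ⟨m, C, hC, hdom⟩ := exists_pow_le_mul hx.bind_eq hA1
  set b : ENNReal := ENNReal.ofReal ε ^ β
  set B : ENNReal := ENNReal.ofReal (1 / ε) ^ β
  have hb0 : b ≠ 0 := (ENNReal.rpow_pos (ENNReal.ofReal_pos.2 hε) ENNReal.ofReal_ne_top).ne'
  have hbt : b ≠ ⊤ := ENNReal.rpow_ne_top_of_nonneg hβ ENNReal.ofReal_ne_top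
  have hBt : B ≠ ⊤ := ENNReal.rpow_ne_top_of_nonneg hβ ENNReal.ofReal_ne_top
  refine ⟨(b ^ m)⁻¹ * (B ^ m * C), ENNReal.mul_ne_top (ENNReal.inv_ne_top.2 (pow_ne_zero _ hb0))
    (ENNReal.mul_ne_top (ENNReal.pow_ne_top hBt) hC), fun k n => ?_⟩
  simp only [hx.siteMoment_envLaw hθ hβ]
  have h1 := weightedMoment_mul_pow_le (π := π) ((measurable_weight hθ).pow_const β) hdom (b := b)
    (B := B) (fun s => ENNReal.rpow_le_rpow (ENNReal.ofReal_le_ofReal (le_ratio (hell s).2)) hβ)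
    (fun s => ENNReal.rpow_le_rpow (weight_le hε hell s) hβ) k n
  rw [mul_assoc, mul_comm, ← div_eq_mul_inv, ENNReal.le_div_iff_mul_le
    (Or.inl (pow_ne_zero _ hb0)) (Or.inl (ENNReal.pow_ne_top hbt)), mul_comm]
  exact h1

/-- The speed of the walk in terms of the index and the Neumann series. -/
theorem exists_isSpeed_envLaw
    (hneg : ∃ β > 0, limsup (logMoment (envLaw θ μ x) β) atTop < 0)
    {κ : ℝ} (hκ : IsIndex (envLaw θ μ x) κ) :
    (κ ≤ 1 → IsSpeed (envLaw θ μ x) 0) ∧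
    (1 < κ → 0 < (∫⁻ s, weight θ s * neumannSeries H θ s ∂π).toReal ∧
      IsSpeed (envLaw θ μ x) (∫⁻ s, weight θ s * neumannSeries H θ s ∂π).toReal⁻¹) := by
  have := isProbabilityMeasure_envLaw hx hθ
  have hellP := ae_elliptic_envLaw hx hθ hell
  have hsub : ∀ β : ℝ, 0 ≤ β → _ := fun β hβ => siteMoment_envLaw_add_le hx hθ hε hell hA1 hβ
  obtain ⟨J, c, hc, hmin⟩ := exists_mul_le_sum_pow hx.bind_eq hA1
  have herg := ergodic_shift hx hθ hc hmin
  have hP := measurePreserving_shift hx hθ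
  have hell0 := hellP.mono fun ω h => h 0
  refine ⟨fun h1 => ?_, fun h1 => ?_⟩
  -- Any order below `κ` has geometrically decaying moments; it is also at most `1` here, as the
  -- bound on hitting probabilities requires.
  · have hκ2 : κ / 2 ∈ Set.Ioo 0 κ := ⟨half_pos hκ.1, half_lt_self hκ.1⟩
    obtain ⟨C, q, hC, hq, hmom⟩ := hκ.exists_siteMoment_le hε hellP hsub hneg hκ2
    exact isSpeed_zero hP herg hε hell0 hκ2.1 (hκ2.2.le.trans h1) hC hq hmom
      (hκ.tsum_siteMoment hε hellP hsub h1)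
  · obtain ⟨C, q, hC, hq, hmom⟩ := hκ.exists_siteMoment_le hε hellP hsub hneg ⟨one_pos, h1⟩
    have h2 := isSpeed_inv_lintegral_crossingTime hP herg hε hell0 hC hq hmom
    rw [hx.lintegral_crossingTime hθ] at h2
    exact h2.2

/-- Existence of a bounded solution of the speed equation, and uniqueness, when `κ > 1`. -/
theorem exists_isPosBounded_solvesAt
    (hneg : ∃ β > 0, limsup (logMoment (envLaw θ μ x) β) atTop < 0)
    {κ : ℝ} (hκ : IsIndex (envLaw θ μ x) κ) (h1 : 1 < κ) :
    ∃ ξ : S → ℝ, IsPosBounded ξ ∧ (∀ s, SolvesAt H θ ξ s) ∧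
      (∀ s, ENNReal.ofReal (ξ s) = neumannSeries H θ s) ∧
      (∀ η : S → ℝ, IsPosBounded η → (∀ᵐ s ∂π, SolvesAt H θ η s) → η =ᵐ[π] ξ) ∧
      (∀ η : S → ℝ, IsPosBounded η → (∀ s, SolvesAt H θ η s) → η = ξ) := by
  have := isProbabilityMeasure_envLaw hx hθ
  have hellP := ae_elliptic_envLaw hx hθ hell
  have hsub : ∀ β : ℝ, 0 ≤ β → _ := fun β hβ => siteMoment_envLaw_add_le hx hθ hε hell hA1 hβ
  obtain ⟨m, C, hC, hdom⟩ := exists_pow_le_mul hx.bind_eq hA1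
  obtain ⟨C', q, hC', hq, hmom⟩ := hκ.exists_siteMoment_le hε hellP hsub hneg ⟨one_pos, h1⟩
  simp only [hx.siteMoment_one_envLaw hθ] at hmom
  obtain ⟨M, hM, hle⟩ := exists_neumannSeries_le hε hell hθ hC hdom hC' hq hmom
  have hfin : ∀ s, neumannSeries H θ s ≠ ⊤ := fun s => ne_top_of_le_ne_top hM (hle s)
  have hsol := solvesAt_neumannSeries hε hell hθ hM hle
  have hpos : IsPosBounded fun s => (neumannSeries H θ s).toReal :=
    ⟨(measurable_neumannSeries hθ).ennreal_toReal, fun s =>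
      ENNReal.toReal_pos (one_pos.trans_le (one_le_neumannSeries hθ s)).ne' (hfin s),
      M.toReal, fun s => ENNReal.toReal_mono hM (hle s)⟩
  have huniq : ∀ η : S → ℝ, IsPosBounded η → (∀ᵐ s ∂π, SolvesAt H θ η s) →
      η =ᵐ[π] fun s => (neumannSeries H θ s).toReal := fun η hη h =>
    ae_eq_of_ae_solvesAt hε hell hθ hx.bind_eq hC' hq hmom hη hpos h (ae_of_all _ hsol)
  exact ⟨_, hpos, hsol, fun s => ENNReal.ofReal_toReal (hfin s), huniq, fun η hη h =>
    eq_of_solvesAt_of_ae_eq hε hell hθ hdom hη hpos h hsol (huniq η hη (ae_of_all _ h))⟩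

end Elliptic

/-! ### Modification on null sets -/

/-- Bad states form a `π`-null set, where `θ` is replaced by `1/2`; this value is admissible because
`ε < 1/2`. -/
lemma exists_elliptic_modification [IsMarkovKernel H]
    [IsProbabilityMeasure π] [IsProbabilityMeasure μ] (hx : IsStationaryMarkovChain H π μ x)
    (hθ : Measurable θ) {ε : ℝ} (hε : ε ∈ Set.Ioo (0 : ℝ) (1 / 2))
    (h : ∀ᵐ ω ∂(envLaw θ μ x), ε < (ω 0 : ℝ) ∧ (ω 0 : ℝ) < 1 - ε) :
    ∃ θ' : S → Set.Ioo (0 : ℝ) 1, Measurable θ' ∧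
      (∀ s, ε < (θ' s : ℝ) ∧ (θ' s : ℝ) < 1 - ε) ∧ θ' =ᵐ[π] θ := by
  classical
  have hm : Measurable fun s => (θ s : ℝ) := measurable_subtype_coe.comp hθ
  have hset : MeasurableSet {s | ε < (θ s : ℝ) ∧ (θ s : ℝ) < 1 - ε} :=
    (measurableSet_lt measurable_const hm).inter (measurableSet_lt hm measurable_const)
  refine ⟨fun s => if ε < (θ s : ℝ) ∧ (θ s : ℝ) < 1 - ε then θ s
    else ⟨1 / 2, by norm_num, by norm_num⟩, Measurable.ite hset hθ measurable_const, fun s => ?_, ?_⟩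
  · dsimp only
    split_ifs with hs
    · exact hs
    · exact ⟨hε.2, by linarith [hε.2]⟩
  · have h1 := ae_of_ae_map (measurable_markovEnv hx hθ).aemeasurable h
    have h2 : ∀ᵐ s ∂π, ε < (θ s : ℝ) ∧ (θ s : ℝ) < 1 - ε := by
      rw [← hx.map_eq (-0)]
      exact (ae_map_iff (hx.measurable _).aemeasurable hset).2 h1
    filter_upwards [h2] with s hs
    exact if_pos hs

lemma envLaw_congr (hx : IsStationaryMarkovChain H π μ x) (h : θ' =ᵐ[π] θ) :
    envLaw θ' μ x = envLaw θ μ x := by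
  refine Measure.map_congr ?_
  have h1 : ∀ n : ℤ, ∀ᵐ w ∂μ, θ' (x n w) = θ (x n w) := fun n =>
    ae_of_ae_map (hx.measurable n).aemeasurable (by rw [hx.map_eq n]; exact h)
  filter_upwards [ae_all_iff.2 h1] with w hw
  funext n
  exact hw (-n)

/-- Invariance of `π` ensures that the integral against `H s` does not see the modification, for
almost every `s`. -/
lemma ae_solvesAt_congr [IsMarkovKernel H] (hπ : π.bind H = π) (h : θ' =ᵐ[π] θ) (ξ : S → ℝ) :
    ∀ᵐ s ∂π, SolvesAt H θ' ξ s ↔ SolvesAt H θ ξ s := by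
  have h1 : ∀ᵐ s ∂(π.bind H), θ' s = θ s := hπ.symm ▸ h
  filter_upwards [h, Measure.ae_ae_of_ae_bind H.aemeasurable h1] with s hs hs'
  have h2 : ∫ y, ratio (θ' y) * ξ y ∂(H s) = ∫ y, ratio (θ y) * ξ y ∂(H s) :=
    integral_congr_ae (hs'.mono fun y hy => by simp only [hy])
  rw [SolvesAt, SolvesAt, h2, hs]

end Main

end RWRE

/-! ### The main theorem. -/

theorem mainTheorem9 {S Ω : Type*} [MeasurableSpace S] [MeasurableSpace.CountablyGenerated S]
    [MeasurableSpace Ω] (μ : Measure Ω) [IsProbabilityMeasure μ]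
    (H : Kernel S S) [IsMarkovKernel H] (π : Measure S) [IsProbabilityMeasure π]
    (x : ℤ → Ω → S) (hx : RWRE.IsStationaryMarkovChain H π μ x)
    (θ : S → Set.Ioo (0 : ℝ) 1) (hθ : Measurable θ)
    (hA : RWRE.StandingAssumption H θ μ x) :
    (∃! κ : ℝ, RWRE.IsIndex (RWRE.envLaw θ μ x) κ) ∧
    ∃ v : ℝ, RWRE.IsSpeed (RWRE.envLaw θ μ x) v ∧
      ∀ κ : ℝ, RWRE.IsIndex (RWRE.envLaw θ μ x) κ →
        (κ ≤ 1 → v = 0) ∧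
        (1 < κ → 0 < v ∧
          -- a positive bounded solution off a `π`-null set exists, and is unique up to such sets
          (∃ ξ : S → ℝ, RWRE.IsPosBounded ξ ∧ (∀ᵐ s ∂π, RWRE.SolvesAt H θ ξ s) ∧
            ∀ η : S → ℝ, RWRE.IsPosBounded η → (∀ᵐ s ∂π, RWRE.SolvesAt H θ η s) →
              η =ᵐ[π] ξ) ∧
          -- if ellipticity holds at every state, so do existence and uniqueness
          ((∃ ε > 0, ∀ s, ε < (θ s : ℝ) ∧ (θ s : ℝ) < 1 - ε) →
            ∃! ξ : S → ℝ, RWRE.IsPosBounded ξ ∧ ∀ s, RWRE.SolvesAt H θ ξ s) ∧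
          -- the speed formula, for every such solution
          (∀ ξ : S → ℝ, RWRE.IsPosBounded ξ → (∀ᵐ s ∂π, RWRE.SolvesAt H θ ξ s) →
            Integrable (fun w => RWRE.ratio (θ (x 0 w)) * ξ (x 0 w)) μ ∧
            v⁻¹ = ∫ w, RWRE.ratio (θ (x 0 w)) * ξ (x 0 w) ∂μ)) := by
  obtain ⟨ε, hε, hεell⟩ := hA.a2
  obtain ⟨θ', hθ', hell', hae⟩ := RWRE.exists_elliptic_modification hx hθ hε hεell
  have hlaw : RWRE.envLaw θ' μ x = RWRE.envLaw θ μ x := RWRE.envLaw_congr hx hae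
  have hneg' := hA.a3_neg
  rw [← hlaw] at hneg'
  have := RWRE.isProbabilityMeasure_envLaw hx hθ'
  have hellP := RWRE.ae_elliptic_envLaw hx hθ' hell'
  have hsub : ∀ β : ℝ, 0 ≤ β → _ := fun β hβ =>
    RWRE.siteMoment_envLaw_add_le hx hθ' hε.1 hell' hA.a1 hβ
  have hex : ∃! κ : ℝ, RWRE.IsIndex (RWRE.envLaw θ' μ x) κ :=
    RWRE.existsUnique_isIndex hε.1 hellP hsub hneg' (hlaw ▸ hA.a3_nonneg)
  obtain ⟨κ, hκ, huniq⟩ := hex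
  obtain ⟨hle, hgt⟩ := RWRE.exists_isSpeed_envLaw hx hθ' hε.1 hell' hA.a1 hneg' hκ
  rw [← hlaw]
  refine ⟨⟨κ, hκ, huniq⟩, ?_⟩
  rcases le_or_gt κ 1 with h1 | h1
  · refine ⟨0, hle h1, fun κ' hκ' => ⟨fun _ => rfl, fun h => ?_⟩⟩
    rw [huniq κ' hκ'] at h
    exact absurd h (not_lt.2 h1)
  obtain ⟨hpos, hspeed⟩ := hgt h1
  refine ⟨_, hspeed, fun κ' hκ' => ⟨fun h => ?_, fun _ => ⟨inv_pos.2 hpos, ?_, ?_, ?_⟩⟩⟩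
  · rw [huniq κ' hκ'] at h
    exact absurd h1 (not_lt.2 h)
  all_goals
    obtain ⟨ξ', hξ', hsol', hneu, hae', -⟩ :=
      RWRE.exists_isPosBounded_solvesAt hx hθ' hε.1 hell' hA.a1 hneg' hκ h1
  · refine ⟨ξ', hξ', ?_, fun η hη h => hae' η hη ?_⟩
    · filter_upwards [RWRE.ae_solvesAt_congr hx.bind_eq hae ξ'] with s hs using hs.1 (hsol' s)
    · filter_upwards [RWRE.ae_solvesAt_congr hx.bind_eq hae η, h] with s hs h using hs.2 h
  -- A claim at every state cannot pass through the modified `θ'`, so the original `θ` is used with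
  -- its own ellipticity constant; the index carries over because the two environment laws coincide.
  · rintro ⟨ε₀, hε₀, hell₀⟩
    obtain ⟨ξ, hξ, hsol, -, -, hu⟩ := RWRE.exists_isPosBounded_solvesAt hx hθ hε₀ hell₀ hA.a1
      hA.a3_neg (hlaw ▸ hκ) h1
    exact ⟨ξ, ⟨hξ, hsol⟩, fun η hη => hu η hη.1 hη.2⟩
  · intro ξ hξ hsol
    -- By uniqueness every solution agrees almost everywhere with the Neumann series, for which the
    -- mean crossing time is known.
    have h2 : ξ =ᵐ[π] ξ' := by
      refine hae' ξ hξ ?_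
      filter_upwards [RWRE.ae_solvesAt_congr hx.bind_eq hae ξ, hsol] with s hs h using hs.2 h
    have h3 : (fun w => RWRE.ratio (θ (x 0 w)) * ξ (x 0 w))
        =ᵐ[μ] fun w => RWRE.ratio (θ' (x 0 w)) * ξ' (x 0 w) := by
      have h4 : ∀ᵐ s ∂(μ.map (x 0)), θ' s = θ s ∧ ξ s = ξ' s := by
        rw [hx.map_eq 0]; exact hae.and h2
      filter_upwards [ae_of_ae_map (hx.measurable 0).aemeasurable h4] with w hw
      rw [hw.1, hw.2]
    have hm : Measurable fun s => RWRE.ratio (θ' s) * ξ' s :=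
      (RWRE.measurable_ratio.comp hθ').mul hξ'.1
    refine ⟨Integrable.congr ?_ h3.symm, ?_⟩
    · obtain ⟨C, hC⟩ := hξ'.2.2
      refine Integrable.of_bound (hm.comp (hx.measurable 0)).aestronglyMeasurable
        (1 / ε * C) (ae_of_all _ fun w => ?_)
      rw [norm_mul, Real.norm_of_nonneg (RWRE.ratio_pos _).le,
        Real.norm_of_nonneg (hξ'.2.1 _).le]
      exact mul_le_mul (RWRE.ratio_le hε.1 (hell' _).1) (hC _) (hξ'.2.1 _).le
        (one_div_nonneg.2 hε.1.le)
    · rw [inv_inv, integral_congr_ae h3, ← hx.map_eq 0,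
        ← integral_map (hx.measurable 0).aemeasurable hm.aestronglyMeasurable,
        integral_eq_lintegral_of_nonneg_ae (ae_of_all _ fun s =>
          mul_nonneg (RWRE.ratio_pos _).le (hξ'.2.1 _).le) hm.aestronglyMeasurable]
      congr 1
      refine lintegral_congr fun s => ?_
      rw [ENNReal.ofReal_mul (RWRE.ratio_pos _).le, hneu, RWRE.weight]
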